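/- Conventions. Let $\mathbf{A}$ be an abelian category, $T:\mathbf{A}\to\mathbf{E}$ an additive functor to an abelian category, and $\mathbf{P}\subseteq\mathbf{A}$ a full additive subcategory. $\mathbf{P}$ is called *$T$-projective* if (i) every object of $\mathbf{A}$ is a quotient of an object of $\mathbf{P}$; (ii) for every short exact sequence $0\to X'\to X\to X''\to 0$ in $\mathbf{A}$ with $X,X''\in\mathbf{P}$ also $X'\in\mathbf{P}$; (iii) for every such sequence $0\to T(X')\to T(X)\to T(X'')\to 0$ is exact. In that case the left satellites $L_nT:\mathbf{A}\to\mathbf{E}$, $n\ge 0$, are the functors $L_nT(X)=H_n(T(P_\bullet))$, where $0\leftarrow X\leftarrow P_0\leftarrow P_1\leftarrow\cdots$ is any resolution of $X$ with all $P_i\in\mathbf{P}$; an object $X$ is *$T$-acyclic* if $L_nT(X)=0$ for all $n>0$. Theorem. Let $\mathbf{C},\mathbf{D},\mathbf{E}$ be abelian categories and let $G:\mathbf{C}\to\mathbf{D}$ and $F:\mathbf{D}\to\mathbf{E}$ be right exact additive functors. Let $\mathbf{P}\subseteq\mathbf{C}$ be a $G$-projective and $\mathbf{Q}\subseteq\mathbf{D}$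 an $F$-projective full additive subcategory, and assume that $G(P)$ is $F$-acyclic for every $P\in\mathbf{P}$. Then $\mathbf{P}$ is $(F\circ G)$-projective, so that the left satellites $L_n(F\circ G)$ are defined by means of $\mathbf{P}$, and there exists a first quadrant spectral sequence, natural in $X\in\mathbf{C}$, $$E^2_{s,t}(X)=L_tF\bigl(L_sG(X)\bigr)\Longrightarrow L_{s+t}(F\circ G)(X),\qquad s,t\ge 0,$$ with differentials $d^r:E^r_{s,t}\to E^r_{s+r-1,t-r}$, $r\ge 2$. Explicitly: $X\mapsto E(X)$ is a functor from $\mathbf{C}$ to spectral sequences starting at the second page, with isomorphisms $E^2_{s,t}(X)\cong L_tF(L_sG(X))$ natural in $X$, and each functor $L_n(F\circ G)$ has a finite filtration by subfunctors $$0=\Phi_{-1}\subseteq\Phi_0\subseteq\cdots\subseteq\Phi_n=L_n(F\circ G)$$ together with isomorphisms $\Phi_t/\Phi_{t-1}\cong E^\infty_{n-t,t}$, natural in $X$, for $0\le t\le n$. -/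

import Mathlib

open CategoryTheory CategoryTheory.Limits

namespace GrothendieckSS

section Subcategories

variable {C : Type*} [Category* C] [Abelian C] {E : Type*} [Category* E] [Abelian E]

/-- The full subcategory of `C` on the objects satisfying `P` is additive: it contains a zero
object, and any two of its objects have a direct sum in it. -/
structure IsAdditiveSubcategory (P : ObjectProperty C) : Prop where
  zero : ∃ Z : C, P Z ∧ IsZero Z
  biprod : ∀ X Y : C, P X → P Y → ∃ Z : C, P Z ∧ Nonempty (Z ≅ X ⊞ Y)

/-- Any object of `C` is a quotient of an object satisfying `P`. -/
def IsGenerating (P : ObjectProperty C) : Prop :=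
  ∀ X : C, ∃ (Y : C) (p : Y ⟶ X), P Y ∧ Epi p

/-- For any short exact sequence `0 ⟶ X' ⟶ X ⟶ X'' ⟶ 0`, if `X` and `X''` satisfy `P`, then
so does `X'`. -/
def IsQuasiProjective (P : ObjectProperty C) : Prop :=
  ∀ S : ShortComplex C, S.ShortExact → P S.X₂ → P S.X₃ → P S.X₁

/-- The full additive subcategory of `C` on the objects satisfying `P` is `F`-projective. -/
structure IsProjectiveFor (F : C ⥤ E) [F.Additive] (P : ObjectProperty C) : Prop where
  additive : IsAdditiveSubcategory P
  generating : IsGenerating P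
  quasiProjective : IsQuasiProjective P
  shortExact_map : ∀ S : ShortComplex C, S.ShortExact → P S.X₂ → P S.X₃ → (S.map F).ShortExact

/-- A resolution `0 ⟵ X ⟵ P₀ ⟵ P₁ ⟵ ⋯` of `X` by objects satisfying `P`, i.e. a
quasi-isomorphism from a nonnegative chain complex of objects satisfying `P` to `X`, seen as a
complex concentrated in degree `0`. -/
structure Resolution (P : ObjectProperty C) (X : C) where
  complex : ChainComplex C ℕ
  mem : ∀ n, P (complex.X n)
  π : complex ⟶ (ChainComplex.single₀ C).obj X
  quasiIso : QuasiIso π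

end Subcategories

section Cover

variable {C : Type*} [Category* C] [Abelian C] {P : ObjectProperty C}

/-- The inductive step in the construction of resolutions of complexes. -/
lemma exists_step (hP : IsGenerating P) {W₀ X₀ X₁ : C} (w : W₀ ⟶ X₀) (d : X₁ ⟶ X₀) :
    ∃ (R W : C) (φ : R ⟶ X₁) (i : W ⟶ R) (e : R ⟶ W₀), P R ∧ Mono i ∧ i ≫ e = 0 ∧
      e ≫ w = φ ≫ d ∧ (∀ ⦃A : C⦄ (x : A ⟶ R), x ≫ e = 0 → ∃ y, y ≫ i = x) ∧
      ∀ ⦃A : C⦄ (a : A ⟶ W₀) (y : A ⟶ X₁), a ≫ w = y ≫ d →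
        ∃ (A' : C) (p : A' ⟶ A) (_ : Epi p) (x : A' ⟶ R), p ≫ a = x ≫ e ∧ p ≫ y = x ≫ φ := by
  obtain ⟨R, q, hR, hq⟩ := hP (pullback w d)
  refine ⟨R, kernel (q ≫ pullback.fst w d), q ≫ pullback.snd w d, kernel.ι _,
    q ≫ pullback.fst w d, hR, inferInstance, kernel.condition _, ?_, ?_, ?_⟩
  · rw [Category.assoc, Category.assoc, pullback.condition]
  · intro A x hx
    exact ⟨kernel.lift _ x hx, kernel.lift_ι _ _ _⟩
  · intro A a y h
    obtain ⟨A', p, hp, x, hx⟩ := surjective_up_to_refinements_of_epi q (pullback.lift a y h)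
    refine ⟨A', p, hp, x, ?_, ?_⟩
    · rw [← Category.assoc, ← hx, Category.assoc, pullback.lift_fst]
    · rw [← Category.assoc, ← hx, Category.assoc, pullback.lift_snd]

/-- The degree `n` part of a resolution of `K`: the object `R`, its map to `K.X n`, and its
subobject of cycles. -/
structure Stage (P : ObjectProperty C) (K : ChainComplex C ℕ) (n : ℕ) where
  R : C
  W : C
  φ : R ⟶ K.X n
  i : W ⟶ R
  mem : P R
  mono : Mono i

lemma exists_stages (hP : IsGenerating P) (K : ChainComplex C ℕ) :
    ∃ (S : ∀ n, Stage P K n) (e : ∀ n, (S (n + 1)).R ⟶ (S n).W),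
      IsIso (S 0).i ∧ Epi (S 0).φ ∧ ∀ n, (S (n + 1)).i ≫ e n = 0 ∧
      e n ≫ (S n).i ≫ (S n).φ = (S (n + 1)).φ ≫ K.d (n + 1) n ∧
      (∀ ⦃A : C⦄ (x : A ⟶ (S (n + 1)).R), x ≫ e n = 0 → ∃ y, y ≫ (S (n + 1)).i = x) ∧
      ∀ ⦃A : C⦄ (a : A ⟶ (S n).W) (y : A ⟶ K.X (n + 1)),
        a ≫ (S n).i ≫ (S n).φ = y ≫ K.d (n + 1) n →
        ∃ (A' : C) (p : A' ⟶ A) (_ : Epi p) (x : A' ⟶ (S (n + 1)).R),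
          p ≫ a = x ≫ e n ∧ p ≫ y = x ≫ (S (n + 1)).φ := by
  choose R W φ i e hR hi h using fun n (S : Stage P K n) =>
    exists_step hP (S.i ≫ S.φ) (K.d (n + 1) n)
  obtain ⟨R₀, q, hR₀, hq⟩ := hP (K.X 0)
  let S : ∀ n, Stage P K n := Nat.rec ⟨R₀, R₀, q, 𝟙 _, hR₀, inferInstance⟩
    (fun n S => ⟨R n S, W n S, φ n S, i n S, hR n S, hi n S⟩)
  exact ⟨S, fun n => e n (S n), inferInstanceAs (IsIso (𝟙 R₀)), hq, fun n => h n (S n)⟩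

/-- If `P` is generating, any nonnegative chain complex receives an epimorphic quasi-isomorphism
from a nonnegative chain complex of objects satisfying `P`. -/
lemma exists_cover (hP : IsGenerating P) (K : ChainComplex C ℕ) :
    ∃ (R : ChainComplex C ℕ) (p : R ⟶ K), (∀ n, P (R.X n)) ∧ Epi p ∧ QuasiIso p := by
  obtain ⟨M, W, i, e, φ, hM, hi, hd, hi₀, hφ₀, h⟩ : ∃ (M : ChainComplex C ℕ) (W : ℕ → C)
      (i : ∀ n, W n ⟶ M.X n) (e : ∀ n, M.X (n + 1) ⟶ W n) (φ : ∀ n, M.X n ⟶ K.X n),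
      (∀ n, P (M.X n)) ∧ (∀ n, Mono (i n)) ∧ (∀ n, M.d (n + 1) n = e n ≫ i n) ∧
      IsIso (i 0) ∧ Epi (φ 0) ∧ ∀ n, i (n + 1) ≫ e n = 0 ∧
      e n ≫ i n ≫ φ n = φ (n + 1) ≫ K.d (n + 1) n ∧
      (∀ ⦃A : C⦄ (x : A ⟶ M.X (n + 1)), x ≫ e n = 0 → ∃ y, y ≫ i (n + 1) = x) ∧
      ∀ ⦃A : C⦄ (a : A ⟶ W n) (y : A ⟶ K.X (n + 1)),
        a ≫ i n ≫ φ n = y ≫ K.d (n + 1) n →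
        ∃ (A' : C) (p : A' ⟶ A) (_ : Epi p) (x : A' ⟶ M.X (n + 1)),
          p ≫ a = x ≫ e n ∧ p ≫ y = x ≫ φ (n + 1) := by
    obtain ⟨S, e, h₀, h₁, h⟩ := exists_stages hP K
    refine ⟨ChainComplex.of (fun n => (S n).R) (fun n => e n ≫ (S n).i) (fun n => by
      rw [Category.assoc, reassoc_of% (h n).1, zero_comp, comp_zero]), fun n => (S n).W,
      fun n => (S n).i, e, fun n => (S n).φ, fun n => (S n).mem, fun n => (S n).mono,
      fun n => ChainComplex.of_d (fun n => (S n).R) (fun n => e n ≫ (S n).i) n, h₀, h₁, h⟩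
  -- cycles of `K` lift locally to cycles of `M`
  have lift_W : ∀ (n : ℕ) ⦃A : C⦄ (y : A ⟶ K.X n),
      y ≫ K.d n ((ComplexShape.down ℕ).next n) = 0 →
      ∃ (A' : C) (p : A' ⟶ A) (_ : Epi p) (w : A' ⟶ W n), p ≫ y = w ≫ i n ≫ φ n := by
    rintro (_ | n) A y hy
    · obtain ⟨A', p, hp, x, hx⟩ := surjective_up_to_refinements_of_epi (φ 0) y
      exact ⟨A', p, hp, x ≫ inv (i 0), by simp [hx]⟩
    · rw [ChainComplex.next_nat_succ] at hy
      obtain ⟨A', p, hp, x, h1, h2⟩ := (h n).2.2.2 0 y (by rw [hy, zero_comp])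
      obtain ⟨w, hw⟩ := (h n).2.2.1 x (by rw [← h1, comp_zero])
      exact ⟨A', p, hp, w, by rw [← Category.assoc, hw, h2]⟩
  have lift_cycles : ∀ (n : ℕ) ⦃A : C⦄ (x : A ⟶ M.X n),
      x ≫ M.d n ((ComplexShape.down ℕ).next n) = 0 → ∃ w : A ⟶ W n, w ≫ i n = x := by
    rintro (_ | n) A x hx
    · exact ⟨x ≫ inv (i 0), by simp⟩
    · rw [ChainComplex.next_nat_succ, hd] at hx
      have := hi n
      exact (h n).2.2.1 x (by rw [← cancel_mono (i n), Category.assoc, hx, zero_comp])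
  have i_d : ∀ n, i n ≫ M.d n ((ComplexShape.down ℕ).next n) = 0 := by
    rintro (_ | n)
    · rw [M.shape _ _ (by simp), comp_zero]
    · rw [ChainComplex.next_nat_succ, hd, reassoc_of% (h n).1, zero_comp]
  let π : M ⟶ K :=
    { f := φ
      comm' := by
        rintro _ n rfl
        rw [hd, Category.assoc, (h n).2.1] }
  refine ⟨M, π, hM, HomologicalComplex.epi_of_epi_f _ ?_, ⟨fun n => ?_⟩⟩
  · rintro (_ | n)
    · exact hφ₀
    · refine (epi_iff_surjective_up_to_refinements (φ (n + 1))).2 (fun A y => ?_)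
      obtain ⟨A', p, hp, w, hw⟩ := lift_W n (y ≫ K.d (n + 1) n) (by simp)
      obtain ⟨A'', p', hp', x, -, hx⟩ := (h n).2.2.2 w (p ≫ y) (by rw [← hw, Category.assoc])
      exact ⟨A'', p' ≫ p, epi_comp _ _, x, by rw [Category.assoc, hx]⟩
  · rw [quasiIsoAt_iff_isIso_homologyMap]
    have : Mono (HomologicalComplex.homologyMap π n) := by
      rw [HomologicalComplex.mono_homologyMap_iff_up_to_refinements _ (n + 1) n _
        (ChainComplex.prev _ _) rfl]
      intro A x hx y hy
      obtain ⟨w, rfl⟩ := lift_cycles n x hx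
      obtain ⟨A', p, hp, x', h1, -⟩ := (h n).2.2.2 w y (by
        rw [← hy, Category.assoc])
      exact ⟨A', p, hp, x', by rw [hd, ← Category.assoc, h1, Category.assoc]⟩
    have : Epi (HomologicalComplex.homologyMap π n) := by
      rw [HomologicalComplex.epi_homologyMap_iff_up_to_refinements _ (n + 1) n _
        (ChainComplex.prev _ _) rfl]
      intro A y hy
      obtain ⟨A', p, hp, w, hw⟩ := lift_W n y hy
      exact ⟨A', p, hp, w ≫ i n, by rw [Category.assoc, i_d, comp_zero], 0, by
        rw [hw, zero_comp, add_zero, Category.assoc]⟩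
    exact isIso_of_mono_of_epi _

/-- If `P` is generating, any object has a resolution by objects satisfying `P`. -/
lemma nonempty_resolution (hP : IsGenerating P) (X : C) : Nonempty (Resolution P X) := by
  obtain ⟨R, p, h, _, h'⟩ := exists_cover hP ((ChainComplex.single₀ C).obj X)
  exact ⟨⟨R, h, p, h'⟩⟩

end Cover

section TrivialFibrations

variable {C : Type*} [Category* C] [Abelian C]

lemma quasiIso_of_acyclic_kernel {S : ShortComplex (ChainComplex C ℕ)} (hS : S.ShortExact)
    (h : S.X₁.Acyclic) : QuasiIso S.g where
  quasiIsoAt n := by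
    rw [quasiIsoAt_iff_isIso_homologyMap]
    have h0 (n : ℕ) : IsZero (S.X₁.homology n) :=
      (HomologicalComplex.exactAt_iff_isZero_homology _ _).1 (h n)
    have : Mono (HomologicalComplex.homologyMap S.g n) :=
      (hS.homology_exact₂ n).mono_g ((h0 n).eq_of_src _ _)
    have : Epi (HomologicalComplex.homologyMap S.g n) := by
      cases n with
      | zero =>
        have := hS.epi_g
        exact HomologicalComplex.epi_homologyMap_of_epi_of_not_rel S.g 0 (by simp)
      | succ n => exact (hS.homology_exact₃ (n + 1) n rfl).epi_f ((h0 n).eq_of_tgt _ _)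
    exact isIso_of_mono_of_epi _

lemma shortExact_kernel {K L : ChainComplex C ℕ} (p : K ⟶ L) [Epi p] :
    (ShortComplex.mk (kernel.ι p) p (kernel.condition p)).ShortExact where
  exact := ShortComplex.exact_of_f_is_kernel _ (kernelIsKernel p)

lemma quasiIso_pullback_fst {K L M : ChainComplex C ℕ} (g : K ⟶ M) (p : L ⟶ M) [Epi p]
    [QuasiIso p] : QuasiIso (pullback.fst g p) := by
  let S : ShortComplex (ChainComplex C ℕ) :=
    ShortComplex.mk (pullback.lift 0 (kernel.ι p) (by simp) : kernel p ⟶ pullback g p)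
      (pullback.fst g p) (pullback.lift_fst _ _ _)
  have hm : Mono S.f := by
    have : Mono (S.f ≫ pullback.snd g p) := by
      have h : S.f ≫ pullback.snd g p = kernel.ι p := pullback.lift_snd _ _ _
      rw [h]; infer_instance
    exact mono_of_mono _ (pullback.snd g p)
  have hS : S.ShortExact :=
    { exact := by
        apply S.exact_of_f_is_kernel
        refine KernelFork.IsLimit.ofι' _ _ (fun {A} k hk => ⟨kernel.lift p (k ≫ pullback.snd g p) ?_, ?_⟩)
        · rw [Category.assoc, ← pullback.condition, ← Category.assoc]
          erw [hk]; rw [zero_comp]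
        · apply pullback.hom_ext
          · rw [Category.assoc]
            erw [pullback.lift_fst]
            rw [comp_zero]; exact hk.symm
          · rw [Category.assoc]
            erw [pullback.lift_snd]
            rw [kernel.lift_ι]
      mono_f := hm
      epi_g := inferInstanceAs (Epi (pullback.fst g p)) }
  exact quasiIso_of_acyclic_kernel hS ((shortExact_kernel p).acyclic_X₁ ‹_›)

/-- A quasi-isomorphism to a complex concentrated in degree `0` is an epimorphism. -/
lemma Resolution.epi_π {P : ObjectProperty C} {X : C} (R : Resolution P X) : Epi R.π := by
  have := R.quasiIso
  have h0 : Epi (HomologicalComplex.homologyMap R.π 0) := inferInstance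
  refine HomologicalComplex.epi_of_epi_f _ ?_
  rintro (_ | n)
  · rw [HomologicalComplex.epi_homologyMap_iff_up_to_refinements _ 1 0 _
        (ChainComplex.prev _ _) rfl] at h0
    refine (epi_iff_surjective_up_to_refinements _).2 (fun A y => ?_)
    obtain ⟨A', p, hp, x, -, y', h⟩ := h0 y (by
      rw [HomologicalComplex.shape _ _ _ (by simp), comp_zero])
    exact ⟨A', p, hp, x, by
      rw [h, HomologicalComplex.single_obj_d]
      erw [comp_zero]
      rw [add_zero]⟩
  · have : IsZero (((ChainComplex.single₀ C).obj X).X (n + 1)) :=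
      HomologicalComplex.isZero_single_obj_X _ _ _ _ (by simp)
    exact ⟨fun _ _ _ => this.eq_of_src _ _⟩

end TrivialFibrations

section Homology

variable {C : Type*} [Category* C] [Abelian C] {E : Type*} [Category* E] [Abelian E]

/-- The functor `K ↦ H_n(F(K))` on nonnegative chain complexes. -/
noncomputable abbrev homologyMapFunctor (F : C ⥤ E) [F.Additive] (n : ℕ) : ChainComplex C ℕ ⥤ E :=
  F.mapHomologicalComplex (ComplexShape.down ℕ) ⋙ HomologicalComplex.homologyFunctor E _ n

variable {F : C ⥤ E} [F.Additive] {P : ObjectProperty C}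

/-- The short exact sequences `0 ⟶ Z_{n+1} ⟶ K_{n+1} ⟶ Z_n ⟶ 0` of an acyclic complex. -/
lemma shortExact_cycles {K : ChainComplex C ℕ} (hK : K.Acyclic) (n : ℕ) :
    (ShortComplex.mk (K.iCycles (n + 1)) (K.toCycles (n + 1) n) (by
      rw [← cancel_mono (K.iCycles n)]; simp)).ShortExact where
  exact := by
    apply ShortComplex.exact_of_f_is_kernel
    refine KernelFork.IsLimit.ofι' _ _ (fun {A} k hk => ⟨K.liftCycles k n (by simp) ?_,
      K.liftCycles_i _ _ _ _⟩)
    rw [← K.toCycles_i (n + 1) n, ← Category.assoc, hk, zero_comp]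
  epi_g := by
    refine (epi_iff_surjective_up_to_refinements (K.toCycles (n + 1) n)).2 (fun A y => ?_)
    obtain ⟨A', p, hp, x, hx⟩ := (K.exactAt_iff_exact_up_to_refinements (n + 1) n _
      (ChainComplex.prev _ _) rfl).1 (hK n) (y ≫ K.iCycles n) (by simp)
    exact ⟨A', p, hp, x, by rw [← cancel_mono (K.iCycles n)]; simpa using hx⟩

lemma IsProjectiveFor.prop_cycles (hP : IsProjectiveFor F P) {K : ChainComplex C ℕ}
    (hK : K.Acyclic) (hK' : ∀ n, P (K.X n)) (n : ℕ) : P (K.cycles n) := by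
  induction n with
  | zero =>
    obtain ⟨Z, hZ, hZ'⟩ := hP.additive.zero
    exact hP.quasiProjective (ShortComplex.mk (K.iCycles 0) (0 : K.X 0 ⟶ Z) (by simp))
      { exact := by
          apply ShortComplex.exact_of_f_is_kernel
          exact KernelFork.IsLimit.ofι' _ _ (fun {A} k hk =>
            ⟨K.liftCycles k _ rfl (by rw [K.shape _ _ (by simp), comp_zero]),
              K.liftCycles_i _ _ _ _⟩)
        epi_g := ⟨fun _ _ _ => hZ'.eq_of_src _ _⟩ } (hK' 0) hZ
  | succ n ih => exact hP.quasiProjective _ (shortExact_cycles hK n) (hK' _) ih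

lemma IsProjectiveFor.acyclic_map (hP : IsProjectiveFor F P) {K : ChainComplex C ℕ}
    (hK : K.Acyclic) (hK' : ∀ n, P (K.X n)) :
    ((F.mapHomologicalComplex (ComplexShape.down ℕ)).obj K).Acyclic := by
  have hS (n : ℕ) := hP.shortExact_map _ (shortExact_cycles hK n) (hK' (n + 1))
    (hP.prop_cycles hK hK' n)
  have hi (n : ℕ) : Mono (F.map (K.iCycles n)) := by
    cases n with
    | zero =>
      infer_instance
    | succ n => exact (hS n).mono_f
  have ht (n : ℕ) : Epi (F.map (K.toCycles (n + 1) n)) := (hS n).epi_g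
  have key : ∀ (n : ℕ) ⦃A : E⦄ (x : A ⟶ F.obj (K.X n)),
      x ≫ F.map (K.d n ((ComplexShape.down ℕ).next n)) = 0 →
      ∃ (A' : E) (p : A' ⟶ A) (_ : Epi p) (y : A' ⟶ F.obj (K.X (n + 1))),
        p ≫ x = y ≫ F.map (K.d (n + 1) n) := by
    intro n A x hx
    obtain ⟨A', p, hp, z, hz⟩ : ∃ (A' : E) (p : A' ⟶ A) (_ : Epi p)
        (z : A' ⟶ F.obj (K.cycles n)), p ≫ x = z ≫ F.map (K.iCycles n) := by
      cases n with
      | zero => exact ⟨A, 𝟙 A, inferInstance, x ≫ inv (F.map (K.iCycles 0)), by simp⟩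
      | succ n =>
        refine (hS n).exact.exact_up_to_refinements x ?_
        have := hi n
        rw [ChainComplex.next_nat_succ, ← K.toCycles_i, F.map_comp, ← Category.assoc] at hx
        have h0 : x ≫ F.map (K.toCycles (n + 1) n) = 0 := by
          rw [← cancel_mono (F.map (K.iCycles n)), zero_comp]
          exact hx
        exact h0
    obtain ⟨A'', q, hq, y, hy⟩ := surjective_up_to_refinements_of_epi
      (F.map (K.toCycles (n + 1) n)) z
    refine ⟨A'', q ≫ p, epi_comp _ _, y, ?_⟩
    rw [Category.assoc, hz, ← Category.assoc, hy, Category.assoc, ← F.map_comp, K.toCycles_i]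
  intro n
  rw [HomologicalComplex.exactAt_iff_exact_up_to_refinements _ (n + 1) n _
    (ChainComplex.prev _ _) rfl]
  exact key n

lemma IsProjectiveFor.isIso_map (hP : IsProjectiveFor F P) {K L : ChainComplex C ℕ} (p : K ⟶ L)
    [Epi p] [QuasiIso p] (hK : ∀ n, P (K.X n)) (hL : ∀ n, P (L.X n)) (n : ℕ) :
    IsIso ((homologyMapFunctor F n).map p) := by
  have hS := shortExact_kernel p
  have hS' := (HomologicalComplex.shortExact_iff_degreewise_shortExact _).1 hS
  let S := ShortComplex.mk (kernel.ι p) p (kernel.condition p)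
  let T := S.map (F.mapHomologicalComplex (ComplexShape.down ℕ))
  have hT : T.ShortExact := HomologicalComplex.shortExact_of_degreewise_shortExact T
    (fun i => hP.shortExact_map _ (hS' i) (hK i) (hL i))
  have : QuasiIso T.g := quasiIso_of_acyclic_kernel hT (hP.acyclic_map (hS.acyclic_X₁ ‹_›)
    (fun i => hP.quasiProjective _ (hS' i) (hK i) (hL i)))
  exact inferInstanceAs (IsIso (HomologicalComplex.homologyMap T.g n))

/-- Two chain maps between complexes of objects satisfying `P` which agree after composition with
an epimorphic quasi-isomorphism induce the same map on `H_n(F(-))`. -/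
lemma IsProjectiveFor.map_eq (hP : IsProjectiveFor F P) {K L M : ChainComplex C ℕ}
    (hK : ∀ n, P (K.X n)) (hL : ∀ n, P (L.X n)) (p : L ⟶ M) [Epi p] [QuasiIso p]
    (a b : K ⟶ L) (h : a ≫ p = b ≫ p) (n : ℕ) :
    (homologyMapFunctor F n).map a = (homologyMapFunctor F n).map b := by
  let H := homologyMapFunctor F n
  -- a cover of the fibre product of `L` with itself
  have hfst : QuasiIso (pullback.fst p p) := quasiIso_pullback_fst p p
  have hsnd : QuasiIso (pullback.snd p p) := by
    rw [← pullbackSymmetry_hom_comp_fst]; infer_instance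
  obtain ⟨S, s, hS, _, _⟩ := exists_cover hP.generating (pullback p p)
  have h₁ : IsIso (H.map (s ≫ pullback.fst p p)) := hP.isIso_map _ hS hL n
  have h₂ : H.map (s ≫ pullback.fst p p) = H.map (s ≫ pullback.snd p p) := by
    have := quasiIso_pullback_fst (pullback.lift (𝟙 L) (𝟙 L) rfl : L ⟶ pullback p p) s
    obtain ⟨T, t, hT, _, _⟩ := exists_cover hP.generating
      (pullback (pullback.lift (𝟙 L) (𝟙 L) rfl : L ⟶ pullback p p) s)
    have h₃ : (t ≫ pullback.snd _ _) ≫ s ≫ pullback.fst p p = t ≫ pullback.fst _ _ := by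
      rw [Category.assoc, ← pullback.condition_assoc, pullback.lift_fst, Category.comp_id]
    have h₄ : (t ≫ pullback.snd _ _) ≫ s ≫ pullback.snd p p = t ≫ pullback.fst _ _ := by
      rw [Category.assoc, ← pullback.condition_assoc, pullback.lift_snd, Category.comp_id]
    have h₅ : IsIso (H.map (t ≫ pullback.fst
      (pullback.lift (𝟙 L) (𝟙 L) rfl : L ⟶ pullback p p) s)) := hP.isIso_map _ hT hL n
    have h₆ : IsIso (H.map (t ≫ pullback.snd
        (pullback.lift (𝟙 L) (𝟙 L) rfl : L ⟶ pullback p p) s)) := by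
      rw [← h₃, H.map_comp] at h₅
      exact IsIso.of_isIso_comp_right _ (H.map (s ≫ pullback.fst p p))
    rw [← cancel_epi (H.map (t ≫ pullback.snd
        (pullback.lift (𝟙 L) (𝟙 L) rfl : L ⟶ pullback p p) s)), ← H.map_comp, ← H.map_comp,
      h₃, h₄]
  have := quasiIso_pullback_fst (pullback.lift a b h) s
  obtain ⟨T, t, hT, _, _⟩ := exists_cover hP.generating (pullback (pullback.lift a b h) s)
  have h₃ : IsIso (H.map (t ≫ pullback.fst (pullback.lift a b h) s)) := hP.isIso_map _ hT hK n
  change H.map a = H.map b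
  rw [← cancel_epi (H.map (t ≫ pullback.fst (pullback.lift a b h) s)), ← H.map_comp, ← H.map_comp]
  have h₄ : (t ≫ pullback.fst (pullback.lift a b h) s) ≫ a =
      (t ≫ pullback.snd _ _) ≫ s ≫ pullback.fst p p := by
    rw [Category.assoc, Category.assoc, ← pullback.condition_assoc, pullback.lift_fst]
  have h₅ : (t ≫ pullback.fst (pullback.lift a b h) s) ≫ b =
      (t ≫ pullback.snd _ _) ≫ s ≫ pullback.snd p p := by
    rw [Category.assoc, Category.assoc, ← pullback.condition_assoc, pullback.lift_snd]
  rw [h₄, h₅, H.map_comp, h₂, ← H.map_comp]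

end Homology

section Satellites

variable {C : Type*} [Category* C] [Abelian C] {E : Type*} [Category* E] [Abelian E]
  {F : C ⥤ E} [F.Additive] {P : ObjectProperty C}

/-- For a morphism `f : X ⟶ Y` and resolutions `A` of `X` and `B` of `Y`, there is a unique
morphism `H_n(F(A)) ⟶ H_n(F(B))` which is compatible with all pairs of chain maps from a complex `R`
of objects satisfying `P` to `A` and to `B` that lie over `f`. -/
lemma IsProjectiveFor.existsUnique_map (hP : IsProjectiveFor F P) (n : ℕ) {X Y : C} (f : X ⟶ Y)
    (A : Resolution P X) (B : Resolution P Y) :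
    ∃! u : (homologyMapFunctor F n).obj A.complex ⟶ (homologyMapFunctor F n).obj B.complex,
      ∀ (R : ChainComplex C ℕ) (a : R ⟶ A.complex) (b : R ⟶ B.complex), (∀ i, P (R.X i)) →
        a ≫ A.π ≫ (ChainComplex.single₀ C).map f = b ≫ B.π →
        (homologyMapFunctor F n).map a ≫ u = (homologyMapFunctor F n).map b := by
  let H := homologyMapFunctor F n
  have := B.epi_π
  have := B.quasiIso
  have := quasiIso_pullback_fst (A.π ≫ (ChainComplex.single₀ C).map f) B.π
  obtain ⟨S, s, hS, _, _⟩ := exists_cover hP.generating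
    (pullback (A.π ≫ (ChainComplex.single₀ C).map f) B.π)
  let a₀ : S ⟶ A.complex := s ≫ pullback.fst _ _
  let b₀ : S ⟶ B.complex := s ≫ pullback.snd _ _
  have h₀ : a₀ ≫ A.π ≫ (ChainComplex.single₀ C).map f = b₀ ≫ B.π := by
    simp only [a₀, b₀, Category.assoc, pullback.condition]
  have : Epi a₀ := epi_comp _ _
  have : QuasiIso a₀ := inferInstanceAs (QuasiIso (s ≫ pullback.fst _ _))
  have : IsIso (H.map a₀) := hP.isIso_map a₀ hS A.mem n
  refine ⟨inv (H.map a₀) ≫ H.map b₀, ?_, ?_⟩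
  · intro R a b hR h
    have := quasiIso_pullback_fst a a₀
    obtain ⟨T, t, hT, _, _⟩ := exists_cover hP.generating (pullback a a₀)
    have : IsIso (H.map (t ≫ pullback.fst a a₀)) := hP.isIso_map _ hT hR n
    have h₁ : (t ≫ pullback.fst a a₀) ≫ a = (t ≫ pullback.snd a a₀) ≫ a₀ := by
      simp only [Category.assoc, pullback.condition]
    have h₂ : H.map ((t ≫ pullback.fst a a₀) ≫ b) = H.map ((t ≫ pullback.snd a a₀) ≫ b₀) :=
      hP.map_eq hT B.mem B.π _ _ (by
        rw [Category.assoc _ b, ← h, Category.assoc _ b₀, ← h₀, ← Category.assoc, h₁,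
          Category.assoc]) n
    change H.map a ≫ inv (H.map a₀) ≫ H.map b₀ = H.map b
    rw [← cancel_epi (H.map (t ≫ pullback.fst a a₀)), ← H.map_comp _ b, h₂, ← Category.assoc,
      ← H.map_comp, h₁, H.map_comp _ a₀, Category.assoc, IsIso.hom_inv_id_assoc, ← H.map_comp]
  · intro u hu
    rw [IsIso.eq_inv_comp]
    exact hu S a₀ b₀ hS h₀

/-- The morphism `H_n(F(A)) ⟶ H_n(F(B))` induced by a morphism `f : X ⟶ Y`, for resolutions `A` of
`X` and `B` of `Y`. -/
noncomputable def IsProjectiveFor.resolutionMap (hP : IsProjectiveFor F P) (n : ℕ) {X Y : C}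
    (f : X ⟶ Y) (A : Resolution P X) (B : Resolution P Y) :
    (homologyMapFunctor F n).obj A.complex ⟶ (homologyMapFunctor F n).obj B.complex :=
  (hP.existsUnique_map n f A B).choose

lemma IsProjectiveFor.map_resolutionMap (hP : IsProjectiveFor F P) (n : ℕ) {X Y : C}
    (f : X ⟶ Y) (A : Resolution P X) (B : Resolution P Y) (R : ChainComplex C ℕ)
    (a : R ⟶ A.complex) (b : R ⟶ B.complex) (hR : ∀ i, P (R.X i))
    (h : a ≫ A.π ≫ (ChainComplex.single₀ C).map f = b ≫ B.π) :
    (homologyMapFunctor F n).map a ≫ hP.resolutionMap n f A B = (homologyMapFunctor F n).map b :=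
  (hP.existsUnique_map n f A B).choose_spec.1 R a b hR h

lemma IsProjectiveFor.resolutionMap_id (hP : IsProjectiveFor F P) (n : ℕ) {X : C}
    (A : Resolution P X) : hP.resolutionMap n (𝟙 X) A A = 𝟙 _ := by
  refine ((hP.existsUnique_map n (𝟙 X) _ _).choose_spec.2 _ (fun R a b hR h => ?_)).symm
  have := A.epi_π
  have := A.quasiIso
  rw [Category.comp_id]
  exact hP.map_eq hR A.mem A.π a b (by simpa using h) n

lemma IsProjectiveFor.resolutionMap_comp (hP : IsProjectiveFor F P) (n : ℕ) {X Y Z : C}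
    (f : X ⟶ Y) (g : Y ⟶ Z) (A : Resolution P X) (B : Resolution P Y) (D : Resolution P Z) :
    hP.resolutionMap n (f ≫ g) A D = hP.resolutionMap n f A B ≫ hP.resolutionMap n g B D := by
  refine ((hP.existsUnique_map n (f ≫ g) _ _).choose_spec.2 _ (fun R a b hR h => ?_)).symm
  let H := homologyMapFunctor F n
  have := B.epi_π
  have := B.quasiIso
  have := quasiIso_pullback_fst (a ≫ A.π ≫ (ChainComplex.single₀ C).map f) B.π
  obtain ⟨T, t, hT, _, _⟩ := exists_cover hP.generating
    (pullback (a ≫ A.π ≫ (ChainComplex.single₀ C).map f) B.π)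
  let r : T ⟶ R := t ≫ pullback.fst _ _
  let c : T ⟶ B.complex := t ≫ pullback.snd _ _
  have hc : (r ≫ a) ≫ A.π ≫ (ChainComplex.single₀ C).map f = c ≫ B.π := by
    simp only [r, c, Category.assoc, pullback.condition]
  have : Epi r := epi_comp _ _
  have : QuasiIso r := inferInstanceAs (QuasiIso (t ≫ pullback.fst _ _))
  have : IsIso (H.map r) := hP.isIso_map r hT hR n
  have h₁ := hP.map_resolutionMap n f A B T (r ≫ a) c hT hc
  have h₂ := hP.map_resolutionMap n g B D T c (r ≫ b) hT (by
    rw [Category.assoc r b, ← h, ← Category.assoc c, ← hc, Functor.map_comp]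
    simp only [Category.assoc])
  rw [← cancel_epi (H.map r), ← H.map_comp, ← h₂, ← h₁, ← Category.assoc, ← H.map_comp,
    ← Category.assoc]

/-- The canonical isomorphism `H_n(F(A)) ≅ H_n(F(B))` for two resolutions `A` and `B` of `X`. -/
noncomputable def IsProjectiveFor.resolutionIso (hP : IsProjectiveFor F P) (n : ℕ) {X : C}
    (A B : Resolution P X) :
    (homologyMapFunctor F n).obj A.complex ≅ (homologyMapFunctor F n).obj B.complex where
  hom := hP.resolutionMap n (𝟙 X) A B
  inv := hP.resolutionMap n (𝟙 X) B A
  hom_inv_id := by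
    rw [← hP.resolutionMap_comp, Category.comp_id, hP.resolutionMap_id]
  inv_hom_id := by
    rw [← hP.resolutionMap_comp, Category.comp_id, hP.resolutionMap_id]

/-- The chosen resolution of an object. -/
noncomputable def IsProjectiveFor.resolution (hP : IsProjectiveFor F P) (X : C) :
    Resolution P X :=
  (nonempty_resolution hP.generating X).some

/-- The `n`-th left satellite `L_n F : C ⥤ E` of `F`, computed with an `F`-projective
subcategory `P`: it sends `X` to `H_n(F(P_•))` for a resolution `P_•` of `X` by objects satisfying
`P`. -/
noncomputable def leftSatellite (F : C ⥤ E) [F.Additive] {P : ObjectProperty C}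
    (hP : IsProjectiveFor F P) (n : ℕ) : C ⥤ E where
  obj X := (homologyMapFunctor F n).obj (hP.resolution X).complex
  map f := hP.resolutionMap n f (hP.resolution _) (hP.resolution _)
  map_id _ := hP.resolutionMap_id n _
  map_comp f g := hP.resolutionMap_comp n f g _ _ _

/-- The left satellites can be computed with any resolution. -/
noncomputable def leftSatelliteIso (hP : IsProjectiveFor F P) (n : ℕ) {X : C}
    (A : Resolution P X) :
    (leftSatellite F hP n).obj X ≅ (homologyMapFunctor F n).obj A.complex :=
  hP.resolutionIso n (hP.resolution X) A

/-- An object `X` is `F`-acyclic if `L_n F (X) = 0` for all `n > 0`. -/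
def IsAcyclicFor (F : C ⥤ E) [F.Additive] {P : ObjectProperty C} (hP : IsProjectiveFor F P)
    (X : C) : Prop :=
  ∀ n : ℕ, 0 < n → IsZero ((leftSatellite F hP n).obj X)

end Satellites

section SpectralSequences

/-- First quadrant spectral sequences `(E^r_{s,t}, d^r)`, `r ≥ 2`, `s, t ≥ 0`, in an abelian
category, with differentials `d^r : E^r_{s,t} ⟶ E^r_{s+r-1,t-r}`. -/
abbrev E2SpectralSequence (A : Type*) [Category* A] [Abelian A] :=
  SpectralSequence A (fun r : ℤ => ComplexShape.spectralSequenceNat (r - 1, -r)) 2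

variable {A : Type*} [Category* A] [Abelian A]

/-- The term `E^r_{s,t}`, as a functor of the spectral sequence. -/
noncomputable def pageTerm (r : ℤ) (hr : 2 ≤ r) (s t : ℕ) : E2SpectralSequence A ⥤ A :=
  SpectralSequence.pageFunctor A _ 2 r hr ⋙ HomologicalComplex.eval A _ (s, t)

/-- For `r ≥ s + t + 2` the differentials `d^r` which start or end at `E^r_{s,t}` vanish. -/
lemma page_d_eq_zero (E : E2SpectralSequence A) (s t : ℕ) (r : ℤ) (hr : s + t + 2 ≤ r)
    (hr' : 2 ≤ r) (x : ℕ × ℕ) :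
    (E.page r hr').d (s, t) x = 0 ∧ (E.page r hr').d x (s, t) = 0 := by
  constructor <;> apply HomologicalComplex.shape <;>
    simp only [ComplexShape.spectralSequenceNat_rel_iff] <;> omega

/-- The term `E^∞_{s,t}`: the common value of the terms `E^r_{s,t}` for `r ≥ s + t + 2`, all
differentials from and to which vanish. -/
noncomputable def pageInfinity (s t : ℕ) : E2SpectralSequence A ⥤ A :=
  pageTerm (s + t + 2) (by omega) s t

/-- Convergence `E^2_{s,t}(X) ⟹ H_{s+t}(X)`, natural in `X`, of a first quadrant spectral sequence
`E(X)` depending functorially on `X : C`: each functor `H n` has a finite filtration by subfunctors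
`0 = fil n 0 ⊆ fil n 1 ⊆ ⋯ ⊆ fil n (n + 1) = H n`, and there are natural isomorphisms
`fil (s + t) (t + 1) / fil (s + t) t ≅ E^∞_{s,t}`. -/
structure ConvergesTo {C : Type*} [Category* C] (E : C ⥤ E2SpectralSequence A)
    (H : ℕ → C ⥤ A) where
  fil (n p : ℕ) : C ⥤ A
  ι (n p : ℕ) : fil n p ⟶ H n
  mono_ι (n p : ℕ) (X : C) : Mono ((ι n p).app X)
  incl (n p : ℕ) : fil n p ⟶ fil n (p + 1)
  incl_ι (n p : ℕ) : incl n p ≫ ι n (p + 1) = ι n p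
  isZero_fil (n : ℕ) (X : C) : IsZero ((fil n 0).obj X)
  isIso_ι (n : ℕ) : IsIso (ι n (n + 1))
  π (s t : ℕ) : fil (s + t) (t + 1) ⟶ E ⋙ pageInfinity s t
  zero (s t : ℕ) (X : C) : (incl (s + t) t).app X ≫ (π s t).app X = 0
  shortExact (s t : ℕ) (X : C) : (ShortComplex.mk _ _ (zero s t X)).ShortExact

end SpectralSequences

end GrothendieckSS

/-! A nonnegative complex K in D has a hyperhomology spectral sequence for its canonical filtration.
Let T_s K be the quotient of K that keeps H_i for i < s. The kernel of T_{s+1} K → T_s K is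
quasi-isomorphic to H_s(K) placed in degree s, so its hyperhomology in degree s + t is L_tF(H_s(K)).
Take K = G(P_•) for a resolution P_• of X by objects of P. Then H_s(K) = L_sG(X), which gives the
second page. The abutment is the hyperhomology of K, and it equals H_n(F(G(P_•))) = L_n(F ∘ G)(X)
because the terms of K are F-acyclic: right exactness of F makes the F-acyclic objects an
F-projective subcategory (`isProjectiveFor_isAcyclicFor`), so F may be applied to K directly
(`compHyperIso`). The underlying fact, that F preserves short exact sequences with acyclic last
term, also shows that P is (F ∘ G)-projective.

Objects of P and Q need not be projective: a morphism lifts to resolutions only after the source is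
refined, and homotopy uniqueness is not available. Well-definedness and naturality therefore rest on
one formal device (`IsResolving`): trivial fibrations which are stable under base change and cover
every object by a good one. A functor on good objects that inverts trivial fibrations has a derived
functor (`derived`), and isomorphisms out of it may be given on resolutions (`derivedIso`). This is
used for complexes (hyperhomology and satellites), for towers of complexes, and for resolutions of X
with values in spectral objects.

The tower of truncations is resolved by a tower of epimorphisms between complexes of objects of Q.
Kernels of its transition maps again consist of objects of Q, so F keeps the sequences 0 → ker f →
ker(f ≫ g) → ker g → 0 exact, and the long exact homology sequences form a spectral object indexed
by `ℕᵒᵈ`. It is independent of choices by `trivialFibrations_kernelFunctorMap`, and invariant under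
trivial fibrations of K by `towerTrivialFibrations_truncTower`.

For naturality in X of every page and every filtration step, the functor from C to spectral objects
is read as one spectral object in the functor category C ⥤ E (`flipSpectralObject`); the spectral
sequence is built there and then evaluated at X. -/

namespace GrothendieckSS

/-! ### Derived functors along a class of trivial fibrations. -/

section Deriving

variable {M : Type*} [Category* M]

/-- `W` is a class of trivial fibrations between the objects satisfying `B`, by means of which
any of these objects can be resolved by an object satisfying `G`. -/
structure IsResolving (W : MorphismProperty M) (B G : ObjectProperty M) : Prop where
  le : G ≤ B
  comp : ∀ {X Y Z : M} (f : X ⟶ Y) (g : Y ⟶ Z), W f → W g → W (f ≫ g)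
  cover : ∀ X, B X → ∃ (R : M) (p : R ⟶ X), G R ∧ W p
  pullback : ∀ {X Y Z : M} (f : X ⟶ Z) (w : Y ⟶ Z), B X → B Y → B Z → W w →
    ∃ (T : M) (p : T ⟶ X) (q : T ⟶ Y), IsPullback p q f w ∧ B T ∧ W p

/-- A resolution of `X` by an object satisfying `G`. -/
structure Cover (W : MorphismProperty M) (G : ObjectProperty M) (X : M) where
  obj : G.FullSubcategory
  π : obj.obj ⟶ X
  prop : W π

variable {W : MorphismProperty M} {B G : ObjectProperty M} {A : Type*} [Category* A]

/-- The functor `H` inverts the trivial fibrations between objects satisfying `G`. -/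
def Inverts (W : MorphismProperty M) (H : G.FullSubcategory ⥤ A) : Prop :=
  ∀ ⦃R S : G.FullSubcategory⦄ (p : R ⟶ S), W p.hom → IsIso (H.map p)

namespace IsResolving

variable (h : IsResolving W B G)

include h

/-- Substitute for lifting a morphism to resolutions: `f` lifts through `w` once X is replaced by a
good cover of the fibre product. -/
lemma exists_cover_square {X Y Z : M} (f : X ⟶ Z) (w : Y ⟶ Z) (hX : B X) (hY : B Y)
    (hZ : B Z) (hw : W w) :
    ∃ (c : Cover W G X) (q : c.obj.obj ⟶ Y), c.π ≫ f = q ≫ w := by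
  obtain ⟨T, p, q, sq, hT, hp⟩ := h.pullback f w hX hY hZ hw
  obtain ⟨R, r, hR, hr⟩ := h.cover T hT
  exact ⟨⟨⟨R, hR⟩, r ≫ p, h.comp _ _ hr hp⟩, r ≫ q, by simp [sq.w]⟩

variable {H : G.FullSubcategory ⥤ A} (hH : Inverts W H)

include hH

/-- Replaces uniqueness up to homotopy. The universal case is that of the two projections `q₁`, `q₂`
from a good cover of the fibre product of `c` with itself. A local lift `u'` of the diagonal
equalizes them, and `H.map u'` is invertible because both `H.map q₁` and the composite are. -/
lemma map_eq {R : G.FullSubcategory} {X : M} (hX : B X) (c : Cover W G X) (a b : R ⟶ c.obj)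
    (hab : a.hom ≫ c.π = b.hom ≫ c.π) : H.map a = H.map b := by
  have hc := h.le _ c.obj.property
  obtain ⟨K, p₁, p₂, sq, hK, hp₁⟩ := h.pullback c.π c.π hc hc hX c.prop
  obtain ⟨N, s, hN, hs⟩ := h.cover K hK
  let N' : G.FullSubcategory := ⟨N, hN⟩
  let q₁ : N' ⟶ c.obj := ObjectProperty.homMk (s ≫ p₁)
  let q₂ : N' ⟶ c.obj := ObjectProperty.homMk (s ≫ p₂)
  have h₁ : IsIso (H.map q₁) := hH _ (h.comp _ _ hs hp₁)
  have h₂ : H.map q₁ = H.map q₂ := by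
    obtain ⟨T, u, hu⟩ := h.exists_cover_square (sq.lift (𝟙 _) (𝟙 _) rfl) s hc
      (h.le _ hN) hK hs
    let t : T.obj ⟶ c.obj := ObjectProperty.homMk T.π
    let u' : T.obj ⟶ N' := ObjectProperty.homMk u
    have e₁ : u' ≫ q₁ = t := by
      ext
      change u ≫ s ≫ p₁ = T.π
      rw [← reassoc_of% hu, sq.lift_fst, Category.comp_id]
    have e₂ : u' ≫ q₂ = t := by
      ext
      change u ≫ s ≫ p₂ = T.π
      rw [← reassoc_of% hu, sq.lift_snd, Category.comp_id]
    have h₃ : IsIso (H.map t) := hH _ T.prop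
    have h₄ : IsIso (H.map u') := by
      rw [← e₁, H.map_comp] at h₃
      exact IsIso.of_isIso_comp_right _ (H.map q₁)
    rw [← cancel_epi (H.map u'), ← H.map_comp, ← H.map_comp, e₁, e₂]
  obtain ⟨T, u, hu⟩ := h.exists_cover_square (sq.lift a.hom b.hom hab) s (h.le _ R.property)
    (h.le _ hN) hK hs
  let t : T.obj ⟶ R := ObjectProperty.homMk T.π
  let u' : T.obj ⟶ N' := ObjectProperty.homMk u
  have e₁ : u' ≫ q₁ = t ≫ a := by
    ext
    change u ≫ s ≫ p₁ = T.π ≫ a.hom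
    rw [← reassoc_of% hu, sq.lift_fst]
  have e₂ : u' ≫ q₂ = t ≫ b := by
    ext
    change u ≫ s ≫ p₂ = T.π ≫ b.hom
    rw [← reassoc_of% hu, sq.lift_snd]
  have h₃ : IsIso (H.map t) := hH _ T.prop
  rw [← cancel_epi (H.map t), ← H.map_comp, ← H.map_comp, ← e₁, ← e₂, H.map_comp, h₂,
    H.map_comp]

/-- A good cover of the fibre product gives a span whose left leg lies in W, so the only candidate
is the inverse of one leg followed by the other. Any other span is compared with this one after a
further cover, where `map_eq` applies. -/
lemma existsUnique_map {X Y : M} (hY : B Y) (f : X ⟶ Y) (c : Cover W G X)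
    (d : Cover W G Y) :
    ∃! u : H.obj c.obj ⟶ H.obj d.obj, ∀ (N : G.FullSubcategory) (a : N ⟶ c.obj) (b : N ⟶ d.obj),
      a.hom ≫ c.π ≫ f = b.hom ≫ d.π → H.map a ≫ u = H.map b := by
  have hc := h.le _ c.obj.property
  have hd := h.le _ d.obj.property
  obtain ⟨S, q, hq⟩ := h.exists_cover_square (c.π ≫ f) d.π hc hd hY d.prop
  let a₀ : S.obj ⟶ c.obj := ObjectProperty.homMk S.π
  let b₀ : S.obj ⟶ d.obj := ObjectProperty.homMk q
  have : IsIso (H.map a₀) := hH _ S.prop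
  refine ⟨inv (H.map a₀) ≫ H.map b₀, fun N a b hab => ?_, fun u hu => ?_⟩
  · obtain ⟨T, r, hr⟩ := h.exists_cover_square a.hom S.π (h.le _ N.property)
      (h.le _ S.obj.property) hc S.prop
    let t : T.obj ⟶ N := ObjectProperty.homMk T.π
    let r' : T.obj ⟶ S.obj := ObjectProperty.homMk r
    have e₁ : t ≫ a = r' ≫ a₀ := by
      ext
      exact hr
    have e₂ : H.map (t ≫ b) = H.map (r' ≫ b₀) := by
      refine h.map_eq hH hY d _ _ ?_
      change (T.π ≫ b.hom) ≫ d.π = (r ≫ q) ≫ d.π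
      rw [Category.assoc, Category.assoc, ← hab, ← hq, reassoc_of% hr]
    have : IsIso (H.map t) := hH _ T.prop
    rw [← cancel_epi (H.map t), ← H.map_comp _ b, e₂, ← Category.assoc, ← H.map_comp, e₁,
      H.map_comp _ a₀, Category.assoc, IsIso.hom_inv_id_assoc, ← H.map_comp]
  · rw [IsIso.eq_inv_comp]
    exact hu S.obj a₀ b₀ hq

/-- The morphism between the values of `H` on resolutions which is induced by a morphism. -/
noncomputable def coverMap {X Y : M} (hY : B Y) (f : X ⟶ Y) (c : Cover W G X)
    (d : Cover W G Y) : H.obj c.obj ⟶ H.obj d.obj :=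
  (h.existsUnique_map hH hY f c d).choose

lemma map_coverMap {X Y : M} (hY : B Y) (f : X ⟶ Y) (c : Cover W G X)
    (d : Cover W G Y) {N : G.FullSubcategory} (a : N ⟶ c.obj) (b : N ⟶ d.obj)
    (hab : a.hom ≫ c.π ≫ f = b.hom ≫ d.π) :
    H.map a ≫ h.coverMap hH hY f c d = H.map b :=
  (h.existsUnique_map hH hY f c d).choose_spec.1 N a b hab

lemma coverMap_eq_map {X Y : M} (hY : B Y) (f : X ⟶ Y) (c : Cover W G X)
    (d : Cover W G Y) (r : c.obj ⟶ d.obj) (hr : c.π ≫ f = r.hom ≫ d.π) :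
    h.coverMap hH hY f c d = H.map r := by
  have := h.map_coverMap hH hY f c d (𝟙 _) r (by simpa using hr)
  simpa using this

lemma coverMap_id {X : M} (hX : B X) (c : Cover W G X) :
    h.coverMap hH hX (𝟙 X) c c = 𝟙 _ := by
  rw [h.coverMap_eq_map hH hX (𝟙 X) c c (𝟙 _) (by simp), H.map_id]

/-- Refines `c` to a cover on which `f` lifts. Identities between values of `coverMap` can then be
checked after cancelling the isomorphism `H.map a`. -/
lemma exists_roof {X Y : M} (hY : B Y) (f : X ⟶ Y) (c : Cover W G X)
    (d : Cover W G Y) :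
    ∃ (e : Cover W G X) (a : e.obj ⟶ c.obj) (b : e.obj ⟶ d.obj), W a.hom ∧ a.hom ≫ c.π = e.π ∧
      e.π ≫ f = b.hom ≫ d.π ∧ IsIso (H.map a) := by
  obtain ⟨S, q, hq⟩ := h.exists_cover_square (c.π ≫ f) d.π (h.le _ c.obj.property)
    (h.le _ d.obj.property) hY d.prop
  exact ⟨⟨S.obj, S.π ≫ c.π, h.comp _ _ S.prop c.prop⟩, ObjectProperty.homMk S.π,
    ObjectProperty.homMk q, S.prop, rfl, by simpa using hq, hH _ S.prop⟩

lemma coverMap_comp {X Y Z : M} (hY : B Y) (hZ : B Z) (f : X ⟶ Y) (g : Y ⟶ Z)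
    (c : Cover W G X) (d : Cover W G Y) (e : Cover W G Z) :
    h.coverMap hH hY f c d ≫ h.coverMap hH hZ g d e =
      h.coverMap hH hZ (f ≫ g) c e := by
  obtain ⟨S, a, b, ha, ha', hb, _⟩ := h.exists_roof hH hY f c d
  obtain ⟨T, a', b', ha₁, ha₁', hb', _⟩ := h.exists_roof hH hZ (f ≫ g) S e
  rw [← cancel_epi (H.map a), ← cancel_epi (H.map a'),
    reassoc_of% h.map_coverMap hH hY f c d a b (by rw [← hb, reassoc_of% ha']),
    ← H.map_comp_assoc a' b, ← H.map_comp_assoc a' a,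
    h.map_coverMap hH hZ g d e (a' ≫ b) b' (by
      rw [← hb', ← ha₁', ObjectProperty.FullSubcategory.comp_hom, Category.assoc,
        ← reassoc_of% hb, Category.assoc]),
    h.map_coverMap hH hZ (f ≫ g) c e (a' ≫ a) b' (by
      rw [← hb', ← ha₁', ObjectProperty.FullSubcategory.comp_hom, Category.assoc,
        reassoc_of% ha', Category.assoc])]

variable {I : Type*} [Category* I] (T : I ⥤ M) (hT : ∀ i, B (T.obj i))

omit hH in
/-- The chosen resolution of an object. -/
noncomputable def chosenCover {X : M} (hX : B X) : Cover W G X :=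
  ⟨⟨_, (h.cover X hX).choose_spec.choose_spec.1⟩, (h.cover X hX).choose_spec.choose,
    (h.cover X hX).choose_spec.choose_spec.2⟩

/-- The functor which sends `i` to the value of `H` on a resolution of `T i`. -/
noncomputable def derived : I ⥤ A where
  obj i := H.obj (h.chosenCover (hT i)).obj
  map f := h.coverMap hH (hT _) (T.map f) (h.chosenCover (hT _)) (h.chosenCover (hT _))
  map_id i := by rw [T.map_id, h.coverMap_id]
  map_comp f g := by rw [h.coverMap_comp, T.map_comp]

/-- The isomorphism between the values of `H` on two resolutions of an object. -/
noncomputable def coverIso {X : M} (hX : B X) (c d : Cover W G X) :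
    H.obj c.obj ≅ H.obj d.obj where
  hom := h.coverMap hH hX (𝟙 _) c d
  inv := h.coverMap hH hX (𝟙 _) d c
  hom_inv_id := by rw [h.coverMap_comp, Category.comp_id, h.coverMap_id]
  inv_hom_id := by rw [h.coverMap_comp, Category.comp_id, h.coverMap_id]

/-- The derived functor can be computed with any resolution. -/
noncomputable def isoOfCover {i : I} (c : Cover W G (T.obj i)) :
    (h.derived hH T hT).obj i ≅ H.obj c.obj :=
  h.coverIso hH (hT i) (h.chosenCover (hT i)) c

lemma derived_map_isoOfCover_hom {i j : I} (f : i ⟶ j) (c : Cover W G (T.obj i))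
    (d : Cover W G (T.obj j)) :
    (h.derived hH T hT).map f ≫ (h.isoOfCover hH T hT d).hom =
      (h.isoOfCover hH T hT c).hom ≫ h.coverMap hH (hT _) (T.map f) c d := by
  refine (h.coverMap_comp hH (hT j) (hT j) (T.map f) (𝟙 _) _ _ d).trans ?_
  refine Eq.trans ?_ (h.coverMap_comp hH (hT i) (hT j) (𝟙 _) (T.map f) _ c d).symm
  rw [Category.comp_id, Category.id_comp]

lemma isoOfCover_hom_naturality {i j : I} (f : i ⟶ j) (c : Cover W G (T.obj i))
    (d : Cover W G (T.obj j)) (r : c.obj ⟶ d.obj) (hr : c.π ≫ T.map f = r.hom ≫ d.π) :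
    (h.derived hH T hT).map f ≫ (h.isoOfCover hH T hT d).hom =
      (h.isoOfCover hH T hT c).hom ≫ H.map r := by
  rw [h.derived_map_isoOfCover_hom hH T hT f c, h.coverMap_eq_map hH _ _ _ _ r hr]

lemma isoOfCover_inv_naturality {i j : I} (f : i ⟶ j) (c : Cover W G (T.obj i))
    (d : Cover W G (T.obj j)) (r : c.obj ⟶ d.obj) (hr : c.π ≫ T.map f = r.hom ≫ d.π) :
    H.map r ≫ (h.isoOfCover hH T hT d).inv =
      (h.isoOfCover hH T hT c).inv ≫ (h.derived hH T hT).map f := by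
  rw [Iso.comp_inv_eq, Category.assoc, h.isoOfCover_hom_naturality hH T hT f c d r hr,
    Iso.inv_hom_id_assoc]

/-- The derived functor inverts trivial fibrations. -/
lemma isIso_derived_map {i j : I} (f : i ⟶ j) (hf : W (T.map f)) :
    IsIso ((h.derived hH T hT).map f) := by
  let c := h.chosenCover (hT i)
  -- The same good object covers both ends, so `f` is computed by an identity.
  let d : Cover W G (T.obj j) := ⟨c.obj, c.π ≫ T.map f, h.comp _ _ c.prop hf⟩
  have := h.isoOfCover_hom_naturality hH T hT f c d (𝟙 _) (by simp [d])
  rw [H.map_id, Category.comp_id] at this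
  rw [← Iso.eq_comp_inv] at this
  rw [this]
  infer_instance

/-- A family of isomorphisms from the values of `H` on the resolutions of `T i` to `N i`, which is
compatible with morphisms of resolutions, induces an isomorphism from the derived functor
to `N`. -/
noncomputable def derivedIso {N : I ⥤ A}
    (θ : ∀ (i : I) (c : Cover W G (T.obj i)), H.obj c.obj ≅ N.obj i)
    (hθ : ∀ ⦃i j : I⦄ (f : i ⟶ j) (c : Cover W G (T.obj i)) (d : Cover W G (T.obj j))
      (r : c.obj ⟶ d.obj), c.π ≫ T.map f = r.hom ≫ d.π →
      H.map r ≫ (θ j d).hom = (θ i c).hom ≫ N.map f) :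
    h.derived hH T hT ≅ N :=
  NatIso.ofComponents (fun i => h.isoOfCover hH T hT (h.chosenCover (hT i)) ≪≫ θ i _) (by
    intro i j f
    -- The chosen covers need not be related by a morphism over `f`; a roof maps to both, and `hθ`
    -- applies to each leg.
    obtain ⟨e, a, b, -, ha, hb, _⟩ := h.exists_roof hH (hT j) (T.map f)
      (h.chosenCover (hT i)) (h.chosenCover (hT j))
    have h₁ := hθ (𝟙 i) e (h.chosenCover (hT i)) a (by simp [ha])
    have h₂ := hθ f e (h.chosenCover (hT j)) b hb
    rw [N.map_id, Category.comp_id] at h₁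
    rw [Iso.trans_hom, Iso.trans_hom,
      reassoc_of% h.derived_map_isoOfCover_hom hH T hT f (h.chosenCover (hT i)), Category.assoc]
    congr 1
    rw [← cancel_epi (H.map a), reassoc_of% h.map_coverMap hH _ _ _ _ a b (by rw [← hb, ← ha,
      Category.assoc]), h₂, ← h₁, Category.assoc])

end IsResolving

end Deriving

/-! ### Trivial fibrations of nonnegative chain complexes. -/

section Chain

variable {C : Type*} [Category* C] [Abelian C] {E : Type*} [Category* E] [Abelian E]

variable (C) in
/-- The epimorphic quasi-isomorphisms of nonnegative chain complexes. -/
def trivialFibrations : MorphismProperty (ChainComplex C ℕ) := fun _ _ p => Epi p ∧ QuasiIso p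

/-- The chain complexes of objects satisfying `P`. -/
def degreewise (P : ObjectProperty C) : ObjectProperty (ChainComplex C ℕ) :=
  fun K => ∀ n, P (K.X n)

lemma quasiIso_of_isPullback {K L M N : ChainComplex C ℕ} {p : N ⟶ K} {q : N ⟶ L} {f : K ⟶ M}
    {w : L ⟶ M} (sq : IsPullback p q f w) [Epi w] [QuasiIso w] : QuasiIso p := by
  have := quasiIso_pullback_fst f w
  rw [← sq.isoPullback_hom_fst]
  infer_instance

lemma isResolving_chain {P : ObjectProperty C} (hP : IsGenerating P) :
    IsResolving (trivialFibrations C) ⊤ (degreewise P) where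
  le := le_top
  comp := by
    rintro X Y Z f g ⟨_, _⟩ ⟨_, _⟩
    exact ⟨epi_comp _ _, inferInstance⟩
  cover X _ := by
    obtain ⟨R, p, hR, hp⟩ := exists_cover hP X
    exact ⟨R, p, hR, hp⟩
  pullback {X Y Z} f w _ _ _ hw := by
    obtain ⟨_, _⟩ := hw
    exact ⟨pullback f w, pullback.fst f w, pullback.snd f w, IsPullback.of_hasPullback f w,
      trivial, inferInstance, quasiIso_pullback_fst f w⟩

lemma IsProjectiveFor.inverts {F : C ⥤ E} [F.Additive] {P : ObjectProperty C}
    (hP : IsProjectiveFor F P) (n : ℕ) :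
    Inverts (trivialFibrations C) ((degreewise P).ι ⋙ homologyMapFunctor F n) := by
  rintro R S p ⟨_, _⟩
  exact hP.isIso_map p.hom R.property S.property n

end Chain

/-! ### Towers and the local lifting condition. -/

section Tower

/-- Towers `⋯ ⟶ U 2 ⟶ U 1 ⟶ U 0`. -/
abbrev Tower (A : Type*) [Category* A] := ℕᵒᵈ ⥤ A

variable {A : Type*} [Category* A] [Abelian A]

/-- The towers of epimorphisms. -/
def epiTower (A : Type*) [Category* A] : ObjectProperty (Tower A) :=
  fun U => ∀ ⦃a b : ℕᵒᵈ⦄ (f : a ⟶ b), Epi (U.map f)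

/-- The natural maps `R a ⟶ U a ×_{U b} R b` are epimorphisms. -/
def LiftsLocally {R U : Tower A} (p : R ⟶ U) ⦃a b : ℕᵒᵈ⦄ (f : a ⟶ b) : Prop :=
  ∀ ⦃T : A⦄ (x : T ⟶ U.obj a) (y : T ⟶ R.obj b), x ≫ U.map f = y ≫ p.app b →
    ∃ (T' : A) (π : T' ⟶ T) (_ : Epi π) (z : T' ⟶ R.obj a),
      π ≫ x = z ≫ p.app a ∧ π ≫ y = z ≫ R.map f

lemma hom_eq_homOfLE_comp {a b c : ℕᵒᵈ} (f : a ⟶ b) (hac : a ≤ c) (hcb : c ≤ b) :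
    f = homOfLE hac ≫ homOfLE hcb := Subsingleton.elim _ _

omit [Abelian A] in
lemma epiTower_of_succ {U : Tower A}
    (hU : ∀ s : ℕ, Epi (U.map (homOfLE (OrderDual.toDual_le_toDual.2 s.le_succ)))) :
    epiTower A U := by
  have key : ∀ (b k : ℕ) (f : OrderDual.toDual (b + k) ⟶ OrderDual.toDual b), Epi (U.map f) := by
    intro b k
    induction k with
    | zero =>
      intro f
      obtain rfl : f = 𝟙 _ := Subsingleton.elim _ _
      rw [U.map_id]
      infer_instance
    | succ k ih =>
      intro f
      rw [hom_eq_homOfLE_comp f (OrderDual.toDual_le_toDual.2 (b + k).le_succ)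
        (OrderDual.toDual_le_toDual.2 (Nat.le_add_right b k)), U.map_comp]
      have := hU (b + k)
      have := ih (homOfLE (OrderDual.toDual_le_toDual.2 (Nat.le_add_right b k)))
      exact epi_comp _ _
  intro a b f
  obtain ⟨k, hk⟩ := Nat.exists_eq_add_of_le (OrderDual.ofDual_le_ofDual.2 (leOfHom f))
  obtain rfl : a = OrderDual.toDual (OrderDual.ofDual b + k) := congrArg OrderDual.toDual hk
  exact key _ _ f

-- Lifting along a composite arrow goes one level at a time, so the Reedy condition need only be
-- arranged between successive levels.
omit [Abelian A] in
lemma liftsLocally_of_succ {R U : Tower A} (p : R ⟶ U)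
    (h : ∀ s : ℕ, LiftsLocally p (homOfLE (OrderDual.toDual_le_toDual.2 s.le_succ)))
    ⦃a b : ℕᵒᵈ⦄ (f : a ⟶ b) : LiftsLocally p f := by
  have key : ∀ (b k : ℕ) (f : OrderDual.toDual (b + k) ⟶ OrderDual.toDual b),
      LiftsLocally p f := by
    intro b k
    induction k with
    | zero =>
      intro f
      obtain rfl : f = 𝟙 _ := Subsingleton.elim _ _
      intro T x y hxy
      exact ⟨T, 𝟙 _, inferInstance, y, by simpa using hxy, by simp⟩
    | succ k ih =>
      intro f
      rw [hom_eq_homOfLE_comp f (OrderDual.toDual_le_toDual.2 (b + k).le_succ)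
        (OrderDual.toDual_le_toDual.2 (Nat.le_add_right b k))]
      intro T x y hxy
      obtain ⟨T₁, π₁, _, z₁, h₁, h₂⟩ :=
        ih (homOfLE (OrderDual.toDual_le_toDual.2 (Nat.le_add_right b k)))
          (x ≫ U.map (homOfLE (OrderDual.toDual_le_toDual.2 (b + k).le_succ))) y (by
            rw [← hxy, U.map_comp, Category.assoc])
      obtain ⟨T₂, π₂, _, z₂, h₃, h₄⟩ := h (b + k) (π₁ ≫ x) z₁ (by rw [← h₁, Category.assoc])
      exact ⟨T₂, π₂ ≫ π₁, epi_comp _ _, z₂, (Category.assoc _ _ _).trans h₃, by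
        rw [Category.assoc, h₂, reassoc_of% h₄, R.map_comp]⟩
  obtain ⟨k, hk⟩ := Nat.exists_eq_add_of_le (OrderDual.ofDual_le_ofDual.2 (leOfHom f))
  obtain rfl : a = OrderDual.toDual (OrderDual.ofDual b + k) := congrArg OrderDual.toDual hk
  exact key _ _ f

end Tower

/-! ### Reedy resolutions of towers of complexes. -/

section TowerOfComplexes

variable {D : Type*} [Category* D] [Abelian D]

variable (D) in
/-- The trivial Reedy fibrations of towers of nonnegative chain complexes. -/
def towerTrivialFibrations : MorphismProperty (Tower (ChainComplex D ℕ)) := fun _ _ p =>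
  (∀ a, trivialFibrations D (p.app a)) ∧ ∀ ⦃a b : ℕᵒᵈ⦄ (f : a ⟶ b), LiftsLocally p f

/-- The towers of epimorphisms between chain complexes of objects satisfying `Q`. -/
def goodTower (Q : ObjectProperty D) : ObjectProperty (Tower (ChainComplex D ℕ)) :=
  fun R => (∀ a, degreewise Q (R.obj a)) ∧ epiTower _ R

lemma LiftsLocally.comp {A : Type*} [Category* A] [Abelian A] {X Y Z : Tower A} {f : X ⟶ Y}
    {g : Y ⟶ Z} {a b : ℕᵒᵈ} {φ : a ⟶ b} (hf : LiftsLocally f φ) (hg : LiftsLocally g φ) :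
    LiftsLocally (f ≫ g) φ := by
  intro T x y hxy
  obtain ⟨T₁, π₁, _, z₁, h₁, h₂⟩ := hg x (y ≫ f.app b) (by simpa using hxy)
  obtain ⟨T₂, π₂, _, z₂, h₃, h₄⟩ := hf z₁ (π₁ ≫ y) (by rw [Category.assoc, h₂])
  exact ⟨T₂, π₂ ≫ π₁, epi_comp _ _, z₂, by
    rw [Category.assoc, h₁, NatTrans.comp_app, reassoc_of% h₃], by rw [Category.assoc, h₄]⟩

lemma LiftsLocally.of_isPullback {A : Type*} [Category* A] [Abelian A] {X Y Z T : Tower A}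
    {p : T ⟶ X} {q : T ⟶ Y} {f : X ⟶ Z} {w : Y ⟶ Z}
    (sq : ∀ a, IsPullback (p.app a) (q.app a) (f.app a) (w.app a)) {a b : ℕᵒᵈ} {φ : a ⟶ b}
    (hw : LiftsLocally w φ) : LiftsLocally p φ := by
  intro S x y hxy
  obtain ⟨S', π, _, z, h₁, h₂⟩ := hw (x ≫ f.app a) (y ≫ q.app b) (by
    rw [Category.assoc, ← f.naturality, reassoc_of% hxy, Category.assoc, (sq b).w])
  exact ⟨S', π, inferInstance, (sq a).lift (π ≫ x) z (by rw [Category.assoc, h₁]), by simp, by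
    apply (sq b).hom_ext
    · rw [Category.assoc, Category.assoc, p.naturality, (sq a).lift_fst_assoc, Category.assoc, hxy]
    · rw [Category.assoc, Category.assoc, q.naturality, (sq a).lift_snd_assoc, ← h₂]⟩

/-- An element of T_b is lifted in two steps: its image in X_b lifts since X is a tower of
epimorphisms, and then the pair lifts because `p` inherits local lifting from `w`. -/
lemma epiTower_of_isPullback {A : Type*} [Category* A] [Abelian A] {X Y Z T : Tower A}
    {p : T ⟶ X} {q : T ⟶ Y} {f : X ⟶ Z} {w : Y ⟶ Z}
    (sq : ∀ a, IsPullback (p.app a) (q.app a) (f.app a) (w.app a)) (hX : epiTower A X)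
    (hw : ∀ ⦃a b : ℕᵒᵈ⦄ (φ : a ⟶ b), LiftsLocally w φ) : epiTower A T := by
  intro a b φ
  rw [epi_iff_surjective_up_to_refinements]
  intro S y
  have := hX φ
  obtain ⟨S₁, π₁, _, x, hx⟩ := surjective_up_to_refinements_of_epi (X.map φ) (y ≫ p.app b)
  obtain ⟨S₂, π₂, _, z, -, h₂⟩ := LiftsLocally.of_isPullback sq (hw φ) x (π₁ ≫ y) (by
    rw [Category.assoc, hx])
  exact ⟨S₂, π₂ ≫ π₁, epi_comp _ _, z, by rw [Category.assoc, h₂]⟩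

/-- The resolution of a tower by downward recursion. -/
noncomputable def coverTowerStep {Q : ObjectProperty D} (hQ : IsGenerating Q)
    (U : Tower (ChainComplex D ℕ)) :
    ∀ s : ℕ, Cover (trivialFibrations D) (degreewise Q) (U.obj (OrderDual.toDual s))
  | 0 => (isResolving_chain hQ).chosenCover trivial
  | s + 1 =>
    let c := coverTowerStep hQ U s
    let f := U.map (homOfLE (OrderDual.toDual_le_toDual.2 s.le_succ))
    -- Covering U_{s+1} ×_{U_s} R_s, and not just U_{s+1}, builds in the transition map to R_s and
    -- the local lifting.
    let d := (isResolving_chain hQ).chosenCover (X := pullback f c.π) trivial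
    ⟨d.obj, d.π ≫ pullback.fst f c.π, by
      obtain ⟨_, _⟩ := c.prop
      exact (isResolving_chain hQ).comp _ _ d.prop ⟨inferInstance, quasiIso_pullback_fst _ _⟩⟩

lemma exists_coverTower {Q : ObjectProperty D} (hQ : IsGenerating Q)
    (U : Tower (ChainComplex D ℕ)) (hU : epiTower _ U) :
    ∃ (R : Tower (ChainComplex D ℕ)) (p : R ⟶ U), goodTower Q R ∧ towerTrivialFibrations D p := by
  let c := coverTowerStep hQ U
  let f (s : ℕ) := U.map (homOfLE (OrderDual.toDual_le_toDual.2 s.le_succ))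
  let e (s : ℕ) := ((isResolving_chain hQ).chosenCover (X := pullback (f s) (c s).π) trivial)
  let d (s : ℕ) : (c (s + 1)).obj.obj ⟶ (c s).obj.obj := (e s).π ≫ pullback.snd (f s) (c s).π
  have he (s : ℕ) : Epi (e s).π := (e s).prop.1
  let R : Tower (ChainComplex D ℕ) := (orderDualEquivalence ℕ).functor ⋙
    Functor.ofOpSequence (X := fun s => (c s).obj.obj) d
  have hR (s : ℕ) : R.map (homOfLE (OrderDual.toDual_le_toDual.2 s.le_succ)) = d s :=
    Functor.ofOpSequence_map_homOfLE_succ (X := fun s => (c s).obj.obj) d s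
  let p' : Functor.ofOpSequence (X := fun s => (c s).obj.obj) d ⟶
    (orderDualEquivalence ℕ).inverse ⋙ U :=
    NatTrans.ofOpSequence (fun s => (c s).π) (by
      intro s
      rw [Functor.ofOpSequence_map_homOfLE_succ]
      change ((e s).π ≫ pullback.snd (f s) (c s).π) ≫ (c s).π =
        ((e s).π ≫ pullback.fst (f s) (c s).π) ≫ f s
      rw [Category.assoc, Category.assoc, pullback.condition])
  let p : R ⟶ U := Functor.whiskerLeft (orderDualEquivalence ℕ).functor p'
  refine ⟨R, p, ⟨fun a => (c (OrderDual.ofDual a)).obj.property, epiTower_of_succ fun s => ?_⟩,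
    fun a => (c (OrderDual.ofDual a)).prop, liftsLocally_of_succ p fun s => ?_⟩
  · rw [hR]
    have := hU (homOfLE (OrderDual.toDual_le_toDual.2 s.le_succ))
    -- Base change of the epimorphism `f s`, whence the transition maps of R are epimorphisms.
    have : Epi (pullback.snd (f s) (c s).π) := inferInstance
    have hd : Epi (d s) := epi_comp' (he s) this
    exact hd
  · intro T x y hxy
    obtain ⟨l, h₁, h₂⟩ : ∃ l : T ⟶ pullback (f s) (c s).π,
        l ≫ pullback.fst _ _ = x ∧ l ≫ pullback.snd _ _ = y :=
      ⟨pullback.lift x y hxy, pullback.lift_fst _ _ _, pullback.lift_snd _ _ _⟩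
    obtain ⟨T', π, hπ, z, hz⟩ := surjective_up_to_refinements_of_epi (e s).π l
    refine ⟨T', π, hπ, z, ?_, ?_⟩
    · rw [← h₁]
      exact (reassoc_of% hz) (pullback.fst (f s) (c s).π)
    · rw [hR, ← h₂]
      exact (reassoc_of% hz) (pullback.snd (f s) (c s).π)

/-- A tower covered by a tower of epimorphisms is itself one, so `epiTower` is the largest class
that good towers can resolve. -/
lemma isResolving_tower {Q : ObjectProperty D} (hQ : IsGenerating Q) :
    IsResolving (towerTrivialFibrations D) (epiTower _) (goodTower Q) where
  le := fun _ h => h.2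
  comp f g hf hg := ⟨fun a => (isResolving_chain hQ).comp _ _ (hf.1 a) (hg.1 a),
    fun _ _ φ => (hf.2 φ).comp (hg.2 φ)⟩
  cover U hU := exists_coverTower hQ U hU
  pullback {X Y Z} f w hX _ _ hw := by
    have sq (a : ℕᵒᵈ) : IsPullback ((pullback.fst f w).app a) ((pullback.snd f w).app a)
        (f.app a) (w.app a) := (IsPullback.of_hasPullback f w).map ((evaluation _ _).obj a)
    refine ⟨pullback f w, pullback.fst f w, pullback.snd f w, IsPullback.of_hasPullback f w,
      epiTower_of_isPullback sq hX hw.2, fun a => ?_,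
      fun _ _ φ => LiftsLocally.of_isPullback sq (hw.2 φ)⟩
    obtain ⟨_, _⟩ := hw.1 a
    refine ⟨?_, quasiIso_of_isPullback (sq a)⟩
    rw [← (sq a).isoPullback_hom_fst]
    infer_instance

end TowerOfComplexes

/-! ### Spectral objects from functorial short exact sequences of complexes. -/

section SpectralObject

open Abelian ComposableArrows

variable {E : Type*} [Category* E] [Abelian E] {ι : Type*} [Category* ι]

/-- The condition that a functor `V` from arrows to an abelian category gives short
exact sequences `0 ⟶ V(f) ⟶ V(f ≫ g) ⟶ V(g) ⟶ 0`. -/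
structure IsShortExactFunctor {A : Type*} [Category* A] [Abelian A]
    (V : ComposableArrows ι 1 ⥤ A) : Prop where
  zero (D : ComposableArrows ι 2) : V.map ((mapFunctorArrows ι 0 1 0 2 2).app D) ≫
    V.map ((mapFunctorArrows ι 0 2 1 2 2).app D) = 0
  shortExact (D : ComposableArrows ι 2) : (ShortComplex.mk _ _ (zero D)).ShortExact

/-- The spectral object given by the long exact homology sequences. -/
noncomputable def IsShortExactFunctor.spectralObject
    {V : ComposableArrows ι 1 ⥤ CochainComplex E ℤ} (hV : IsShortExactFunctor V) :
    SpectralObject E ι where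
  H n := V ⋙ HomologicalComplex.homologyFunctor E _ n
  δ' n₀ n₁ h :=
    { app D := (hV.shortExact D).δ n₀ n₁ h
      naturality D D' φ := by
        let τ : ShortComplex.mk _ _ (hV.zero D) ⟶ ShortComplex.mk _ _ (hV.zero D') :=
          { τ₁ := V.map ((functorArrows ι 0 1 2).map φ)
            τ₂ := V.map ((functorArrows ι 0 2 2).map φ)
            τ₃ := V.map ((functorArrows ι 1 2 2).map φ)
            comm₁₂ := by
              dsimp only
              rw [← V.map_comp, ← V.map_comp, NatTrans.naturality]
            comm₂₃ := by
              dsimp only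
              rw [← V.map_comp, ← V.map_comp, NatTrans.naturality] }
        exact (HomologicalComplex.HomologySequence.δ_naturality τ (hV.shortExact D)
          (hV.shortExact D') n₀ n₁ h).symm }
  exact₁' n₀ n₁ h D := ((hV.shortExact D).homology_exact₁ n₀ n₁ h).exact_toComposableArrows
  exact₂' n D := ((hV.shortExact D).homology_exact₂ n).exact_toComposableArrows
  exact₃' n₀ n₁ h D := ((hV.shortExact D).homology_exact₃ n₀ n₁ h).exact_toComposableArrows

/-- The functoriality of `IsShortExactFunctor.spectralObject`. -/
noncomputable def IsShortExactFunctor.spectralObjectMap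
    {V V' : ComposableArrows ι 1 ⥤ CochainComplex E ℤ} (hV : IsShortExactFunctor V)
    (hV' : IsShortExactFunctor V') (τ : V ⟶ V') : hV.spectralObject ⟶ hV'.spectralObject where
  hom n := Functor.whiskerRight τ _
  comm n₀ n₁ h i j k f g := by
    let D : ComposableArrows ι 2 := mk₂ f g
    let φ : ShortComplex.mk _ _ (hV.zero D) ⟶ ShortComplex.mk _ _ (hV'.zero D) :=
      { τ₁ := τ.app _
        τ₂ := τ.app _
        τ₃ := τ.app _
        comm₁₂ := (τ.naturality _).symm
        comm₂₃ := (τ.naturality _).symm }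
    exact HomologicalComplex.HomologySequence.δ_naturality φ (hV.shortExact D)
      (hV'.shortExact D) n₀ n₁ h

lemma isIso_spectralObject_hom {X Y : SpectralObject E ι} (φ : X ⟶ Y)
    (h : ∀ (n : ℤ) (D : ComposableArrows ι 1), IsIso ((φ.hom n).app D)) : IsIso φ := by
  have h' (n : ℤ) : IsIso (φ.hom n) := NatIso.isIso_of_isIso_app _
  refine ⟨⟨fun n => inv (φ.hom n), ?_⟩, ?_, ?_⟩
  · intro n₀ n₁ hn i j k f g
    have := φ.comm n₀ n₁ hn f g
    rw [NatIso.isIso_inv_app, NatIso.isIso_inv_app, IsIso.comp_inv_eq, Category.assoc, this,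
      IsIso.inv_hom_id_assoc]
  · refine SpectralObject.Hom.ext (funext fun n => ?_)
    exact IsIso.hom_inv_id (φ.hom n)
  · refine SpectralObject.Hom.ext (funext fun n => ?_)
    exact IsIso.inv_hom_id (φ.hom n)

end SpectralObject

/-! ### Kernels of transition morphisms. -/

section KerTower

open ComposableArrows

variable {A : Type*} [Category* A] [Abelian A] {ι : Type*} [Category* ι]

/-- The functor which sends an arrow `f` to the kernel of `U f`. -/
noncomputable def kernelFunctor (U : ι ⥤ A) : ComposableArrows ι 1 ⥤ A where
  obj X := kernel (U.map (X.map' 0 1))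
  map {X Y} φ := kernel.map _ _ (U.map (φ.app 0)) (U.map (φ.app 1)) (by
    rw [← U.map_comp, ← U.map_comp]
    exact congrArg U.map (φ.naturality _))
  map_id X := by ext; simp
  map_comp f g := by ext; simp

/-- The inclusion of the kernel of `U f`. -/
noncomputable def kernelFunctorι (U : ι ⥤ A) (X : ComposableArrows ι 1) :
    (kernelFunctor U).obj X ⟶ U.obj (X.obj 0) := kernel.ι _

instance (U : ι ⥤ A) (X : ComposableArrows ι 1) : Mono (kernelFunctorι U X) :=
  inferInstanceAs (Mono (kernel.ι _))

@[simp]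
lemma kernelFunctorι_comp (U : ι ⥤ A) (X : ComposableArrows ι 1) :
    kernelFunctorι U X ≫ U.map (X.map' 0 1) = 0 := kernel.condition _

/-- The lift of a morphism to the kernel of `U f`. -/
noncomputable def kernelFunctorLift (U : ι ⥤ A) (X : ComposableArrows ι 1) {Z : A}
    (x : Z ⟶ U.obj (X.obj 0)) (hx : x ≫ U.map (X.map' 0 1) = 0) :
    Z ⟶ (kernelFunctor U).obj X := kernel.lift _ x hx

@[simp]
lemma kernelFunctorLift_ι (U : ι ⥤ A) (X : ComposableArrows ι 1) {Z : A}
    (x : Z ⟶ U.obj (X.obj 0)) (hx : x ≫ U.map (X.map' 0 1) = 0) :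
    kernelFunctorLift U X x hx ≫ kernelFunctorι U X = x := kernel.lift_ι _ _ _

@[simp]
lemma kernelFunctorLift_ι_assoc (U : ι ⥤ A) (X : ComposableArrows ι 1) {Z : A}
    (x : Z ⟶ U.obj (X.obj 0)) (hx : x ≫ U.map (X.map' 0 1) = 0) {Y : A}
    (y : U.obj (X.obj 0) ⟶ Y) :
    kernelFunctorLift U X x hx ≫ kernelFunctorι U X ≫ y = x ≫ y := kernel.lift_ι_assoc _ _ _ _

lemma kernelFunctor_map_ι (U : ι ⥤ A) {X Y : ComposableArrows ι 1} (φ : X ⟶ Y) :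
    (kernelFunctor U).map φ ≫ kernelFunctorι U Y = kernelFunctorι U X ≫ U.map (φ.app 0) :=
  kernel.lift_ι _ _ _

/-- The functoriality of `kernelFunctor`. -/
noncomputable def kernelFunctorMap {U V : ι ⥤ A} (p : U ⟶ V) :
    kernelFunctor U ⟶ kernelFunctor V where
  app X := kernelFunctorLift V X (kernelFunctorι U X ≫ p.app _) (by
    rw [Category.assoc, ← p.naturality, reassoc_of% kernelFunctorι_comp, zero_comp])
  naturality X Y φ := by
    rw [← cancel_mono (kernelFunctorι V Y)]
    simp [kernelFunctor_map_ι, reassoc_of% @kernelFunctor_map_ι]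

lemma kernelFunctorMap_app_ι {U V : ι ⥤ A} (p : U ⟶ V) (X : ComposableArrows ι 1) :
    (kernelFunctorMap p).app X ≫ kernelFunctorι V X = kernelFunctorι U X ≫ p.app _ :=
  kernelFunctorLift_ι _ _ _ _

lemma kernelFunctorMap_id (U : ι ⥤ A) : kernelFunctorMap (𝟙 U) = 𝟙 _ := by
  ext X
  rw [← cancel_mono (kernelFunctorι U X), kernelFunctorMap_app_ι]
  exact (Category.comp_id _).trans (Category.id_comp _).symm

lemma kernelFunctorMap_comp {U V W : ι ⥤ A} (p : U ⟶ V) (q : V ⟶ W) :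
    kernelFunctorMap (p ≫ q) = kernelFunctorMap p ≫ kernelFunctorMap q := by
  ext X
  rw [← cancel_mono (kernelFunctorι W X), kernelFunctorMap_app_ι, NatTrans.comp_app,
    NatTrans.comp_app, Category.assoc, kernelFunctorMap_app_ι, reassoc_of% @kernelFunctorMap_app_ι]

/-- The kernel sequence of a composite f ≫ g. Surjectivity onto ker U(g) uses that U(f) is an
epimorphism; the rest is formal. -/
lemma isShortExactFunctor_kernelFunctor {U : ι ⥤ A} (hU : ∀ ⦃a b : ι⦄ (f : a ⟶ b), Epi (U.map f)) :
    IsShortExactFunctor (kernelFunctor U) := by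
  have key (D : ComposableArrows ι 2) :
    (kernelFunctor U).map ((mapFunctorArrows ι 0 1 0 2 2).app D) ≫
      (kernelFunctor U).map ((mapFunctorArrows ι 0 2 1 2 2).app D) = 0 := by
    rw [← cancel_mono (kernelFunctorι U _), Category.assoc, kernelFunctor_map_ι, zero_comp,
      reassoc_of% @kernelFunctor_map_ι, ← U.map_comp]
    have : ((mapFunctorArrows ι 0 1 0 2 2).app D).app 0 ≫
      ((mapFunctorArrows ι 0 2 1 2 2).app D).app 0 = ((functorArrows ι 0 1 2).obj D).map' 0 1 :=
      (congrArg (· ≫ _) (D.map_id 0)).trans (Category.id_comp _)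
    rw [this]
    exact kernelFunctorι_comp _ _
  have h0 (D : ComposableArrows ι 2) : U.map (((mapFunctorArrows ι 0 1 0 2 2).app D).app 0) = 𝟙 _ :=
    (congrArg U.map (D.map_id 0)).trans (U.map_id _)
  have hm (D : ComposableArrows ι 2) :
      (kernelFunctor U).map ((mapFunctorArrows ι 0 1 0 2 2).app D) ≫ kernelFunctorι U _ =
        kernelFunctorι U _ := by
    rw [kernelFunctor_map_ι, h0]
    exact Category.comp_id _
  have hmono (D : ComposableArrows ι 2) :
      Mono ((kernelFunctor U).map ((mapFunctorArrows ι 0 1 0 2 2).app D)) := by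
    have : Mono ((kernelFunctor U).map ((mapFunctorArrows ι 0 1 0 2 2).app D) ≫
      kernelFunctorι U _) := by
      rw [hm]
      exact inferInstanceAs (Mono (kernelFunctorι U _))
    exact mono_of_mono _ (kernelFunctorι U _)
  have hepi (D : ComposableArrows ι 2) :
      Epi ((kernelFunctor U).map ((mapFunctorArrows ι 0 2 1 2 2).app D)) := by
    rw [epi_iff_surjective_up_to_refinements]
    intro Z y
    let f : D.obj 0 ⟶ D.obj 1 := D.map' 0 1
    let g : D.obj 1 ⟶ D.obj 2 := D.map' 1 2
    let y' : Z ⟶ U.obj (D.obj 1) := y ≫ kernelFunctorι U _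
    have hy' : y' ≫ U.map g = 0 :=
      (Category.assoc _ _ _).trans ((congrArg (fun f => y ≫ f)
        (kernelFunctorι_comp U ((functorArrows ι 1 2 2).obj D))).trans comp_zero)
    have := hU f
    obtain ⟨Z', π, _, x, hx⟩ := surjective_up_to_refinements_of_epi (U.map f) y'
    have h₁ : x ≫ U.map (f ≫ g) = 0 := by
      rw [U.map_comp, ← reassoc_of% hx, hy', comp_zero]
    have h₂ : D.map' 0 2 = f ≫ g := D.map'_comp 0 1 2
    refine ⟨Z', π, inferInstance, kernelFunctorLift U ((functorArrows ι 0 2 2).obj D) x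
      ((congrArg (fun f => x ≫ U.map f) h₂).trans h₁), ?_⟩
    rw [← cancel_mono (kernelFunctorι U _), Category.assoc, Category.assoc, kernelFunctor_map_ι]
    refine hx.trans ?_
    exact (kernelFunctorLift_ι_assoc U ((functorArrows ι 0 2 2).obj D) x _ (U.map f)).symm
  refine ⟨key, fun D => { exact := ?_, mono_f := hmono D, epi_g := hepi D }⟩
  rw [ShortComplex.exact_iff_exact_up_to_refinements]
  intro Z x hx
  have hx' := congrArg (· ≫ kernelFunctorι U _) hx
  simp only [Category.assoc, kernelFunctor_map_ι, zero_comp] at hx'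
  refine ⟨Z, 𝟙 _, inferInstance, kernelFunctorLift U _ (x ≫ kernelFunctorι U _)
    ((Category.assoc _ _ _).trans hx'), ?_⟩
  rw [← cancel_mono (kernelFunctorι U _), Category.id_comp, Category.assoc]
  dsimp only
  erw [hm, kernelFunctorLift_ι]
  rfl

end KerTower

/-! ### The spectral object of a good tower and its invariance. -/

section TowerSpectralObject

open Abelian ComposableArrows

lemma IsShortExactFunctor.comp {A A' : Type*} [Category* A] [Abelian A] [Category* A'] [Abelian A']
    {ι : Type*} [Category* ι] {V : ComposableArrows ι 1 ⥤ A} (hV : IsShortExactFunctor V)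
    (Φ : A ⥤ A') [Φ.PreservesZeroMorphisms]
    (hΦ : ∀ D, ((ShortComplex.mk _ _ (hV.zero D)).map Φ).ShortExact) :
    IsShortExactFunctor (V ⋙ Φ) where
  zero D := ((ShortComplex.mk _ _ (hV.zero D)).map Φ).zero
  shortExact := hΦ

lemma shortExact_extend {E : Type*} [Category* E] [Abelian E] {S : ShortComplex (ChainComplex E ℕ)}
    (hS : S.ShortExact) :
    (S.map (ComplexShape.embeddingDownNat.extendFunctor E)).ShortExact := by
  apply HomologicalComplex.shortExact_of_degreewise_shortExact
  intro m
  by_cases hm : ∃ n, ComplexShape.embeddingDownNat.f n = m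
  · obtain ⟨n, hn⟩ := hm
    have key {K L : ChainComplex E ℕ} (f : K ⟶ L) :
        (K.extendXIso ComplexShape.embeddingDownNat hn).inv ≫
          (HomologicalComplex.extendMap f ComplexShape.embeddingDownNat).f m =
        f.f n ≫ (L.extendXIso ComplexShape.embeddingDownNat hn).inv := by
      rw [HomologicalComplex.extendMap_f f _ hn, Iso.inv_hom_id_assoc]
    exact ShortComplex.shortExact_of_iso (ShortComplex.isoMk
      (HomologicalComplex.extendXIso S.X₁ _ hn).symm (HomologicalComplex.extendXIso S.X₂ _ hn).symm
      (HomologicalComplex.extendXIso S.X₃ _ hn).symm (key S.f) (key S.g))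
      (hS.map_of_exact (HomologicalComplex.eval E _ n))
  · have h0 (K : ChainComplex E ℕ) :
      IsZero ((K.extend ComplexShape.embeddingDownNat).X m) :=
      K.isZero_extend_X _ _ (fun n hn => hm ⟨n, hn⟩)
    exact
      { exact := ShortComplex.exact_of_isZero_X₂ _ (h0 _)
        mono_f := ⟨fun _ _ _ => (h0 _).eq_of_tgt _ _⟩
        epi_g := ⟨fun _ _ _ => (h0 _).eq_of_src _ _⟩ }

variable {D : Type*} [Category* D] [Abelian D] {E : Type*} [Category* E] [Abelian E]
  {F : D ⥤ E} [F.Additive] {Q : ObjectProperty D}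

/-- The extension of a nonnegative chain complex to a cochain complex indexed by the integers has
the same homology. -/
noncomputable def extendHomologyNatIso (n : ℕ) (m : ℤ) (h : m = -n) :
    ComplexShape.embeddingDownNat.extendFunctor E ⋙ HomologicalComplex.homologyFunctor E _ m ≅
      HomologicalComplex.homologyFunctor E _ n :=
  NatIso.ofComponents (fun K => K.extendHomologyIso ComplexShape.embeddingDownNat h.symm)
    (fun f => HomologicalComplex.extendHomologyIso_hom_naturality f _ _)

lemma isZero_extend_homology (K : ChainComplex E ℕ) (m : ℤ) (hm : 0 < m) :
    IsZero ((K.extend ComplexShape.embeddingDownNat).homology m) :=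
  (HomologicalComplex.exactAt_iff_isZero_homology _ _).1
    (K.extend_exactAt _ _ (fun j => by simp; lia))

lemma IsQuasiProjective.degreewise_kernelFunctor (hQ : IsQuasiProjective Q)
    {R : Tower (ChainComplex D ℕ)} (hR : goodTower Q R) (X : ComposableArrows ℕᵒᵈ 1) :
    degreewise Q ((kernelFunctor R).obj X) := by
  let f : X.obj 0 ⟶ X.obj 1 := X.map' 0 1
  have := hR.2 f
  have h := shortExact_kernel (R.map f)
  intro n
  exact hQ _ (h.map_of_exact (HomologicalComplex.eval D _ n)) (hR.1 _ n) (hR.1 _ n)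

/-- The functor which sends an arrow `f` to the complex `F(ker R(f))`. -/
noncomputable def towerFunctor (F : D ⥤ E) [F.Additive] (R : Tower (ChainComplex D ℕ)) :
    ComposableArrows ℕᵒᵈ 1 ⥤ CochainComplex E ℤ :=
  (kernelFunctor R ⋙ F.mapHomologicalComplex (ComplexShape.down ℕ)) ⋙
    ComplexShape.embeddingDownNat.extendFunctor E

/-- F need not be exact, but the middle and last kernels are complexes of objects of Q, and on such
sequences F is exact in each degree. -/
lemma IsProjectiveFor.isShortExactFunctor (hQ : IsProjectiveFor F Q)
    {R : Tower (ChainComplex D ℕ)} (hR : goodTower Q R) :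
    IsShortExactFunctor (towerFunctor F R) := by
  let h := isShortExactFunctor_kernelFunctor hR.2
  have h' := h.comp (F.mapHomologicalComplex (ComplexShape.down ℕ)) (fun X => by
    apply HomologicalComplex.shortExact_of_degreewise_shortExact
    intro n
    exact hQ.shortExact_map _ ((h.shortExact X).map_of_exact (HomologicalComplex.eval D _ n))
      (hQ.quasiProjective.degreewise_kernelFunctor hR _ n)
      (hQ.quasiProjective.degreewise_kernelFunctor hR _ n))
  exact h'.comp _ fun X => shortExact_extend (h'.shortExact X)

/-- The functoriality of `towerFunctor`. -/
noncomputable def towerFunctorMap (F : D ⥤ E) [F.Additive] {R S : Tower (ChainComplex D ℕ)}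
    (p : R ⟶ S) : towerFunctor F R ⟶ towerFunctor F S :=
  Functor.whiskerRight (Functor.whiskerRight (kernelFunctorMap p) _) _

lemma towerFunctorMap_id (R : Tower (ChainComplex D ℕ)) : towerFunctorMap F (𝟙 R) = 𝟙 _ := by
  rw [towerFunctorMap, kernelFunctorMap_id, Functor.whiskerRight_id', Functor.whiskerRight_id']
  rfl

lemma towerFunctorMap_comp {R S T : Tower (ChainComplex D ℕ)} (p : R ⟶ S) (q : S ⟶ T) :
    towerFunctorMap F (p ≫ q) = towerFunctorMap F p ≫ towerFunctorMap F q := by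
  rw [towerFunctorMap, kernelFunctorMap_comp, Functor.whiskerRight_comp, Functor.whiskerRight_comp]
  rfl

/-- The spectral object of a tower of epimorphisms between complexes of objects
satisfying `Q`, where `Q` is `F`-projective. -/
noncomputable def IsProjectiveFor.towerSpectralObject (hQ : IsProjectiveFor F Q) :
    (goodTower Q).FullSubcategory ⥤ SpectralObject E ℕᵒᵈ where
  obj R := (hQ.isShortExactFunctor R.property).spectralObject
  map p := IsShortExactFunctor.spectralObjectMap _ _ (towerFunctorMap F p.hom)
  map_id R := by
    refine SpectralObject.Hom.ext (funext fun n => ?_)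
    exact (congrArg (Functor.whiskerRight · _) (towerFunctorMap_id R.obj)).trans
      (Functor.whiskerRight_id' _)
  map_comp p q := by
    refine SpectralObject.Hom.ext (funext fun n => ?_)
    exact (congrArg (Functor.whiskerRight · _) (towerFunctorMap_comp p.hom q.hom)).trans
      (Functor.whiskerRight_comp _ _ _)

/-- The evaluation of spectral objects. -/
noncomputable def spectralObjectEval (E : Type*) [Category* E] [Abelian E] {ι : Type*} [Category* ι]
    (X : ComposableArrows ι 1) (n : ℤ) : SpectralObject E ι ⥤ E where
  obj S := (S.H n).obj X
  map f := (f.hom n).app X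

/-- The functor which sends a tower `R` to the complex `ker R(f)`. -/
noncomputable def IsProjectiveFor.kernelEval (hQ : IsProjectiveFor F Q)
    (X : ComposableArrows ℕᵒᵈ 1) :
    (goodTower Q).FullSubcategory ⥤ (degreewise Q).FullSubcategory where
  obj R := ⟨(kernelFunctor R.obj).obj X, hQ.quasiProjective.degreewise_kernelFunctor R.property X⟩
  map p := ObjectProperty.homMk ((kernelFunctorMap p.hom).app X)
  map_id R := by
    ext : 1
    exact NatTrans.congr_app (kernelFunctorMap_id R.obj) X
  map_comp p q := by
    ext : 1
    exact NatTrans.congr_app (kernelFunctorMap_comp p.hom q.hom) X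

/-- The values of the spectral object of a tower. -/
noncomputable def IsProjectiveFor.towerSpectralObjectEvalIso (hQ : IsProjectiveFor F Q)
    (X : ComposableArrows ℕᵒᵈ 1) (n : ℕ) (m : ℤ) (h : m = -n) :
    hQ.towerSpectralObject ⋙ spectralObjectEval E X m ≅
      hQ.kernelEval X ⋙ (degreewise Q).ι ⋙ homologyMapFunctor F n :=
  NatIso.ofComponents (fun _ => (extendHomologyNatIso n m h).app _)
    (fun _ => (extendHomologyNatIso n m h).hom.naturality _)

lemma IsProjectiveFor.isZero_towerSpectralObject (hQ : IsProjectiveFor F Q)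
    (R : (goodTower Q).FullSubcategory)
    (X : ComposableArrows ℕᵒᵈ 1) (m : ℤ) (h : 0 < m) :
    IsZero (((hQ.towerSpectralObject.obj R).H m).obj X) :=
  isZero_extend_homology _ m h

lemma trivialFibrations_of_isPullback {K L M N : ChainComplex D ℕ} {p : N ⟶ K} {q : N ⟶ L}
    {f : K ⟶ M} {w : L ⟶ M} (sq : IsPullback p q f w) (hw : trivialFibrations D w) :
    trivialFibrations D p := by
  obtain ⟨_, _⟩ := hw
  refine ⟨?_, quasiIso_of_isPullback sq⟩
  rw [← sq.isoPullback_hom_fst]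
  infer_instance

/-- This is what the Reedy condition is for: levelwise trivial fibrations alone need not be
surjective on kernels. Local lifting makes `l : R_a ⟶ U_a ×_{U_b} R_b` an epimorphism, and two out
of three makes it a quasi-isomorphism. The map ker R(f) → ker U(f) is the base change of `l` along
the embedding `j` of ker U(f) with second component 0. -/
lemma trivialFibrations_kernelFunctorMap {R U : Tower (ChainComplex D ℕ)} (p : R ⟶ U)
    (hp : towerTrivialFibrations D p) (X : ComposableArrows ℕᵒᵈ 1) :
    trivialFibrations D ((kernelFunctorMap p).app X) := by
  obtain ⟨_, _⟩ := hp.1 (X.obj 0)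
  obtain ⟨_, _⟩ := hp.1 (X.obj 1)
  let f : X.obj 0 ⟶ X.obj 1 := X.map' 0 1
  let l : R.obj (X.obj 0) ⟶ pullback (U.map f) (p.app (X.obj 1)) :=
    pullback.lift (p.app _) (R.map f) (p.naturality f).symm
  have hl : l ≫ pullback.fst _ _ = p.app (X.obj 0) := pullback.lift_fst _ _ _
  have hl' : l ≫ pullback.snd _ _ = R.map f := pullback.lift_snd _ _ _
  have hlw : trivialFibrations D l := by
    constructor
    · rw [epi_iff_surjective_up_to_refinements]
      intro T x
      obtain ⟨T', π, hπ, z, h₁, h₂⟩ := hp.2 f (x ≫ pullback.fst _ _) (x ≫ pullback.snd _ _)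
        (by rw [Category.assoc, Category.assoc, pullback.condition])
      refine ⟨T', π, hπ, z, pullback.hom_ext ?_ ?_⟩
      · rw [Category.assoc, Category.assoc, h₁, hl]
      · rw [Category.assoc, Category.assoc, h₂, hl']
    · have := quasiIso_pullback_fst (U.map f) (p.app (X.obj 1))
      rw [← quasiIso_iff_comp_right l (pullback.fst (U.map f) (p.app (X.obj 1))), hl]
      infer_instance
  let j : (kernelFunctor U).obj X ⟶ pullback (U.map f) (p.app (X.obj 1)) :=
    pullback.lift (kernelFunctorι U X) 0 ((kernelFunctorι_comp U X).trans zero_comp.symm)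
  have hj : j ≫ pullback.fst _ _ = kernelFunctorι U X := pullback.lift_fst _ _ _
  have hj' : j ≫ pullback.snd _ _ = 0 := pullback.lift_snd _ _ _
  have hR : kernelFunctorι R X ≫ R.map f = 0 := kernelFunctorι_comp R X
  have w : (kernelFunctorMap p).app X ≫ j = kernelFunctorι R X ≫ l := by
    apply pullback.hom_ext
    · rw [Category.assoc, Category.assoc, hj, hl, kernelFunctorMap_app_ι]
    · rw [Category.assoc, Category.assoc, hj', hl', hR, comp_zero]
  have sq : IsPullback ((kernelFunctorMap p).app X) (kernelFunctorι R X) j l :=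
    ⟨⟨w⟩, ⟨PullbackCone.IsLimit.mk _ (fun s => kernelFunctorLift R X s.snd (by
      change s.snd ≫ R.map f = 0
      rw [← hl', ← reassoc_of% s.condition, hj', comp_zero])) (fun s => by
        rw [← cancel_mono (kernelFunctorι U X), Category.assoc, kernelFunctorMap_app_ι,
          kernelFunctorLift_ι_assoc, ← hj, ← hl, ← reassoc_of% s.condition])
      (fun s => kernelFunctorLift_ι _ _ _ _) (fun s m h₁ h₂ => by
        rw [← cancel_mono (kernelFunctorι R X), h₂, kernelFunctorLift_ι])⟩⟩
  exact trivialFibrations_of_isPullback sq hlw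

lemma IsProjectiveFor.inverts_tower (hQ : IsProjectiveFor F Q) :
    Inverts (towerTrivialFibrations D) hQ.towerSpectralObject := by
  intro R S p hp
  refine isIso_spectralObject_hom _ (fun m X => ?_)
  by_cases hm : 0 < m
  · have h₁ := hQ.isZero_towerSpectralObject R X m hm
    have h₂ := hQ.isZero_towerSpectralObject S X m hm
    exact ⟨0, h₁.eq_of_src _ _, h₂.eq_of_src _ _⟩
  · obtain ⟨n, hn⟩ := Int.exists_eq_neg_ofNat (not_lt.1 hm)
    exact (NatIso.isIso_map_iff (hQ.towerSpectralObjectEvalIso X n m hn) p).2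
      (hQ.inverts n _ (trivialFibrations_kernelFunctorMap p.hom hp X))

end TowerSpectralObject

/-! ### Canonical truncations. -/

section Truncation

variable {D : Type*} [Category* D] [Abelian D]

/-- The differential of `pathComplex`. -/
noncomputable def pathComplexD (K : ChainComplex D ℕ) (n : ℕ) :
    K.X (n + 1) ⊞ K.X (n + 1 - 1) ⟶ K.X n ⊞ K.X (n - 1) := biprod.snd ≫ biprod.inl

/-- The contractible complex `K_n ⊞ K_{n-1}`. -/
noncomputable def pathComplex (K : ChainComplex D ℕ) : ChainComplex D ℕ :=
  ChainComplex.of (fun n => K.X n ⊞ K.X (n - 1)) (pathComplexD K) (by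
    intro n
    simp [pathComplexD])

/-- The components of `truncHom`. -/
noncomputable def truncHomF (s : ℕ) (K : ChainComplex D ℕ) (n : ℕ) :
    K.X n ⟶ K.X n ⊞ K.X (n - 1) :=
  -- The components impose x = 0 below degree s and d x = 0 up to degree s. For n = 0 the index n -
  -- 1 is 0 and `K.d 0 0` vanishes, so the second condition is empty there.
  biprod.lift (if n < s then 𝟙 _ else 0) (if n ≤ s then K.d n (n - 1) else 0)

lemma truncHomF_comm (s : ℕ) (K : ChainComplex D ℕ) (m : ℕ) :
    truncHomF s K (m + 1) ≫ pathComplexD K m = K.d (m + 1) m ≫ truncHomF s K m := by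
  have h : K.d (m + 1) m ≫ K.d m (m - 1) = 0 := by
    by_cases hm : (ComplexShape.down ℕ).Rel m (m - 1)
    · simp
    · rw [K.shape _ _ hm, comp_zero]
  dsimp only [truncHomF, pathComplexD]
  by_cases hm : m + 1 ≤ s
  · rw [if_pos hm, if_pos (Nat.lt_of_succ_le hm), if_pos (Nat.le_of_succ_le hm)]
    ext <;> simp [h]
  · rw [if_neg hm, if_neg (by lia : ¬ m < s)]
    split_ifs <;> ext <;> simp [h]

/-- The morphism from `K` to a contractible complex whose kernel is the `s`-th canonical
truncation of `K`. -/
noncomputable def truncHom (s : ℕ) (K : ChainComplex D ℕ) : K ⟶ pathComplex K where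
  f n := truncHomF s K n
  comm' := by
    rintro _ m rfl
    have h : (pathComplex K).d (m + 1) m = pathComplexD K m :=
      ChainComplex.of_d (fun n => K.X n ⊞ K.X (n - 1)) (pathComplexD K) m
    exact (congrArg (truncHomF s K (m + 1) ≫ ·) h).trans (truncHomF_comm s K m)

/-- Shows the truncated subcomplex to be 0 below degree s, the cycles in degree s, and all of K
above; later arguments use only this description. -/
lemma comp_truncHom_f_eq_zero_iff (s : ℕ) (K : ChainComplex D ℕ) (n : ℕ) {A : D} (x : A ⟶ K.X n) :
    x ≫ (truncHom s K).f n = 0 ↔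
      (n < s → x = 0) ∧ (n ≤ s → x ≫ K.d n (n - 1) = 0) := by
  change x ≫ truncHomF s K n = 0 ↔ _
  have h : x ≫ truncHomF s K n =
      biprod.lift (if n < s then x else 0) (if n ≤ s then x ≫ K.d n (n - 1) else 0) := by
    dsimp only [truncHomF]
    ext
    · split_ifs <;> simp
    · split_ifs <;> simp
  rw [h]
  constructor
  · intro hx
    have h₁ := congrArg (· ≫ biprod.fst) hx
    have h₂ := congrArg (· ≫ biprod.snd) hx
    simp only [biprod.lift_fst, biprod.lift_snd] at h₁ h₂
    rw [zero_comp] at h₁ h₂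
    exact ⟨fun hn => by simpa [hn] using h₁, fun hn => by simpa [hn] using h₂⟩
  · intro hx
    ext
    · simpa using hx.1
    · simpa using hx.2

/-- The canonical truncation of a complex. -/
noncomputable def truncSub (s : ℕ) (K : ChainComplex D ℕ) : ChainComplex D ℕ :=
  kernel (truncHom s K)

/-- The inclusion of the canonical truncation. -/
noncomputable def truncι (s : ℕ) (K : ChainComplex D ℕ) : truncSub s K ⟶ K :=
  kernel.ι (truncHom s K)

instance (s : ℕ) (K : ChainComplex D ℕ) : Mono (truncι s K) :=
  inferInstanceAs (Mono (kernel.ι (truncHom s K)))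

lemma truncι_comp (s : ℕ) (K : ChainComplex D ℕ) : truncι s K ≫ truncHom s K = 0 :=
  kernel.condition _

lemma exists_truncι_lift_f (s : ℕ) (K : ChainComplex D ℕ) (n : ℕ) {A : D} (x : A ⟶ K.X n)
    (h₁ : n < s → x = 0) (h₂ : n ≤ s → x ≫ K.d n (n - 1) = 0) :
    ∃ y : A ⟶ (truncSub s K).X n, y ≫ (truncι s K).f n = x := by
  let S : ShortComplex (ChainComplex D ℕ) := ShortComplex.mk _ _ (truncι_comp s K)
  have hS : S.Exact := ShortComplex.exact_of_f_is_kernel _ (kernelIsKernel _)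
  have hS' := hS.map (HomologicalComplex.eval D _ n)
  have : Mono (S.map (HomologicalComplex.eval D _ n)).f :=
    inferInstanceAs (Mono ((truncι s K).f n))
  exact ⟨hS'.lift x ((comp_truncHom_f_eq_zero_iff s K n x).2 ⟨h₁, h₂⟩), hS'.lift_f _ _⟩

lemma truncι_f_eq_zero (s : ℕ) (K : ChainComplex D ℕ) (n : ℕ) (hn : n < s) :
    (truncι s K).f n = 0 :=
  ((comp_truncHom_f_eq_zero_iff s K n _).1
    (HomologicalComplex.congr_hom (truncι_comp s K) n)).1 hn

lemma truncι_f_comp_d (s : ℕ) (K : ChainComplex D ℕ) (n : ℕ) (hn : n ≤ s) :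
    (truncι s K).f n ≫ K.d n (n - 1) = 0 :=
  ((comp_truncHom_f_eq_zero_iff s K n _).1
    (HomologicalComplex.congr_hom (truncι_comp s K) n)).2 hn

lemma isZero_truncSub_X (s : ℕ) (K : ChainComplex D ℕ) (n : ℕ) (hn : n < s) :
    IsZero ((truncSub s K).X n) := by
  rw [IsZero.iff_id_eq_zero, ← cancel_mono ((truncι s K).f n), truncι_f_eq_zero s K n hn]
  simp

lemma truncι_comp_truncHom {s s' : ℕ} (h : s ≤ s') (K : ChainComplex D ℕ) :
    truncι s' K ≫ truncHom s K = 0 := by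
  ext n : 1
  exact (comp_truncHom_f_eq_zero_iff s K n _).2
    ⟨fun hn => truncι_f_eq_zero s' K n (by lia), fun hn => truncι_f_comp_d s' K n (by lia)⟩

/-- The canonical truncation of a complex, as a quotient. -/
noncomputable def truncQuot (s : ℕ) (K : ChainComplex D ℕ) : ChainComplex D ℕ :=
  cokernel (truncι s K)

/-- The projection to the canonical truncation. -/
noncomputable def truncπ (s : ℕ) (K : ChainComplex D ℕ) : K ⟶ truncQuot s K :=
  cokernel.π (truncι s K)

instance (s : ℕ) (K : ChainComplex D ℕ) : Epi (truncπ s K) :=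
  inferInstanceAs (Epi (cokernel.π (truncι s K)))

@[simp]
lemma truncι_π (s : ℕ) (K : ChainComplex D ℕ) : truncι s K ≫ truncπ s K = 0 :=
  cokernel.condition _

lemma shortExact_trunc (s : ℕ) (K : ChainComplex D ℕ) :
    (ShortComplex.mk _ _ (truncι_π s K)).ShortExact where
  exact := ShortComplex.exact_of_g_is_cokernel _ (cokernelIsCokernel _)

lemma truncι_comp_π {s s' : ℕ} (h : s ≤ s') (K : ChainComplex D ℕ) :
    truncι s' K ≫ truncπ s K = 0 := by
  obtain ⟨l, hl⟩ : ∃ l : truncSub s' K ⟶ truncSub s K, l ≫ truncι s K = truncι s' K :=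
    ⟨kernel.lift _ (truncι s' K) (truncι_comp_truncHom h K), kernel.lift_ι _ _ _⟩
  rw [← hl, Category.assoc, truncι_π, comp_zero]

/-- The universal property of `truncQuot`. -/
noncomputable def truncDesc (s : ℕ) (K : ChainComplex D ℕ) {L : ChainComplex D ℕ} (f : K ⟶ L)
    (hf : truncι s K ≫ f = 0) : truncQuot s K ⟶ L := cokernel.desc _ f hf

@[simp]
lemma truncπ_desc (s : ℕ) (K : ChainComplex D ℕ) {L : ChainComplex D ℕ} (f : K ⟶ L)
    (hf : truncι s K ≫ f = 0) : truncπ s K ≫ truncDesc s K f hf = f := cokernel.π_desc _ _ _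

@[simp]
lemma truncπ_desc_assoc (s : ℕ) (K : ChainComplex D ℕ) {L L' : ChainComplex D ℕ} (f : K ⟶ L)
    (hf : truncι s K ≫ f = 0) (g : L ⟶ L') : truncπ s K ≫ truncDesc s K f hf ≫ g = f ≫ g :=
  cokernel.π_desc_assoc _ _ _ _

lemma truncι_naturality_comp (s : ℕ) {K L : ChainComplex D ℕ} (f : K ⟶ L) :
    (truncι s K ≫ f) ≫ truncHom s L = 0 := by
  ext n : 1
  refine (comp_truncHom_f_eq_zero_iff s L n _).2 ⟨fun hn => ?_, fun hn => ?_⟩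
  · rw [HomologicalComplex.comp_f, truncι_f_eq_zero s K n hn, zero_comp]
  · rw [HomologicalComplex.comp_f, Category.assoc, f.comm, reassoc_of% truncι_f_comp_d s K n hn,
      zero_comp]

/-- The functoriality of `truncSub`. -/
noncomputable def truncSubMap (s : ℕ) {K L : ChainComplex D ℕ} (f : K ⟶ L) :
    truncSub s K ⟶ truncSub s L :=
  kernel.lift _ (truncι s K ≫ f) (truncι_naturality_comp s f)

lemma truncSubMap_ι (s : ℕ) {K L : ChainComplex D ℕ} (f : K ⟶ L) :
    truncSubMap s f ≫ truncι s L = truncι s K ≫ f := kernel.lift_ι _ _ _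

/-- The tower of canonical truncations of a complex. -/
noncomputable def truncTower : ChainComplex D ℕ ⥤ Tower (ChainComplex D ℕ) where
  obj K :=
    { obj a := truncQuot (OrderDual.ofDual a) K
      map {a b} f := truncDesc _ K (truncπ _ K)
        (truncι_comp_π (OrderDual.ofDual_le_ofDual.2 (leOfHom f)) K)
      map_id a := by rw [← cancel_epi (truncπ _ K)]; simp
      map_comp f g := by rw [← cancel_epi (truncπ _ K)]; simp }
  map f :=
    { app a := truncDesc _ _ (f ≫ truncπ _ _) (by
        rw [← Category.assoc, ← truncSubMap_ι, Category.assoc, truncι_π, comp_zero])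
      naturality a b g := by rw [← cancel_epi (truncπ _ _)]; simp }
  map_id K := by
    ext a : 2
    rw [← cancel_epi (truncπ _ K)]
    simp
  map_comp f g := by
    ext a : 2
    rw [← cancel_epi (truncπ _ _)]
    simp

/-- The projection from a complex to a term of its tower of canonical truncations. -/
noncomputable def towerπ (K : ChainComplex D ℕ) (a : ℕᵒᵈ) : K ⟶ (truncTower.obj K).obj a :=
  truncπ (OrderDual.ofDual a) K

instance (K : ChainComplex D ℕ) (a : ℕᵒᵈ) : Epi (towerπ K a) :=
  inferInstanceAs (Epi (truncπ (OrderDual.ofDual a) K))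

@[simp]
lemma towerπ_map (K : ChainComplex D ℕ) {a b : ℕᵒᵈ} (f : a ⟶ b) :
    towerπ K a ≫ (truncTower.obj K).map f = towerπ K b :=
  truncπ_desc _ _ _ _

@[simp]
lemma towerπ_naturality {K L : ChainComplex D ℕ} (f : K ⟶ L) (a : ℕᵒᵈ) :
    towerπ K a ≫ (truncTower.map f).app a = f ≫ towerπ L a :=
  truncπ_desc _ _ _ _

lemma epiTower_truncTower (K : ChainComplex D ℕ) : epiTower _ (truncTower.obj K) := by
  intro a b f
  have : Epi (towerπ K a ≫ (truncTower.obj K).map f) := by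
    rw [towerπ_map]
    infer_instance
  exact epi_of_epi (towerπ K a) _

/-- For i ≥ s the subcomplex contains all of degree i + 1, so no boundary of degree i is lost. -/
lemma mono_homologyMap_truncι (s : ℕ) (K : ChainComplex D ℕ) (i : ℕ) :
    Mono (HomologicalComplex.homologyMap (truncι s K) i) := by
  by_cases hi : i < s
  · have : IsZero ((truncSub s K).homology i) :=
      ShortComplex.isZero_homology_of_isZero_X₂ _ (isZero_truncSub_X s K i hi)
    exact ⟨fun _ _ _ => this.eq_of_tgt _ _⟩
  · rw [HomologicalComplex.mono_homologyMap_iff_up_to_refinements _ (i + 1) i _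
      (ChainComplex.prev _ _) rfl]
    intro A x _ y hy
    obtain ⟨z, hz⟩ := exists_truncι_lift_f s K (i + 1) y (by lia) (by lia)
    refine ⟨A, 𝟙 _, inferInstance, z, ?_⟩
    rw [← cancel_mono ((truncι s K).f i), Category.id_comp, hy, Category.assoc,
      ← (truncι s K).comm, reassoc_of% hz]

lemma epi_homologyMap_truncι (s : ℕ) (K : ChainComplex D ℕ) (i : ℕ) (hi : s ≤ i) :
    Epi (HomologicalComplex.homologyMap (truncι s K) i) := by
  rw [HomologicalComplex.epi_homologyMap_iff_up_to_refinements _ (i + 1) i _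
      (ChainComplex.prev _ _) rfl]
  intro A y hy
  have hy' : y ≫ K.d i (i - 1) = 0 := by
    obtain (_ | i) := i
    · rw [K.shape _ _ (by simp), comp_zero]
    · rwa [ChainComplex.next_nat_succ] at hy
  obtain ⟨z, hz⟩ := exists_truncι_lift_f s K i y (by lia) (fun _ => hy')
  refine ⟨A, 𝟙 _, inferInstance, z, ?_, 0, ?_⟩
  · rw [← cancel_mono ((truncι s K).f _), Category.assoc, ← (truncι s K).comm, reassoc_of% hz, hy,
      zero_comp]
  · simp [hz]

lemma exactAt_truncQuot (s : ℕ) (K : ChainComplex D ℕ) (i : ℕ) (hi : s ≤ i) :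
    (truncQuot s K).ExactAt i :=
  (shortExact_trunc s K).exactAt_X₃ i (epi_homologyMap_truncι s K i hi)
    (fun j _ => mono_homologyMap_truncι s K j)

lemma isIso_homologyMap_truncπ (s : ℕ) (K : ChainComplex D ℕ) (i : ℕ) (hi : i < s) :
    IsIso (HomologicalComplex.homologyMap (truncπ s K) i) := by
  have h0 (j : ℕ) (hj : j < s) : IsZero ((truncSub s K).homology j) :=
    ShortComplex.isZero_homology_of_isZero_X₂ _ (isZero_truncSub_X s K j hj)
  have h := shortExact_trunc s K
  have : Mono (HomologicalComplex.homologyMap (truncπ s K) i) :=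
    (h.homology_exact₂ i).mono_g ((h0 i hi).eq_of_src _ _)
  have : Epi (HomologicalComplex.homologyMap (truncπ s K) i) := by
    cases i with
    | zero =>
      exact HomologicalComplex.epi_homologyMap_of_epi_of_not_rel (truncπ s K) 0 (by simp)
    | succ n => exact (h.homology_exact₃ (n + 1) n rfl).epi_f ((h0 n (by lia)).eq_of_tgt _ _)
  exact isIso_of_mono_of_epi _

lemma isIso_homologyMap_towerπ (K : ChainComplex D ℕ) (a : ℕᵒᵈ) (i : ℕ)
    (hi : i < OrderDual.ofDual a) : IsIso (HomologicalComplex.homologyMap (towerπ K a) i) :=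
  isIso_homologyMap_truncπ _ K i hi

/-- Everything in degree 0 is a cycle, so at level 0 the subcomplex is all of K. -/
lemma isZero_truncQuot_zero (K : ChainComplex D ℕ) : IsZero (truncQuot 0 K) := by
  have : Epi (truncι 0 K) := by
    refine HomologicalComplex.epi_of_epi_f _ (fun n => ?_)
    obtain ⟨y, hy⟩ := exists_truncι_lift_f 0 K n (𝟙 _) (by lia) (fun hn => by
      rw [K.shape _ _ (by simp; lia), comp_zero])
    have : Epi (y ≫ (truncι 0 K).f n) := by rw [hy]; infer_instance
    exact epi_of_epi y _
  exact isZero_cokernel_of_epi _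

lemma mono_truncπ_f (s : ℕ) (K : ChainComplex D ℕ) (i : ℕ) (hi : i < s) :
    Mono ((truncπ s K).f i) :=
  ((shortExact_trunc s K).map_of_exact (HomologicalComplex.eval D _ i)).exact.mono_g
    ((isZero_truncSub_X s K i hi).eq_of_src _ _)

/-- Degree s is the point: a cycle of L must lift to a cycle of K. Surjectivity on homology lifts it
up to a boundary, and surjectivity of `f` in degree s + 1 lifts the boundary. -/
lemma epi_truncSubMap (s : ℕ) {K L : ChainComplex D ℕ} (f : K ⟶ L) [Epi f] [QuasiIso f] :
    Epi (truncSubMap s f) := by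
  refine HomologicalComplex.epi_of_epi_f _ (fun n => ?_)
  rw [epi_iff_surjective_up_to_refinements]
  intro A y
  suffices ∃ (A' : D) (π : A' ⟶ A) (_ : Epi π) (x : A' ⟶ K.X n),
      (n < s → x = 0) ∧ (n ≤ s → x ≫ K.d n (n - 1) = 0) ∧
      π ≫ y ≫ (truncι s L).f n = x ≫ f.f n by
    obtain ⟨A', π, hπ, x, h₁, h₂, h₃⟩ := this
    obtain ⟨z, hz⟩ := exists_truncι_lift_f s K n x h₁ h₂
    refine ⟨A', π, hπ, z, ?_⟩
    have := HomologicalComplex.congr_hom (truncSubMap_ι s f) n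
    simp only [HomologicalComplex.comp_f] at this
    rw [← cancel_mono ((truncι s L).f n), Category.assoc, h₃, Category.assoc, this,
      reassoc_of% hz]
  obtain hn | rfl | hn := lt_trichotomy n s
  · refine ⟨A, 𝟙 _, inferInstance, 0, by simp, by simp, ?_⟩
    rw [truncι_f_eq_zero s L n hn]
    simp
  · have h : Epi (HomologicalComplex.homologyMap f n) := inferInstance
    rw [HomologicalComplex.epi_homologyMap_iff_up_to_refinements _ (n + 1) n _
      (ChainComplex.prev _ _) rfl] at h
    -- Reconciles `next n` with n - 1; in degree 0 both differentials are zero.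
    have hd (M : ChainComplex D ℕ) {A : D} (x : A ⟶ M.X n) :
        x ≫ M.d n ((ComplexShape.down ℕ).next n) = 0 ↔ x ≫ M.d n (n - 1) = 0 := by
      obtain (_ | n) := n
      · rw [M.shape _ _ (by simp), M.shape _ _ (by simp)]
        simp
      · rw [ChainComplex.next_nat_succ]
        rfl
    obtain ⟨A₁, π₁, _, x, hx, y', h₁⟩ := h (y ≫ (truncι n L).f n) (by
      rw [hd, Category.assoc, truncι_f_comp_d n L n le_rfl, comp_zero])
    obtain ⟨A₂, π₂, _, x', hx'⟩ := surjective_up_to_refinements_of_epi (f.f (n + 1)) y'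
    refine ⟨A₂, π₂ ≫ π₁, epi_comp _ _, π₂ ≫ x + x' ≫ K.d (n + 1) n, by simp, fun _ => ?_, ?_⟩
    · rw [← hd, Preadditive.add_comp, Category.assoc, hx]
      simp
    · rw [Category.assoc, h₁, Preadditive.comp_add, Preadditive.add_comp, reassoc_of% hx']
      simp
  · obtain ⟨A', π, hπ, x, hx⟩ := surjective_up_to_refinements_of_epi (f.f n)
      (y ≫ (truncι s L).f n)
    exact ⟨A', π, hπ, x, by lia, by lia, hx⟩

/-- For local lifting, represent a compatible pair by x' in L and y' in K. The difference of f(y')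
and x' lies in the subcomplex of L truncated at level b; by `epi_truncSubMap` it lifts to the
corresponding subcomplex of K, and subtracting the lift from y' gives the common lift. -/
lemma towerTrivialFibrations_truncTower {K L : ChainComplex D ℕ} (f : K ⟶ L)
    (hf : trivialFibrations D f) : towerTrivialFibrations D (truncTower.map f) := by
  obtain ⟨_, _⟩ := hf
  refine ⟨fun a => ⟨?_, ⟨fun i => ?_⟩⟩, fun a b φ T x y hxy => ?_⟩
  · have : Epi (towerπ K a ≫ (truncTower.map f).app a) := by
      rw [towerπ_naturality]
      exact epi_comp _ _
    exact epi_of_epi (towerπ K a) _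
  · rw [quasiIsoAt_iff_isIso_homologyMap]
    by_cases hi : i < OrderDual.ofDual a
    · have := isIso_homologyMap_towerπ K a i hi
      have := isIso_homologyMap_towerπ L a i hi
      have h : IsIso (HomologicalComplex.homologyMap (towerπ K a) i ≫
          HomologicalComplex.homologyMap ((truncTower.map f).app a) i) := by
        rw [← HomologicalComplex.homologyMap_comp, towerπ_naturality,
          HomologicalComplex.homologyMap_comp]
        infer_instance
      exact IsIso.of_isIso_comp_left
        (HomologicalComplex.homologyMap (towerπ K a) i) _
    · have h (M : ChainComplex D ℕ) : IsZero ((truncQuot (OrderDual.ofDual a) M).homology i) :=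
        (HomologicalComplex.exactAt_iff_isZero_homology _ _).1
          (exactAt_truncQuot _ M i (not_lt.1 hi))
      exact ⟨0, (h K).eq_of_src _ _, (h L).eq_of_src _ _⟩
  · obtain ⟨T₁, π₁, _, x', hx'⟩ :=
      surjective_up_to_refinements_of_epi (towerπ L a) x
    obtain ⟨T₂, π₂, _, y', hy'⟩ :=
      surjective_up_to_refinements_of_epi (towerπ K b) (π₁ ≫ y)
    have h := shortExact_trunc (OrderDual.ofDual b) L
    have hιπ : truncι (OrderDual.ofDual b) K ≫ towerπ K b = 0 := truncι_π _ _
    have : Mono (ShortComplex.mk _ _ (truncι_π (OrderDual.ofDual b) L)).f := h.mono_f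
    let w := h.exact.lift (y' ≫ f - π₂ ≫ x') (by
      change (y' ≫ f - π₂ ≫ x') ≫ towerπ L b = 0
      rw [Preadditive.sub_comp, Category.assoc, Category.assoc, ← towerπ_naturality,
        ← reassoc_of% hy', ← hxy, ← towerπ_map L φ, ← reassoc_of% hx', sub_self])
    have hw : w ≫ truncι (OrderDual.ofDual b) L = y' ≫ f - π₂ ≫ x' := h.exact.lift_f _ _
    have := epi_truncSubMap (OrderDual.ofDual b) f
    obtain ⟨T₃, π₃, _, v, hv⟩ :=
      surjective_up_to_refinements_of_epi (truncSubMap (OrderDual.ofDual b) f) w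
    have hv' : (v ≫ truncι (OrderDual.ofDual b) K) ≫ f = π₃ ≫ (y' ≫ f - π₂ ≫ x') := by
      rw [Category.assoc, ← truncSubMap_ι, ← reassoc_of% hv, hw]
    refine ⟨T₃, π₃ ≫ π₂ ≫ π₁, epi_comp' inferInstance (epi_comp _ _),
      (π₃ ≫ y' - v ≫ truncι (OrderDual.ofDual b) K) ≫ towerπ K a, ?_, ?_⟩
    · have : (π₃ ≫ y' - v ≫ truncι (OrderDual.ofDual b) K) ≫ f = π₃ ≫ π₂ ≫ x' := by
        rw [Preadditive.sub_comp, hv', Preadditive.comp_sub]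
        simp
      rw [Category.assoc _ _ ((truncTower.map f).app a), towerπ_naturality, reassoc_of% this,
        Category.assoc,
        Category.assoc, hx']
    · rw [Category.assoc _ _ ((truncTower.obj K).map φ), towerπ_map, Preadditive.sub_comp,
        Category.assoc,
        Category.assoc, Category.assoc, Category.assoc _ _ (towerπ K b), hιπ, comp_zero,
        sub_zero, hy']

end Truncation

/-! ### Compatibility of derived functors with composition. -/

section Deriving

variable {M : Type*} [Category* M] {W : MorphismProperty M} {B G : ObjectProperty M}
  {A A' A'' : Type*} [Category* A] [Category* A'] [Category* A'']

lemma Inverts.comp {H : G.FullSubcategory ⥤ A} (hH : Inverts W H) (Φ : A ⥤ A') :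
    Inverts W (H ⋙ Φ) := by
  intro R S p hp
  have := hH p hp
  exact inferInstanceAs (IsIso (Φ.map (H.map p)))

namespace IsResolving

variable (h : IsResolving W B G) {H : G.FullSubcategory ⥤ A} (hH : Inverts W H)
  {I : Type*} [Category* I] (T : I ⥤ M) (hT : ∀ i, B (T.obj i))

/-- Deriving commutes with the postcomposition with a functor. -/
noncomputable def derivedComp (Φ : A ⥤ A') :
    h.derived (hH.comp Φ) T hT ≅ h.derived hH T hT ⋙ Φ :=
  h.derivedIso (hH.comp Φ) T hT (fun _ c => Φ.mapIso (h.isoOfCover hH T hT c).symm)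
    (fun i j f c d r hr => by
      refine (Φ.map_comp _ _).symm.trans (Eq.trans ?_ (Φ.map_comp _ _))
      exact congrArg Φ.map (h.isoOfCover_inv_naturality hH T hT f c d r hr))

/-- Deriving is functorial with respect to isomorphisms. -/
noncomputable def derivedCongr {H' : G.FullSubcategory ⥤ A} (hH' : Inverts W H') (e : H ≅ H') :
    h.derived hH T hT ≅ h.derived hH' T hT :=
  h.derivedIso hH T hT (fun _ c => e.app c.obj ≪≫ (h.isoOfCover hH' T hT c).symm)
    (fun i j f c d r hr => by
      simp only [Iso.trans_hom, Iso.app_hom, Iso.symm_hom, Category.assoc,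
        NatTrans.naturality_assoc]
      rw [h.isoOfCover_inv_naturality hH' T hT f c d r hr])

/-- Deriving is compatible with isomorphisms between composite functors. -/
noncomputable def derivedCompCongr {H' : G.FullSubcategory ⥤ A'} (hH' : Inverts W H')
    (Φ : A ⥤ A'') (Φ' : A' ⥤ A'') (e : H ⋙ Φ ≅ H' ⋙ Φ') :
    h.derived hH T hT ⋙ Φ ≅ h.derived hH' T hT ⋙ Φ' :=
  (h.derivedComp hH T hT Φ).symm ≪≫
    h.derivedCongr (hH.comp Φ) T hT (hH'.comp Φ') e ≪≫ h.derivedComp hH' T hT Φ'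

end IsResolving

end Deriving

/-! ### Exactness up to a given degree. -/

section PartialAcyclicity

variable {C : Type*} [Category* C] [Abelian C] {E : Type*} [Category* E] [Abelian E]
  {F : C ⥤ E} [F.Additive] {P : ObjectProperty C}

lemma shortExact_cycles_of_exactAt {K : ChainComplex C ℕ} (n : ℕ) (hK : K.ExactAt n) :
    (ShortComplex.mk (K.iCycles (n + 1)) (K.toCycles (n + 1) n) (by
      rw [← cancel_mono (K.iCycles n)]; simp)).ShortExact where
  exact := by
    apply ShortComplex.exact_of_f_is_kernel
    refine KernelFork.IsLimit.ofι' _ _ (fun {A} k hk => ⟨K.liftCycles k n (by simp) ?_,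
      K.liftCycles_i _ _ _ _⟩)
    rw [← K.toCycles_i (n + 1) n, ← Category.assoc, hk, zero_comp]
  epi_g := by
    refine (epi_iff_surjective_up_to_refinements (K.toCycles (n + 1) n)).2 (fun A y => ?_)
    obtain ⟨A', p, hp, x, hx⟩ := (K.exactAt_iff_exact_up_to_refinements (n + 1) n _
      (ChainComplex.prev _ _) rfl).1 hK (y ≫ K.iCycles n) (by simp)
    exact ⟨A', p, hp, x, by rw [← cancel_mono (K.iCycles n)]; simpa using hx⟩

/-- Induction upwards from Z_0 = K_0: exactness in degree n makes Z_{n+1} the kernel of an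
epimorphism from K_{n+1} to Z_n. -/
lemma IsProjectiveFor.prop_cycles_of_exactAt (hP : IsProjectiveFor F P) {K : ChainComplex C ℕ}
    (hK' : ∀ n, P (K.X n)) (n : ℕ) (hK : ∀ i < n, K.ExactAt i) : P (K.cycles n) := by
  induction n with
  | zero =>
    obtain ⟨Z, hZ, hZ'⟩ := hP.additive.zero
    exact hP.quasiProjective (ShortComplex.mk (K.iCycles 0) (0 : K.X 0 ⟶ Z) (by simp))
      { exact := by
          apply ShortComplex.exact_of_f_is_kernel
          exact KernelFork.IsLimit.ofι' _ _ (fun {A} k hk =>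
            ⟨K.liftCycles k _ rfl (by rw [K.shape _ _ (by simp), comp_zero]),
              K.liftCycles_i _ _ _ _⟩)
        epi_g := ⟨fun _ _ _ => hZ'.eq_of_src _ _⟩ } (hK' 0) hZ
  | succ n ih =>
    exact hP.quasiProjective _ (shortExact_cycles_of_exactAt n (hK n (by lia))) (hK' _)
      (ih (fun i hi => hK i (by lia)))

/-- If a complex of objects satisfying `P` is exact up to degree `n`, then so is its image
by `F`. -/
lemma IsProjectiveFor.exactAt_map (hP : IsProjectiveFor F P) {K : ChainComplex C ℕ}
    (hK' : ∀ n, P (K.X n)) (n : ℕ) (hK : ∀ i ≤ n, K.ExactAt i) :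
    ((F.mapHomologicalComplex (ComplexShape.down ℕ)).obj K).ExactAt n := by
  have hS (i : ℕ) (hi : i ≤ n) := hP.shortExact_map _ (shortExact_cycles_of_exactAt i (hK i hi))
    (hK' (i + 1)) (hP.prop_cycles_of_exactAt hK' i (fun j hj => hK j (by lia)))
  have ht : Epi (F.map (K.toCycles (n + 1) n)) := (hS n le_rfl).epi_g
  have key : ∀ ⦃A : E⦄ (x : A ⟶ F.obj (K.X n)),
      x ≫ F.map (K.d n ((ComplexShape.down ℕ).next n)) = 0 →
      ∃ (A' : E) (p : A' ⟶ A) (_ : Epi p) (y : A' ⟶ F.obj (K.X (n + 1))),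
        p ≫ x = y ≫ F.map (K.d (n + 1) n) := by
    intro A x hx
    -- A cycle of F(K) comes from F(Z_n): the inclusion of the cycles one degree lower stays a
    -- monomorphism under F, and the sequence defining Z_n stays exact.
    obtain ⟨A', p, hp, z, hz⟩ : ∃ (A' : E) (p : A' ⟶ A) (_ : Epi p)
        (z : A' ⟶ F.obj (K.cycles n)), p ≫ x = z ≫ F.map (K.iCycles n) := by
      cases n with
      | zero => exact ⟨A, 𝟙 A, inferInstance, x ≫ inv (F.map (K.iCycles 0)), by simp⟩
      | succ n =>
        refine (hS n (by lia)).exact.exact_up_to_refinements x ?_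
        have : Mono (F.map (K.iCycles n)) := by
          cases n with
          | zero => infer_instance
          | succ n => exact (hS n (by lia)).mono_f
        rw [ChainComplex.next_nat_succ, ← K.toCycles_i, F.map_comp, ← Category.assoc] at hx
        have h0 : x ≫ F.map (K.toCycles (n + 1) n) = 0 := by
          rw [← cancel_mono (F.map (K.iCycles n)), zero_comp]
          exact hx
        exact h0
    obtain ⟨A'', q, hq, y, hy⟩ := surjective_up_to_refinements_of_epi
      (F.map (K.toCycles (n + 1) n)) z
    refine ⟨A'', q ≫ p, epi_comp _ _, y, ?_⟩
    rw [Category.assoc, hz, ← Category.assoc, hy, Category.assoc, ← F.map_comp, K.toCycles_i]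
  rw [HomologicalComplex.exactAt_iff_exact_up_to_refinements _ (n + 1) n _
    (ChainComplex.prev _ _) rfl]
  exact key

lemma isIso_homologyMap_of_exactAt {S : ShortComplex (ChainComplex C ℕ)} (hS : S.ShortExact)
    (n : ℕ) (h : ∀ i ≤ n, S.X₁.ExactAt i) : IsIso (HomologicalComplex.homologyMap S.g n) := by
  have h0 (i : ℕ) (hi : i ≤ n) : IsZero (S.X₁.homology i) :=
    (HomologicalComplex.exactAt_iff_isZero_homology _ _).1 (h i hi)
  have : Mono (HomologicalComplex.homologyMap S.g n) :=
    (hS.homology_exact₂ n).mono_g ((h0 n le_rfl).eq_of_src _ _)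
  have : Epi (HomologicalComplex.homologyMap S.g n) := by
    cases n with
    | zero =>
      have := hS.epi_g
      exact HomologicalComplex.epi_homologyMap_of_epi_of_not_rel S.g 0 (by simp)
    | succ n => exact (hS.homology_exact₃ (n + 1) n rfl).epi_f ((h0 n (by lia)).eq_of_tgt _ _)
  exact isIso_of_mono_of_epi _

/-- The morphism `f` is an epimorphism which induces isomorphisms in homology up to degree `n`,
and an epimorphism in degree `n + 1`. -/
structure IsConnected (n : ℕ) {K L : ChainComplex C ℕ} (f : K ⟶ L) : Prop where
  epi : Epi f
  isIso (i : ℕ) (hi : i ≤ n) : IsIso (HomologicalComplex.homologyMap f i)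
  epi_homologyMap : Epi (HomologicalComplex.homologyMap f (n + 1))

/-- The epimorphism in degree n + 1 kills the connecting map to H_n of the kernel; this is why
`IsConnected` demands it. -/
lemma IsConnected.exactAt_kernel {n : ℕ} {K L : ChainComplex C ℕ} {f : K ⟶ L}
    (hf : IsConnected n f) (i : ℕ) (hi : i ≤ n) : (kernel f).ExactAt i := by
  have := hf.epi
  refine (shortExact_kernel f).exactAt_X₁ i (by have := hf.isIso i hi; infer_instance) ?_
  rintro _ rfl
  obtain hi | rfl := hi.lt_or_eq
  · have := hf.isIso (i + 1) (by lia)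
    infer_instance
  · exact hf.epi_homologyMap

lemma IsProjectiveFor.isIso_map_of_isConnected (hP : IsProjectiveFor F P) {K L : ChainComplex C ℕ}
    (hK : degreewise P K) (hL : degreewise P L) (n : ℕ) (p : K ⟶ L) (hp : IsConnected n p) :
    IsIso ((homologyMapFunctor F n).map p) := by
  have := hp.epi
  have hS := shortExact_kernel p
  have hS' := (HomologicalComplex.shortExact_iff_degreewise_shortExact _).1 hS
  let S := ShortComplex.mk (kernel.ι p) p (kernel.condition p)
  let T := S.map (F.mapHomologicalComplex (ComplexShape.down ℕ))
  have hT : T.ShortExact := HomologicalComplex.shortExact_of_degreewise_shortExact T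
    (fun i => hP.shortExact_map _ (hS' i) (hK i) (hL i))
  exact isIso_homologyMap_of_exactAt hT n (fun i hi => hP.exactAt_map
    (fun j => hP.quasiProjective _ (hS' j) (hK j) (hL j)) i
    (fun j hj => hp.exactAt_kernel j (by lia)))

end PartialAcyclicity

/-! ### Hyperhomology. -/

section HyperDerived

variable {D : Type*} [Category* D] [Abelian D] {E : Type*} [Category* E] [Abelian E]
  {F : D ⥤ E} [F.Additive] {Q : ObjectProperty D}

/-- The hyperhomology functors, i.e. the left derived functors of `K ↦ H_n(F(K))`. -/
noncomputable def IsProjectiveFor.hyper (hQ : IsProjectiveFor F Q) (n : ℕ) :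
    ChainComplex D ℕ ⥤ E :=
  (isResolving_chain hQ.generating).derived (hQ.inverts n) (𝟭 _) (fun _ => trivial)

/-- The derived functors of `K ↦ H_n(F(K))` along a functor. -/
noncomputable def IsProjectiveFor.derivedIsoCompHyper (hQ : IsProjectiveFor F Q) (n : ℕ)
    {I : Type*} [Category* I] (T : I ⥤ ChainComplex D ℕ) :
    (isResolving_chain hQ.generating).derived (hQ.inverts n) T (fun _ => trivial) ≅
      -- The chosen cover depends on the complex only, so the two functors agree definitionally.
      T ⋙ hQ.hyper n := Iso.refl _

/-- The hyperhomology can be computed with any resolution. -/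
noncomputable def IsProjectiveFor.hyperIso (hQ : IsProjectiveFor F Q) (n : ℕ)
    {K : ChainComplex D ℕ} (c : Cover (trivialFibrations D) (degreewise Q) K) :
    (hQ.hyper n).obj K ≅ (homologyMapFunctor F n).obj c.obj.obj :=
  (isResolving_chain hQ.generating).isoOfCover (hQ.inverts n) (𝟭 _) (fun _ => trivial) (i := K) c

lemma IsProjectiveFor.hyperIso_hom_naturality (hQ : IsProjectiveFor F Q) (n : ℕ)
    {K L : ChainComplex D ℕ} (f : K ⟶ L) (c : Cover (trivialFibrations D) (degreewise Q) K)
    (d : Cover (trivialFibrations D) (degreewise Q) L) (r : c.obj ⟶ d.obj)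
    (hr : c.π ≫ f = r.hom ≫ d.π) :
    (hQ.hyper n).map f ≫ (hQ.hyperIso n d).hom =
      (hQ.hyperIso n c).hom ≫ (homologyMapFunctor F n).map r.hom :=
  (isResolving_chain hQ.generating).isoOfCover_hom_naturality (hQ.inverts n) (𝟭 _)
    (fun _ => trivial) f c d r hr

lemma IsProjectiveFor.hyperIso_inv_naturality (hQ : IsProjectiveFor F Q) (n : ℕ)
    {K L : ChainComplex D ℕ} (f : K ⟶ L) (c : Cover (trivialFibrations D) (degreewise Q) K)
    (d : Cover (trivialFibrations D) (degreewise Q) L) (r : c.obj ⟶ d.obj)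
    (hr : c.π ≫ f = r.hom ≫ d.π) :
    (homologyMapFunctor F n).map r.hom ≫ (hQ.hyperIso n d).inv =
      (hQ.hyperIso n c).inv ≫ (hQ.hyper n).map f :=
  (isResolving_chain hQ.generating).isoOfCover_inv_naturality (hQ.inverts n) (𝟭 _)
    (fun _ => trivial) f c d r hr

/-- Over a cover of the fibre product of the resolutions, `f` lifts to an epimorphism `r` between
complexes of objects of Q. On homology `r` agrees with `f` up to isomorphisms, so it is n-connected
too. -/
lemma IsProjectiveFor.isIso_hyper_map (hQ : IsProjectiveFor F Q) (n : ℕ)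
    {K L : ChainComplex D ℕ} (f : K ⟶ L) (hf : IsConnected n f) :
    IsIso ((hQ.hyper n).map f) := by
  let h := isResolving_chain hQ.generating
  let c : Cover (trivialFibrations D) (degreewise Q) K := h.chosenCover trivial
  let d : Cover (trivialFibrations D) (degreewise Q) L := h.chosenCover trivial
  obtain ⟨_, _⟩ := c.prop
  obtain ⟨_, _⟩ := d.prop
  have := hf.epi
  have := quasiIso_pullback_fst (c.π ≫ f) d.π
  let e : Cover (trivialFibrations D) (degreewise Q) (pullback (c.π ≫ f) d.π) :=
    h.chosenCover trivial
  obtain ⟨he, he'⟩ := e.prop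
  let c' : Cover (trivialFibrations D) (degreewise Q) K :=
    ⟨e.obj, (e.π ≫ pullback.fst _ _) ≫ c.π, epi_comp _ _, inferInstance⟩
  obtain ⟨_, _⟩ := c'.prop
  let r : c'.obj ⟶ d.obj := ObjectProperty.homMk (e.π ≫ pullback.snd _ _)
  have hr : c'.π ≫ f = r.hom ≫ d.π := by
    change ((e.π ≫ pullback.fst _ _) ≫ c.π) ≫ f = (e.π ≫ pullback.snd _ _) ≫ d.π
    simp only [Category.assoc, pullback.condition]
  have hr' (i : ℕ) : HomologicalComplex.homologyMap r.hom i =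
      HomologicalComplex.homologyMap c'.π i ≫ HomologicalComplex.homologyMap f i ≫
        inv (HomologicalComplex.homologyMap d.π i) := by
    rw [← Category.assoc, IsIso.eq_comp_inv, ← HomologicalComplex.homologyMap_comp,
      ← HomologicalComplex.homologyMap_comp, hr]
  have hr'' : IsConnected n r.hom := by
    have : Epi (c.π ≫ f) := epi_comp _ _
    refine ⟨epi_comp' he (inferInstanceAs (Epi (pullback.snd (c.π ≫ f) d.π))), fun i hi => ?_, ?_⟩
    · have := hf.isIso i hi
      rw [hr']
      infer_instance
    · have := hf.epi_homologyMap
      rw [hr']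
      infer_instance
  have := hQ.isIso_map_of_isConnected c'.obj.property d.obj.property n r.hom hr''
  have := hQ.hyperIso_hom_naturality n f c' d r hr
  rw [← Iso.eq_comp_inv] at this
  rw [this]
  infer_instance

lemma isConnected_of_trivialFibrations {K L : ChainComplex D ℕ} (f : K ⟶ L)
    (hf : trivialFibrations D f) (n : ℕ) : IsConnected n f := by
  obtain ⟨_, _⟩ := hf
  exact ⟨inferInstance, inferInstance, inferInstance⟩

lemma IsProjectiveFor.isZero_hyper (hQ : IsProjectiveFor F Q) (n : ℕ) {K : ChainComplex D ℕ}
    (hK : ∀ i ≤ n, K.ExactAt i) : IsZero ((hQ.hyper n).obj K) := by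
  let c : Cover (trivialFibrations D) (degreewise Q) K :=
    (isResolving_chain hQ.generating).chosenCover trivial
  refine IsZero.of_iso ?_ (hQ.hyperIso n c)
  obtain ⟨_, _⟩ := c.prop
  refine (HomologicalComplex.exactAt_iff_isZero_homology _ _).1
    (hQ.exactAt_map c.obj.property n (fun i hi => ?_))
  rw [HomologicalComplex.exactAt_iff_isZero_homology]
  exact IsZero.of_iso ((HomologicalComplex.exactAt_iff_isZero_homology _ _).1 (hK i hi))
    (asIso (HomologicalComplex.homologyMap c.π i))

end HyperDerived

/-! ### The spectral object of the canonical filtration. -/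

section TruncationSpectralObject

open Abelian ComposableArrows

variable {D : Type*} [Category* D] [Abelian D] {E : Type*} [Category* E] [Abelian E]
  {F : D ⥤ E} [F.Additive] {Q : ObjectProperty D}

/-- The hyperhomology spectral object of a complex, for the canonical filtration. -/
noncomputable def IsProjectiveFor.truncSpectralObject (hQ : IsProjectiveFor F Q) :
    ChainComplex D ℕ ⥤ SpectralObject E ℕᵒᵈ :=
  (isResolving_tower hQ.generating).derived hQ.inverts_tower truncTower epiTower_truncTower

lemma IsProjectiveFor.isIso_truncSpectralObject_map (hQ : IsProjectiveFor F Q)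
    {K L : ChainComplex D ℕ} (f : K ⟶ L) (hf : trivialFibrations D f) :
    IsIso (hQ.truncSpectralObject.map f) :=
  (isResolving_tower hQ.generating).isIso_derived_map hQ.inverts_tower truncTower
    epiTower_truncTower f (towerTrivialFibrations_truncTower f hf)

/-- The functor which sends `K` to the kernel of a transition morphism in its tower of
canonical truncations. -/
noncomputable def truncKernel (D : Type*) [Category* D] [Abelian D] (X : ComposableArrows ℕᵒᵈ 1) :
    ChainComplex D ℕ ⥤ ChainComplex D ℕ where
  obj K := (kernelFunctor (truncTower.obj K)).obj X
  map f := (kernelFunctorMap (truncTower.map f)).app X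
  map_id K := by rw [truncTower.map_id, kernelFunctorMap_id]; rfl
  map_comp f g := by rw [truncTower.map_comp, kernelFunctorMap_comp]; rfl

/-- The values of `truncSpectralObject` are hyperhomology functors. -/
noncomputable def IsProjectiveFor.truncSpectralObjectEvalIso (hQ : IsProjectiveFor F Q)
    (X : ComposableArrows ℕᵒᵈ 1) (n : ℕ) (m : ℤ) (h : m = -n) :
    hQ.truncSpectralObject ⋙ spectralObjectEval E X m ≅ truncKernel D X ⋙ hQ.hyper n :=
  ((isResolving_tower hQ.generating).derivedComp hQ.inverts_tower truncTower epiTower_truncTower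
    (spectralObjectEval E X m)).symm ≪≫
  (isResolving_tower hQ.generating).derivedIso _ truncTower epiTower_truncTower
    (N := truncKernel D X ⋙ hQ.hyper n)
    -- A Reedy resolution of the tower induces a resolution of the kernel, from which hyperhomology
    -- can be computed.
    (fun K c => (hQ.towerSpectralObjectEvalIso X n m h).app c.obj ≪≫
      (hQ.hyperIso n (K := (truncKernel D X).obj K) ⟨(hQ.kernelEval X).obj c.obj,
        (kernelFunctorMap c.π).app X, trivialFibrations_kernelFunctorMap c.π c.prop X⟩).symm)
    (fun K L f c d r hr => by
      have h₁ := (hQ.towerSpectralObjectEvalIso X n m h).hom.naturality r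
      have h₂ := hQ.hyperIso_inv_naturality n ((truncKernel D X).map f)
        ⟨(hQ.kernelEval X).obj c.obj,
          (kernelFunctorMap c.π).app X, trivialFibrations_kernelFunctorMap c.π c.prop X⟩
        ⟨(hQ.kernelEval X).obj d.obj,
          (kernelFunctorMap d.π).app X, trivialFibrations_kernelFunctorMap d.π d.prop X⟩
        ((hQ.kernelEval X).map r) (by
          have h₁ := kernelFunctorMap_comp c.π (truncTower.map f)
          have h₂ := kernelFunctorMap_comp r.hom d.π
          rw [hr] at h₁
          exact NatTrans.congr_app (h₁.symm.trans h₂) X)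
      exact (Category.assoc _ _ _).symm.trans ((congrArg (· ≫ _) h₁).trans
        ((Category.assoc _ _ _).trans ((congrArg (_ ≫ ·) h₂).trans (Category.assoc _ _ _).symm))))

lemma isIso_homologyMap_truncTower_map (K : ChainComplex D ℕ) {a b : ℕᵒᵈ} (f : a ⟶ b) (i : ℕ)
    (hi : i < OrderDual.ofDual b) :
    IsIso (HomologicalComplex.homologyMap ((truncTower.obj K).map f) i) := by
  have hab : OrderDual.ofDual b ≤ OrderDual.ofDual a := leOfHom f
  have := isIso_homologyMap_towerπ K a i (by lia)
  have h := isIso_homologyMap_towerπ K b i hi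
  rw [← towerπ_map K f, HomologicalComplex.homologyMap_comp] at h
  exact IsIso.of_isIso_comp_left (HomologicalComplex.homologyMap (towerπ K a) i) _

lemma exactAt_truncTower (K : ChainComplex D ℕ) (a : ℕᵒᵈ) (i : ℕ) (hi : OrderDual.ofDual a ≤ i) :
    ((truncTower.obj K).obj a).ExactAt i :=
  exactAt_truncQuot _ K i hi

/-- T_a → T_b is an isomorphism on H_i for i < b, and T_b has no homology from degree b on; the
latter covers i + 1 = b in the long exact sequence. -/
lemma exactAt_truncKernel (X : ComposableArrows ℕᵒᵈ 1) (K : ChainComplex D ℕ) (i : ℕ)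
    (hi : i < OrderDual.ofDual (X.obj 1)) : ((truncKernel D X).obj K).ExactAt i := by
  let f : X.obj 0 ⟶ X.obj 1 := X.map' 0 1
  have : Epi ((truncTower.obj K).map f) := epiTower_truncTower K f
  refine (shortExact_kernel ((truncTower.obj K).map f)).exactAt_X₁ i
    (by have := isIso_homologyMap_truncTower_map K f i hi; infer_instance) ?_
  rintro _ rfl
  by_cases hi' : i + 1 < OrderDual.ofDual (X.obj 1)
  · have := isIso_homologyMap_truncTower_map K f (i + 1) hi'
    infer_instance
  · have : IsZero (((truncTower.obj K).obj (X.obj 1)).homology (i + 1)) :=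
      (HomologicalComplex.exactAt_iff_isZero_homology _ _).1
        (exactAt_truncTower K _ _ (not_lt.1 hi'))
    exact ⟨fun _ _ _ => this.eq_of_src _ _⟩

lemma IsProjectiveFor.isZero_truncSpectralObject (hQ : IsProjectiveFor F Q)
    (X : ComposableArrows ℕᵒᵈ 1) (K : ChainComplex D ℕ) (m : ℤ)
    (hm : -m < OrderDual.ofDual (X.obj 1)) :
    IsZero (((hQ.truncSpectralObject.obj K).H m).obj X) := by
  by_cases hm' : 0 < m
  · exact hQ.isZero_towerSpectralObject _ X m hm'
  · obtain ⟨n, hn⟩ := Int.exists_eq_neg_ofNat (not_lt.1 hm')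
    refine IsZero.of_iso ?_ ((hQ.truncSpectralObjectEvalIso X n m hn).app K)
    exact hQ.isZero_hyper n (fun i hi => exactAt_truncKernel X K i (by lia))

end TruncationSpectralObject

/-! ### From spectral objects to first quadrant spectral sequences. -/

section FirstQuadrant

open Abelian ComposableArrows OrderDual

/-- The recipe for the construction of a homological first quadrant spectral sequence from a
spectral object indexed by `ℕᵒᵈ`. -/
def grothendieckCore :
    SpectralObject.SpectralSequenceDataCore ℕᵒᵈ
      (fun r : ℤ => ComplexShape.spectralSequenceNat (r - 1, -r)) 2 where
  -- Spectral objects are cohomological, so total degree s + t becomes -(s + t).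
  deg pq := -(pq.1 + pq.2 : ℤ)
  -- The cap s + t + 1 is not reached where a differential d^r leaves, since t ≥ r there. With it,
  -- and with truncated subtraction in `i₃`, page s + t + 2 uses the interval from s + t + 1 to 0
  -- that carries the abutment.
  i₀ r pq _ := toDual (min (pq.1 + (r - 1).toNat) (pq.1 + pq.2 + 1))
  i₁ pq := toDual (pq.1 + 1)
  i₂ pq := toDual pq.1
  i₃ r pq _ := toDual (pq.1 - (r - 2).toNat)
  le₀₁ r pq hr := toDual_le_toDual.2 (by lia)
  le₁₂ pq := toDual_le_toDual.2 (by lia)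
  le₂₃ r pq hr := toDual_le_toDual.2 (by lia)
  hc r pq pq' hpq hr := by
    simp only [ComplexShape.spectralSequenceNat_rel_iff] at hpq
    lia
  hc₀₂ r pq pq' hpq hr := by
    simp only [ComplexShape.spectralSequenceNat_rel_iff] at hpq
    exact congrArg toDual (by lia)
  hc₁₃ r pq pq' hpq hr := by
    simp only [ComplexShape.spectralSequenceNat_rel_iff] at hpq
    exact congrArg toDual (by lia)
  antitone_i₀ r r' pq hr hrr' := toDual_le_toDual.2 (by lia)
  monotone_i₃ r r' pq hr hrr' := toDual_le_toDual.2 (by lia)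
  i₀_prev r r' pq pq' hpq hrr' hr := by
    simp only [ComplexShape.spectralSequenceNat_rel_iff] at hpq
    exact congrArg toDual (by lia)
  i₃_next r r' pq pq' hpq hrr' hr := by
    simp only [ComplexShape.spectralSequenceNat_rel_iff] at hpq
    exact congrArg toDual (by lia)

instance : grothendieckCore.HasFirstPageComputation where
  hi₀₁ pq := congrArg toDual (by simp)
  hi₂₃ pq := congrArg toDual (by simp)

variable {A : Type*} [Category* A] [Abelian A] (Y : SpectralObject A ℕᵒᵈ)

/-- The vanishing condition for a spectral object indexed by `ℕᵒᵈ` to give a first quadrant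
spectral sequence. -/
class IsHomologicalFirstQuadrant : Prop where
  isZero (m : ℤ) (X : ComposableArrows ℕᵒᵈ 1) (h : -m < ofDual (X.obj 1)) : IsZero ((Y.H m).obj X)

lemma isZero_H_of_eq (m : ℤ) {a b : ℕᵒᵈ} (f : a ⟶ b) (hab : a = b) :
    IsZero ((Y.H m).obj (mk₁ f)) := by
  subst hab
  obtain rfl : f = 𝟙 _ := Subsingleton.elim _ _
  exact Y.isZero_H_map_mk₁_of_isIso m (𝟙 _)

variable [IsHomologicalFirstQuadrant Y]

instance : Y.HasSpectralSequence grothendieckCore where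
  isZero_H_obj_mk₁_i₀_le r r' pq hpq n hn hrr' hr := by
    -- Otherwise d^r would lead to (s + r - 1, t - r).
    have ht : pq.2 < r := by
      by_contra! ht
      refine hpq (pq.1 + (r - 1).toNat, pq.2 - r.toNat) ?_
      simp only [ComplexShape.spectralSequenceNat_rel_iff]
      lia
    change n = -(pq.1 + pq.2 : ℤ) + 1 at hn
    -- For r = t + 1 the lower end of the interval is s + t, and H vanishes there in homological
    -- degree s + t - 1. For larger r both ends are capped at s + t + 1 and the interval is trivial.
    by_cases h : pq.2 + 1 = r
    · apply IsHomologicalFirstQuadrant.isZero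
      change -n < (min (pq.1 + (r - 1).toNat) (pq.1 + pq.2 + 1) : ℕ)
      lia
    · exact isZero_H_of_eq _ _ _ (congrArg toDual (by lia))
  isZero_H_obj_mk₁_i₃_le r r' pq hpq n hn hrr' hr := by
    -- Otherwise d^r would arrive from (s - r + 1, t + r). Hence both ends of the interval are
    -- already 0.
    have hs : pq.1 + 1 < r := by
      by_contra! hs
      refine hpq (pq.1 - (r - 1).toNat, pq.2 + r.toNat) ?_
      simp only [ComplexShape.spectralSequenceNat_rel_iff]
      lia
    exact isZero_H_of_eq _ _ _ (congrArg toDual (by lia))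

/-- The first quadrant spectral sequence attached to a spectral object indexed by `ℕᵒᵈ`. -/
noncomputable def grothendieckSpectralSequence : E2SpectralSequence A :=
  Y.spectralSequence grothendieckCore

/-- The arrow `a ⟶ b` in `ℕᵒᵈ` for `b ≤ a`. -/
abbrev dualArrow {a b : ℕ} (h : b ≤ a) : toDual a ⟶ toDual b :=
  homOfLE (toDual_le_toDual.2 h)

/-- The second page of the spectral sequence. -/
noncomputable def grothendieckSecondPageIso (s t : ℕ) :
    ((grothendieckSpectralSequence Y).page 2).X (s, t) ≅
      (Y.H (-(s + t : ℤ))).obj (mk₁ (dualArrow s.le_succ)) :=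
  Y.spectralSequenceFirstPageXIso grothendieckCore (s, t) (toDual (s + 1)) (toDual s) rfl rfl _ rfl

/-- The page of the spectral sequence on which the term `E^∞_{s,t}` appears. -/
noncomputable def grothendieckPageInfinityIso (s t b₁ b₂ : ℕ) (hb₁ : b₁ = s + 1) (hb₂ : b₂ = s)
    (n₀ n₁ n₂ : ℤ) (h₁ : n₁ = -(s + t : ℤ)) (h₀ : n₀ + 1 = n₁) (h₂ : n₁ + 1 = n₂) :
    ((grothendieckSpectralSequence Y).page (s + t + 2)).X (s, t) ≅
      Y.E (dualArrow (show b₁ ≤ s + t + 1 by lia)) (dualArrow (show b₂ ≤ b₁ by lia))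
        (dualArrow b₂.zero_le) n₀ n₁ n₂ h₀ h₂ :=
  Y.spectralSequencePageXIso grothendieckCore (s + t + 2) (by lia) (s, t)
    (toDual (s + t + 1)) (toDual b₁) (toDual b₂) (toDual 0)
    (congrArg toDual (by simp; lia)) (congrArg toDual hb₁) (congrArg toDual hb₂)
    (congrArg toDual (by simp; lia)) n₀ n₁ n₂ h₁ h₀ h₂

end FirstQuadrant

/-! ### Images in an exact sequence and their quotients. -/

section ImageFiltration

variable {A : Type*} [Category* A] [Abelian A] {S : ShortComplex A} (hS : S.Exact)

lemma exact_factorThruImage (hS : S.Exact) :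
    (ShortComplex.mk S.f (factorThruImage S.g) (by
      rw [← cancel_mono (image.ι S.g), Category.assoc, image.fac, S.zero, zero_comp])).Exact := by
  rw [ShortComplex.exact_iff_exact_up_to_refinements]
  intro T x hx
  exact hS.exact_up_to_refinements x ((congrArg (x ≫ ·) (image.fac S.g).symm).trans
    ((Category.assoc x _ _).symm.trans ((congrArg (· ≫ image.ι S.g) hx).trans zero_comp)))

/-- The factorization through the image of `S.g` of a morphism which vanishes on `S.X₁`, for an
exact short complex `S`. -/
noncomputable def imageDesc {Z : A} (e : S.X₂ ⟶ Z) (he : S.f ≫ e = 0) : image S.g ⟶ Z :=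
  (exact_factorThruImage hS).desc e he

lemma factorThruImage_imageDesc {Z : A} (e : S.X₂ ⟶ Z) (he : S.f ≫ e = 0) :
    factorThruImage S.g ≫ imageDesc hS e he = e :=
  (exact_factorThruImage hS).g_desc e he

lemma preComp_imageDesc {B Z : A} (u : B ⟶ S.X₂) (w : B ⟶ S.X₃) (hw : u ≫ S.g = w)
    (i : image w ⟶ image S.g) (hi : i ≫ image.ι S.g = image.ι w)
    (e : S.X₂ ⟶ Z) (he : S.f ≫ e = 0) (hu : u ≫ e = 0) : i ≫ imageDesc hS e he = 0 := by
  have h : factorThruImage w ≫ i = u ≫ factorThruImage S.g := by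
    rw [← cancel_mono (image.ι S.g), Category.assoc, hi, image.fac, Category.assoc, image.fac, hw]
  rw [← cancel_epi (factorThruImage w), reassoc_of% h, factorThruImage_imageDesc, hu, comp_zero]

/-- By exactness, `image S.g` is X₂ modulo the image of `S.f`. As Z is X₂ modulo the images of `u`
and `S.f`, what dies in Z is the image of `u` in X₃, which is `image w`. -/
lemma shortExact_imageDesc {B Z : A} (u : B ⟶ S.X₂) (w : B ⟶ S.X₃) (hw : u ≫ S.g = w)
    (i : image w ⟶ image S.g) (hi : i ≫ image.ι S.g = image.ι w)
    (e : S.X₂ ⟶ Z) (he : S.f ≫ e = 0) (hu : u ≫ e = 0) (hepi : Epi e)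
    (h : (ShortComplex.mk (biprod.desc u S.f) e (by ext <;> simp [hu, he])).Exact) :
    (ShortComplex.mk i (imageDesc hS e he) (preComp_imageDesc hS u w hw i hi e he hu)).ShortExact
      where
  exact := by
    have hi' : factorThruImage w ≫ i = u ≫ factorThruImage S.g := by
      rw [← cancel_mono (image.ι S.g), Category.assoc, hi, image.fac, Category.assoc, image.fac, hw]
    rw [ShortComplex.exact_iff_exact_up_to_refinements]
    intro T x hx
    obtain ⟨T₁, p₁, _, y, hy⟩ := surjective_up_to_refinements_of_epi (factorThruImage S.g) x
    obtain ⟨T₂, p₂, _, z, hz⟩ := h.exact_up_to_refinements y (by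
      change y ≫ e = 0
      rw [← factorThruImage_imageDesc hS e he, ← Category.assoc, ← hy, Category.assoc]
      exact (congrArg (p₁ ≫ ·) hx).trans comp_zero)
    refine ⟨T₂, p₂ ≫ p₁, epi_comp _ _, z ≫ biprod.fst ≫ factorThruImage w, ?_⟩
    have hz' : p₂ ≫ y = z ≫ biprod.desc u S.f := hz
    have h0 : S.f ≫ factorThruImage S.g = 0 := by
      rw [← cancel_mono (image.ι S.g), Category.assoc, image.fac, S.zero, zero_comp]
    change _ = (z ≫ biprod.fst ≫ factorThruImage w) ≫ i
    have h1 : biprod.desc u S.f ≫ factorThruImage S.g = biprod.fst ≫ factorThruImage w ≫ i := by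
      ext <;> simp [h0, hi']
    rw [Category.assoc, hy, reassoc_of% hz', h1]
    exact (congrArg (z ≫ ·) (Category.assoc _ _ _).symm).trans (Category.assoc _ _ _).symm
  mono_f := mono_of_mono_fac hi
  epi_g := epi_of_epi_fac (factorThruImage_imageDesc hS e he)

end ImageFiltration

/-! ### The image filtration of a spectral object. -/

section

open Abelian (SpectralObject)
open ComposableArrows

variable {A ι : Type*} [Category* A] [Abelian A] [Category* ι] (Y : SpectralObject A ι)
  {i j k l : ι} (f₁ : i ⟶ j) (f₂ : j ⟶ k) (f₃ : k ⟶ l) (f₁₂ : i ⟶ k) (f₂₃ : j ⟶ l) (f : i ⟶ l)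
  (h₁₂ : f₁ ≫ f₂ = f₁₂) (h₂₃ : f₂ ≫ f₃ = f₂₃) (h : f₁₂ ≫ f₃ = f) (h' : f₁ ≫ f₂₃ = f)
  (n₀ n₁ n₂ : ℤ) (hn₁ : n₀ + 1 = n₁) (hn₂ : n₁ + 1 = n₂)

/-- The image of `H^n(f) ⟶ H^n(f ≫ g)`. -/
noncomputable abbrev imageH {i j k : ι} (f : i ⟶ j) (g : j ⟶ k) (fg : i ⟶ k) (h : f ≫ g = fg)
    (n : ℤ) : A :=
  image ((Y.H n).map (twoδ₂Toδ₁ f g fg h))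

include h₁₂ h₂₃ in
lemma map_twoδ₂Toδ₁_comp :
    (Y.H n₁).map (twoδ₂Toδ₁ f₁ f₂ f₁₂ h₁₂) ≫ (Y.H n₁).map (twoδ₂Toδ₁ f₁₂ f₃ f h) =
      (Y.H n₁).map (twoδ₂Toδ₁ f₁ f₂₃ f h') := by
  subst h₁₂ h₂₃
  rw [← Functor.map_comp]
  congr 1
  ext
  · exact Category.id_comp _
  · rfl

/-- The inclusion of the image of `H^n(f₁)` in the image of `H^n(f₁ ≫ f₂)`. -/
noncomputable def imageHIncl :
    imageH Y f₁ f₂₃ f h' n₁ ⟶ imageH Y f₁₂ f₃ f h n₁ :=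
  image.lift
    { I := _
      m := image.ι _
      e := (Y.H n₁).map (twoδ₂Toδ₁ f₁ f₂ f₁₂ h₁₂) ≫ factorThruImage _
      fac := by
        rw [Category.assoc, image.fac, map_twoδ₂Toδ₁_comp Y f₁ f₂ f₃ f₁₂ f₂₃ f h₁₂ h₂₃ h h'] }

lemma isZero_imageH (hf : IsZero ((Y.H n₁).obj (mk₁ f₁))) : IsZero (imageH Y f₁ f₂ f₁₂ h₁₂ n₁) :=
  IsZero.of_epi_eq_zero (factorThruImage ((Y.H n₁).map (twoδ₂Toδ₁ f₁ f₂ f₁₂ h₁₂)))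
    (hf.eq_of_src _ _)

lemma imageHIncl_ι :
    imageHIncl Y f₁ f₂ f₃ f₁₂ f₂₃ f h₁₂ h₂₃ h h' n₁ ≫ image.ι _ = image.ι _ :=
  image.lift_fac _

lemma δ_toCycles_πE : Y.δ f₁₂ f₃ n₀ n₁ hn₁ ≫ Y.toCycles f₁ f₂ f₁₂ h₁₂ n₁ ≫
    Y.πE f₁ f₂ f₃ n₀ n₁ n₂ hn₁ hn₂ = 0 := by
  have := (Y.cokernelSequenceE f₁ f₂ f₃ f₁₂ h₁₂ n₀ n₁ n₂ hn₁ hn₂).zero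
  exact (congrArg (· ≫ _) (biprod.inr_desc _ _).symm).trans ((Category.assoc _ _ _).trans
    ((congrArg (biprod.inr ≫ ·) this).trans comp_zero))

lemma map_toCycles_πE : (Y.H n₁).map (twoδ₂Toδ₁ f₁ f₂ f₁₂ h₁₂) ≫ Y.toCycles f₁ f₂ f₁₂ h₁₂ n₁ ≫
    Y.πE f₁ f₂ f₃ n₀ n₁ n₂ hn₁ hn₂ = 0 := by
  have := (Y.cokernelSequenceE f₁ f₂ f₃ f₁₂ h₁₂ n₀ n₁ n₂ hn₁ hn₂).zero
  exact (congrArg (· ≫ _) (biprod.inl_desc _ _).symm).trans ((Category.assoc _ _ _).trans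
    ((congrArg (biprod.inl ≫ ·) this).trans comp_zero))

/-- The morphism to `E^n(f₁, f₂, f₃)` from the image of `H^n(f₁ ≫ f₂)` in `H^n(f₁ ≫ f₂ ≫ f₃)`. -/
noncomputable def imageHπ : imageH Y f₁₂ f₃ f h n₁ ⟶ Y.E f₁ f₂ f₃ n₀ n₁ n₂ hn₁ hn₂ :=
  imageDesc (Y.exact₁ f₁₂ f₃ f h n₀ n₁ hn₁)
    (Y.toCycles f₁ f₂ f₁₂ h₁₂ n₁ ≫ Y.πE f₁ f₂ f₃ n₀ n₁ n₂ hn₁ hn₂)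
    (δ_toCycles_πE Y f₁ f₂ f₃ f₁₂ h₁₂ n₀ n₁ n₂ hn₁ hn₂)

lemma imageHIncl_π : imageHIncl Y f₁ f₂ f₃ f₁₂ f₂₃ f h₁₂ h₂₃ h h' n₁ ≫
    imageHπ Y f₁ f₂ f₃ f₁₂ f h₁₂ h n₀ n₁ n₂ hn₁ hn₂ = 0 :=
  preComp_imageDesc (Y.exact₁ f₁₂ f₃ f h n₀ n₁ hn₁) _ _ (map_twoδ₂Toδ₁_comp
    Y f₁ f₂ f₃ f₁₂ f₂₃ f h₁₂ h₂₃ h h' n₁) _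
    (imageHIncl_ι Y f₁ f₂ f₃ f₁₂ f₂₃ f h₁₂ h₂₃ h h' n₁) _ _
    (map_toCycles_πE Y f₁ f₂ f₃ f₁₂ h₁₂ n₀ n₁ n₂ hn₁ hn₂)

/-- `cokernelSequenceE` presents E(f₁, f₂, f₃) as H(f₁ ≫ f₂) modulo the image of H(f₁) and that of
the connecting map from H(f₃); the latter image is the kernel of H(f₁ ≫ f₂) → H(f). -/
lemma shortExact_imageH :
    (ShortComplex.mk _ _
      (imageHIncl_π Y f₁ f₂ f₃ f₁₂ f₂₃ f h₁₂ h₂₃ h h' n₀ n₁ n₂ hn₁ hn₂)).ShortExact :=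
  shortExact_imageDesc (Y.exact₁ f₁₂ f₃ f h n₀ n₁ hn₁)
    ((Y.H n₁).map (twoδ₂Toδ₁ f₁ f₂ f₁₂ h₁₂)) _
    (map_twoδ₂Toδ₁_comp Y f₁ f₂ f₃ f₁₂ f₂₃ f h₁₂ h₂₃ h h' n₁) _
    (imageHIncl_ι Y f₁ f₂ f₃ f₁₂ f₂₃ f h₁₂ h₂₃ h h' n₁)
    (Y.cokernelSequenceE f₁ f₂ f₃ f₁₂ h₁₂ n₀ n₁ n₂ hn₁ hn₂).g
    (δ_toCycles_πE Y f₁ f₂ f₃ f₁₂ h₁₂ n₀ n₁ n₂ hn₁ hn₂)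
    (map_toCycles_πE Y f₁ f₂ f₃ f₁₂ h₁₂ n₀ n₁ n₂ hn₁ hn₂)
    (inferInstanceAs (Epi (Y.cokernelSequenceE f₁ f₂ f₃ f₁₂ h₁₂ n₀ n₁ n₂ hn₁ hn₂).g))
    (Y.cokernelSequenceE_exact f₁ f₂ f₃ f₁₂ h₁₂ n₀ n₁ n₂ hn₁ hn₂)

end

/-! ### The filtered abutment and the infinity page. -/

section Abutment

open Abelian (SpectralObject)
open ComposableArrows OrderDual

variable {A : Type*} [Category* A] [Abelian A] (Y : SpectralObject A ℕᵒᵈ)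

/-- The abutment of the spectral sequence of a spectral object indexed by `ℕᵒᵈ`. -/
noncomputable abbrev abutment (n : ℕ) : A :=
  (Y.H (-n : ℤ)).obj (mk₁ (dualArrow (n + 1).zero_le))

/-- The filtration of the abutment. -/
noncomputable def abutmentFil (n p : ℕ) : A :=
  -- Step p is the part coming from levels between n + 1 - p and n + 1: zero for p = 0, everything
  -- for p = n + 1. For n = s + t, steps t and t + 1 start at levels s + 1 and s.
  imageH Y (dualArrow (show n + 1 - p ≤ n + 1 by lia)) (dualArrow (Nat.zero_le _))
    (dualArrow (n + 1).zero_le) rfl (-n : ℤ)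

/-- The inclusion of a step of the filtration in the abutment. -/
noncomputable def abutmentFilι (n p : ℕ) : abutmentFil Y n p ⟶ abutment Y n := image.ι _

instance (n p : ℕ) : Mono (abutmentFilι Y n p) := inferInstanceAs (Mono (image.ι _))

/-- The inclusion of a step of the filtration in the next one. -/
noncomputable def abutmentFilIncl (n p : ℕ) : abutmentFil Y n p ⟶ abutmentFil Y n (p + 1) :=
  imageHIncl Y _ (dualArrow (show n + 1 - (p + 1) ≤ n + 1 - p by lia)) _ _ _ _ rfl rfl rfl rfl _

lemma abutmentFilIncl_ι (n p : ℕ) :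
    abutmentFilIncl Y n p ≫ abutmentFilι Y n (p + 1) = abutmentFilι Y n p :=
  imageHIncl_ι ..

lemma isZero_abutmentFil (n : ℕ) : IsZero (abutmentFil Y n 0) :=
  isZero_imageH Y _ _ _ _ _ (isZero_H_of_eq Y _ _ rfl)

lemma isIso_abutmentFilι (n : ℕ) : IsIso (abutmentFilι Y n (n + 1)) := by
  have : Epi ((Y.H (-n : ℤ)).map (twoδ₂Toδ₁ (dualArrow (show n + 1 - (n + 1) ≤ n + 1 by lia))
      (dualArrow (Nat.zero_le _)) (dualArrow (n + 1).zero_le) rfl)) :=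
    (Y.exact₂ _ _ _ rfl _).epi_f ((isZero_H_of_eq Y _ _ (by simp)).eq_of_tgt _ _)
  have : Epi (abutmentFilι Y n (n + 1)) := epi_of_epi_fac (image.fac _)
  exact isIso_of_mono_of_epi _

variable [IsHomologicalFirstQuadrant Y]

/-- The isomorphism between `E^∞` and the subquotient of the abutment. -/
noncomputable abbrev abutmentPageInfinityIso (s t : ℕ) :=
  -- The levels s + 1 and s are written in the form in which the filtration produces them, which
  -- avoids transport along equalities of indices.
  grothendieckPageInfinityIso Y s t (s + t + 1 - t) (s + t + 1 - (t + 1)) (by lia) (by lia)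
    (-((s + t : ℕ) : ℤ) - 1) (-((s + t : ℕ) : ℤ)) (-((s + t : ℕ) : ℤ) + 1) (by lia) (by lia) rfl

/-- The projection from the filtration to `E^∞`. -/
noncomputable def abutmentFilπ (s t : ℕ) : abutmentFil Y (s + t) (t + 1) ⟶
    ((grothendieckSpectralSequence Y).page (s + t + 2)).X (s, t) :=
  imageHπ Y _ _ _ _ _ rfl rfl _ _ _ _ _ ≫ (abutmentPageInfinityIso Y s t).inv

lemma abutmentFilIncl_π (s t : ℕ) : abutmentFilIncl Y (s + t) t ≫ abutmentFilπ Y s t = 0 :=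
  (Category.assoc _ _ _).symm.trans
    ((congrArg (· ≫ _) (imageHIncl_π Y _ _ _ _ _ _ _ _ _ _ _ _ _ _ _)).trans zero_comp)

lemma shortExact_abutmentFil (s t : ℕ) :
    (ShortComplex.mk _ _ (abutmentFilIncl_π Y s t)).ShortExact := by
  refine ShortComplex.shortExact_of_iso ?_
    (shortExact_imageH Y (dualArrow (show s + t + 1 - t ≤ s + t + 1 by lia))
      (dualArrow (show s + t + 1 - (t + 1) ≤ s + t + 1 - t by lia)) (dualArrow (Nat.zero_le _))
      _ _ _ rfl rfl rfl rfl (-((s + t : ℕ) : ℤ) - 1) _ (-((s + t : ℕ) : ℤ) + 1) (by lia) rfl)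
  exact ShortComplex.isoMk (Iso.refl _) (Iso.refl _) (abutmentPageInfinityIso Y s t).symm
      ((Category.id_comp _).trans (Category.comp_id _).symm) (Category.id_comp _)

end Abutment

/-! ### Spectral objects and spectral sequences in functor categories. -/

section FunctorCategory

open Abelian (SpectralObject)
open ComposableArrows

variable {C : Type*} [Category* C] {E : Type*} [Category* E] [Abelian E] {ι : Type*} [Category* ι]

lemma exact_mk₂_of_app {F₁ F₂ F₃ : C ⥤ E} (f : F₁ ⟶ F₂) (g : F₂ ⟶ F₃)
    (h : ∀ X, (mk₂ (f.app X) (g.app X)).Exact) : (mk₂ f g).Exact := by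
  let S : ShortComplex (C ⥤ E) := ShortComplex.mk f g (by
    ext X
    exact (h X).toIsComplex.zero 0)
  have hS : S.Exact := S.exact_iff_isZero_homology.2 (Functor.isZero _ fun X =>
    IsZero.of_iso (((S.map ((evaluation C E).obj X)).exact_iff_isZero_homology).1 ((h X).exact 0))
      (S.mapHomologyIso ((evaluation C E).obj X)).symm)
  exact hS.exact_toComposableArrows

/-- The spectral object in the category of functors to `E` attached to a functor to the category
of spectral objects in `E`. -/
noncomputable def flipSpectralObject (Ψ : C ⥤ SpectralObject E ι) : SpectralObject (C ⥤ E) ι where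
  H n :=
    { obj D := Ψ ⋙ spectralObjectEval E D n
      map φ :=
        { app X := ((Ψ.obj X).H n).map φ
          naturality X Y f := (((Ψ.map f).hom n).naturality φ).symm }
      map_id D := by
        ext X
        exact ((Ψ.obj X).H n).map_id D
      map_comp φ ψ := by
        ext X
        exact ((Ψ.obj X).H n).map_comp φ ψ }
  δ' n₀ n₁ h :=
    { app D :=
        { app X := ((Ψ.obj X).δ' n₀ n₁ h).app D
          naturality X Y f := by
            obtain ⟨_, _, _, f₁, f₂, rfl⟩ := ComposableArrows.mk₂_surjective D
            exact ((Ψ.map f).comm n₀ n₁ h f₁ f₂).symm }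
      naturality D D' φ := by
        ext X
        exact ((Ψ.obj X).δ' n₀ n₁ h).naturality φ }
  exact₁' n₀ n₁ h D := exact_mk₂_of_app _ _ (fun X => (Ψ.obj X).exact₁' n₀ n₁ h D)
  exact₂' n D := exact_mk₂_of_app _ _ (fun X => (Ψ.obj X).exact₂' n D)
  exact₃' n₀ n₁ h D := exact_mk₂_of_app _ _ (fun X => (Ψ.obj X).exact₃' n₀ n₁ h D)

/-- The evaluation of a spectral sequence in a category of functors. -/
noncomputable def evalSpectralSequence {κ : Type*} {c : ℤ → ComplexShape κ} {r₀ : ℤ}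
    (S : SpectralSequence (C ⥤ E) c r₀) : C ⥤ SpectralSequence E c r₀ where
  obj X :=
    { page r hr := (((evaluation C E).obj X).mapHomologicalComplex (c r)).obj (S.page r hr)
      iso r r' pq hrr' hr := ((S.page r hr).sc pq).mapHomologyIso ((evaluation C E).obj X) ≪≫
        (S.iso r r' pq hrr' hr).app X }
  map {X Y} f :=
    { hom r hr := (NatTrans.mapHomologicalComplex ((evaluation C E).map f) (c r)).app (S.page r hr)
      comm r r' pq hrr' hr := by
        have h := NatTrans.app_homology ((evaluation C E).map f) ((S.page r hr).sc pq)
        have h' := (S.iso r r' pq hrr' hr).hom.naturality f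
        have h₁ : HomologicalComplex.homologyMap ((NatTrans.mapHomologicalComplex
            ((evaluation C E).map f) (c r)).app (S.page r hr)) pq ≫
            (((S.page r hr).sc pq).mapHomologyIso ((evaluation C E).obj Y)).hom =
            (((S.page r hr).sc pq).mapHomologyIso ((evaluation C E).obj X)).hom ≫
            ((evaluation C E).map f).app ((S.page r hr).homology pq) :=
          ((Iso.eq_inv_comp _).1 h).symm
        exact (Category.assoc _ _ _).symm.trans ((congrArg (· ≫ _) h₁).trans
          ((Category.assoc _ _ _).trans ((congrArg (_ ≫ ·) h').trans (
            Category.assoc _ _ _).symm))) }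
  map_id X := by
    ext r hr pq
    exact ((S.page r hr).X pq).map_id X
  map_comp f g := by
    ext r hr pq
    exact ((S.page r hr).X pq).map_comp f g

end FunctorCategory

/-! ### Functorial convergence. -/

section Convergence

open Abelian (SpectralObject)
open ComposableArrows OrderDual

variable {C : Type*} [Category* C] {E : Type*} [Category* E] [Abelian E]

instance (Ψ : C ⥤ SpectralObject E ℕᵒᵈ) [∀ X, IsHomologicalFirstQuadrant (Ψ.obj X)] :
    IsHomologicalFirstQuadrant (flipSpectralObject Ψ) where
  isZero m D h := Functor.isZero _ (fun _ => IsHomologicalFirstQuadrant.isZero m D h)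

variable (Ψ : C ⥤ SpectralObject E ℕᵒᵈ) [∀ X, IsHomologicalFirstQuadrant (Ψ.obj X)]

/-- The functorial spectral sequence attached to a functor to spectral objects indexed by `ℕᵒᵈ`. -/
noncomputable def functorialSpectralSequence : C ⥤ E2SpectralSequence E :=
  evalSpectralSequence (grothendieckSpectralSequence (flipSpectralObject Ψ))

/-- The second page of `functorialSpectralSequence Ψ`. -/
noncomputable def functorialSecondPageIso (s t : ℕ) :
    functorialSpectralSequence Ψ ⋙ pageTerm 2 le_rfl s t ≅
      Ψ ⋙ spectralObjectEval E (mk₁ (dualArrow s.le_succ)) (-(s + t : ℤ)) :=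
  NatIso.ofComponents
    (fun X => (grothendieckSecondPageIso (flipSpectralObject Ψ) s t).app X)
    (fun f => (grothendieckSecondPageIso (flipSpectralObject Ψ) s t).hom.naturality f)

/-- The convergence of `functorialSpectralSequence Ψ`. -/
noncomputable def functorialConvergesTo (H : ℕ → C ⥤ E)
    (e : ∀ n, abutment (flipSpectralObject Ψ) n ≅ H n) :
    ConvergesTo (functorialSpectralSequence Ψ) H where
  fil := abutmentFil (flipSpectralObject Ψ)
  ι n p := abutmentFilι (flipSpectralObject Ψ) n p ≫ (e n).hom
  mono_ι n p X := by
    have : Mono (abutmentFilι (flipSpectralObject Ψ) n p ≫ (e n).hom) := mono_comp _ _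
    infer_instance
  incl := abutmentFilIncl (flipSpectralObject Ψ)
  incl_ι n p := by
    rw [← Category.assoc, abutmentFilIncl_ι]
  isZero_fil n X := (isZero_abutmentFil (flipSpectralObject Ψ) n).obj X
  isIso_ι n := by
    have := isIso_abutmentFilι (flipSpectralObject Ψ) n
    exact IsIso.comp_isIso
  π s t :=
    { app X := (abutmentFilπ (flipSpectralObject Ψ) s t).app X
      naturality X Y f := (abutmentFilπ (flipSpectralObject Ψ) s t).naturality f }
  zero s t X := NatTrans.congr_app (abutmentFilIncl_π (flipSpectralObject Ψ) s t) X
  shortExact s t X :=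
    (shortExact_abutmentFil (flipSpectralObject Ψ) s t).map_of_exact ((evaluation C E).obj X)

end Convergence

/-! ### Left satellites as derived functors. -/

section SatellitesAsDerived

variable {C : Type*} [Category* C] [Abelian C] {E : Type*} [Category* E] [Abelian E]
  {F : C ⥤ E} [F.Additive] {P : ObjectProperty C}

/-- The resolution given by a cover of a complex concentrated in degree `0`. -/
abbrev Cover.resolution {X : C}
    (c : Cover (trivialFibrations C) (degreewise P) ((ChainComplex.single₀ C).obj X)) :
    Resolution P X where
  complex := c.obj.obj
  mem := c.obj.property
  π := c.π
  quasiIso := c.prop.2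

/-- The left satellites are derived functors along the inclusion of the objects in degree `0`. -/
noncomputable def IsProjectiveFor.derivedIsoLeftSatellite (hP : IsProjectiveFor F P) (n : ℕ) :
    (isResolving_chain hP.generating).derived (hP.inverts n) (ChainComplex.single₀ C)
      (fun _ => trivial) ≅ leftSatellite F hP n :=
  (isResolving_chain hP.generating).derivedIso (hP.inverts n) (ChainComplex.single₀ C)
    (fun _ => trivial)
    (fun X c => (leftSatelliteIso hP n c.resolution).symm)
    (fun X Y f c d r hr => by
      have h := hP.map_resolutionMap n f c.resolution d.resolution c.obj.obj (𝟙 _) r.hom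
        c.obj.property ((Category.id_comp _).trans hr)
      rw [CategoryTheory.Functor.map_id, Category.id_comp] at h
      have h₁ := hP.resolutionMap_comp n f (𝟙 Y) c.resolution d.resolution (hP.resolution Y)
      have h₂ := hP.resolutionMap_comp n (𝟙 X) f c.resolution (hP.resolution X) (hP.resolution Y)
      rw [Category.comp_id] at h₁
      rw [Category.id_comp] at h₂
      exact (congrArg (· ≫ _) h.symm).trans (h₁.symm.trans h₂))

end SatellitesAsDerived

/-! ### Hyperhomology of a complex concentrated in one degree. -/

section Shift

variable {D : Type*} [Category* D] [Abelian D] {E : Type*} [Category* E] [Abelian E]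
  {F : D ⥤ E} [F.Additive] {Q : ObjectProperty D}

/-- The embedding `i ↦ i + s`. -/
abbrev shiftEmbedding (s : ℕ) : (ComplexShape.down ℕ).Embedding (ComplexShape.down ℕ) :=
  ComplexShape.embeddingDown'Add 1 s

/-- Extending complexes by zero commutes with additive functors, degreewise. -/
noncomputable def mapExtendXIso (F : D ⥤ E) [F.Additive] (K : ChainComplex D ℕ) :
    ∀ o : Option ℕ, F.obj (HomologicalComplex.extend.X K o) ≅
      HomologicalComplex.extend.X ((F.mapHomologicalComplex (ComplexShape.down ℕ)).obj K) o
  | none => (F.map_isZero (isZero_zero D)).iso (isZero_zero E)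
  | some _ => Iso.refl _

lemma mapExtendXIso_comm (F : D ⥤ E) [F.Additive] (K : ChainComplex D ℕ) : ∀ o o' : Option ℕ,
    (mapExtendXIso F K o).hom ≫ HomologicalComplex.extend.d
      ((F.mapHomologicalComplex (ComplexShape.down ℕ)).obj K) o o' =
      F.map (HomologicalComplex.extend.d K o o') ≫ (mapExtendXIso F K o').hom
  | none, _ => (F.map_isZero (isZero_zero D)).eq_of_src _ _
  | some _, none => (isZero_zero E).eq_of_tgt _ _
  | some _, some _ => (Category.id_comp _).trans (Category.comp_id _).symm

lemma mapExtendXIso_naturality (F : D ⥤ E) [F.Additive] {K L : ChainComplex D ℕ} (f : K ⟶ L) :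
    ∀ o : Option ℕ, F.map (HomologicalComplex.extend.mapX f o) ≫ (mapExtendXIso F L o).hom =
      (mapExtendXIso F K o).hom ≫ HomologicalComplex.extend.mapX
        ((F.mapHomologicalComplex (ComplexShape.down ℕ)).map f) o
  | none => (isZero_zero E).eq_of_tgt _ _
  | some _ => (Category.comp_id _).trans (Category.id_comp _).symm

/-- Extending complexes by zero commutes with additive functors. -/
noncomputable def mapExtendNatIso (F : D ⥤ E) [F.Additive] (s : ℕ) :
    (shiftEmbedding s).extendFunctor D ⋙ F.mapHomologicalComplex (ComplexShape.down ℕ) ≅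
      F.mapHomologicalComplex (ComplexShape.down ℕ) ⋙ (shiftEmbedding s).extendFunctor E :=
  NatIso.ofComponents (fun K => HomologicalComplex.Hom.isoOfComponents
    (fun i => mapExtendXIso F K ((shiftEmbedding s).r i))
    (fun _ _ _ => mapExtendXIso_comm F K _ _)) (fun f => by
      ext i
      exact mapExtendXIso_naturality F f _)

/-- The homology of shifted complexes. -/
noncomputable def homologyMapShiftIso (F : D ⥤ E) [F.Additive] (s t : ℕ) :
    (shiftEmbedding s).extendFunctor D ⋙ homologyMapFunctor F (s + t) ≅ homologyMapFunctor F t :=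
  Functor.isoWhiskerRight (mapExtendNatIso F s) (HomologicalComplex.homologyFunctor E _ (s + t)) ≪≫
    Functor.isoWhiskerLeft (F.mapHomologicalComplex (ComplexShape.down ℕ))
      (NatIso.ofComponents (fun K => K.extendHomologyIso (shiftEmbedding s) (add_comm t s))
        (fun f => HomologicalComplex.extendHomologyIso_hom_naturality f _ _) :
        (shiftEmbedding s).extendFunctor E ⋙ HomologicalComplex.homologyFunctor E _ (s + t) ≅
          HomologicalComplex.homologyFunctor E _ t)

/-- Closure under isomorphism is not part of `IsProjectiveFor`; here and in `prop_of_iso` it comes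
from quasi-projectivity, applied to sequences that end in the given zero object of Q. -/
lemma IsProjectiveFor.prop_of_isZero (hQ : IsProjectiveFor F Q) {Z : D} (hZ : IsZero Z) : Q Z := by
  obtain ⟨Z', hZ', hZ''⟩ := hQ.additive.zero
  exact hQ.quasiProjective (ShortComplex.mk (0 : Z ⟶ Z') (0 : Z' ⟶ Z') comp_zero)
    { exact := ShortComplex.exact_of_isZero_X₂ _ hZ''
      mono_f := ⟨fun _ _ _ => hZ.eq_of_tgt _ _⟩
      epi_g := ⟨fun _ _ _ => hZ''.eq_of_src _ _⟩ } hZ' hZ'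

lemma IsProjectiveFor.prop_of_iso (hQ : IsProjectiveFor F Q) {X Y : D} (e : X ≅ Y) (hX : Q X) :
    Q Y := by
  obtain ⟨Z, hZ, hZ'⟩ := hQ.additive.zero
  exact hQ.quasiProjective (ShortComplex.mk e.inv (0 : X ⟶ Z) comp_zero)
    { exact := (ShortComplex.exact_iff_epi _ rfl).2 (inferInstanceAs (Epi e.inv))
      mono_f := inferInstanceAs (Mono e.inv)
      epi_g := ⟨fun _ _ _ => hZ'.eq_of_src _ _⟩ } hX hZ

lemma IsProjectiveFor.degreewise_extend (hQ : IsProjectiveFor F Q) {K : ChainComplex D ℕ}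
    (hK : degreewise Q K) (s : ℕ) : degreewise Q (K.extend (shiftEmbedding s)) := by
  intro i
  by_cases hi : ∃ j, (shiftEmbedding s).f j = i
  · obtain ⟨j, hj⟩ := hi
    exact hQ.prop_of_iso (K.extendXIso (shiftEmbedding s) hj).symm (hK j)
  · exact hQ.prop_of_isZero (K.isZero_extend_X _ i (fun j hj => hi ⟨j, hj⟩))

lemma trivialFibrations_extendMap {K L : ChainComplex D ℕ} {f : K ⟶ L}
    (hf : trivialFibrations D f) (s : ℕ) :
    trivialFibrations D (HomologicalComplex.extendMap f (shiftEmbedding s)) := by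
  obtain ⟨_, _⟩ := hf
  refine ⟨HomologicalComplex.epi_of_epi_f _ (fun i => ?_),
    (HomologicalComplex.quasiIso_extendMap_iff _ _).2 ‹_›⟩
  by_cases hi : ∃ j, (shiftEmbedding s).f j = i
  · obtain ⟨j, hj⟩ := hi
    rw [HomologicalComplex.extendMap_f f _ hj]
    infer_instance
  · exact ⟨fun _ _ _ => (L.isZero_extend_X _ i (fun j hj => hi ⟨j, hj⟩)).eq_of_src _ _⟩

lemma extendSingleIso_hom_naturality (e : (ComplexShape.down ℕ).Embedding (ComplexShape.down ℕ))
    {s s' : ℕ} (h : e.f s = s') {M N : D} (f : M ⟶ N) :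
    HomologicalComplex.extendMap ((HomologicalComplex.single D _ s).map f) e ≫
      (HomologicalComplex.extendSingleIso e N s s' h).hom =
    (HomologicalComplex.extendSingleIso e M s s' h).hom ≫
      (HomologicalComplex.single D (ComplexShape.down ℕ) s').map f := by
  refine HomologicalComplex.to_single_hom_ext ?_
  rw [HomologicalComplex.comp_f, HomologicalComplex.comp_f,
    HomologicalComplex.extendMap_f _ _ h, HomologicalComplex.extendSingleIso_hom_f,
    HomologicalComplex.extendSingleIso_hom_f, HomologicalComplex.single_map_f_self,
    HomologicalComplex.single_map_f_self]
  simp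

/-- The cover of a complex concentrated in degree `s` given by shifting a cover of a complex
concentrated in degree `0`. -/
noncomputable def IsProjectiveFor.shiftCover (hQ : IsProjectiveFor F Q) (s : ℕ) {M : D}
    (c : Cover (trivialFibrations D) (degreewise Q) ((ChainComplex.single₀ D).obj M)) :
    Cover (trivialFibrations D) (degreewise Q)
      ((HomologicalComplex.single D (ComplexShape.down ℕ) s).obj M) where
  obj := ⟨c.obj.obj.extend (shiftEmbedding s), hQ.degreewise_extend c.obj.property s⟩
  π := HomologicalComplex.extendMap c.π (shiftEmbedding s) ≫
    (HomologicalComplex.extendSingleIso (shiftEmbedding s) M 0 s (zero_add s)).hom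
  prop := by
    obtain ⟨_, _⟩ := trivialFibrations_extendMap c.prop s
    exact ⟨epi_comp _ _, inferInstance⟩

/-- The hyperhomology of a complex concentrated in degree `s`. -/
noncomputable def IsProjectiveFor.singleCompHyperIso (hQ : IsProjectiveFor F Q) (s t : ℕ) :
    HomologicalComplex.single D (ComplexShape.down ℕ) s ⋙ hQ.hyper (s + t) ≅
      leftSatellite F hQ t :=
  ((isResolving_chain hQ.generating).derivedIso (hQ.inverts t) (ChainComplex.single₀ D)
    (fun _ => trivial)
    (N := HomologicalComplex.single D (ComplexShape.down ℕ) s ⋙ hQ.hyper (s + t))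
    -- A resolution of M shifted by s resolves M in degree s, and the shift turns H_t into H_{s+t}.
    (fun M c => ((homologyMapShiftIso F s t).app c.obj.obj).symm ≪≫
      (hQ.hyperIso (s + t) (hQ.shiftCover s c)).symm)
    (fun M N f c d r hr => by
      have h₁ := (homologyMapShiftIso F s t).inv.naturality r.hom
      have h₂ := hQ.hyperIso_inv_naturality (s + t)
        ((HomologicalComplex.single D (ComplexShape.down ℕ) s).map f)
        (hQ.shiftCover s c) (hQ.shiftCover s d)
        (ObjectProperty.homMk (HomologicalComplex.extendMap r.hom (shiftEmbedding s))) (by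
          have h₃ : HomologicalComplex.extendMap c.π (shiftEmbedding s) ≫
              HomologicalComplex.extendMap ((ChainComplex.single₀ D).map f) (shiftEmbedding s) =
              HomologicalComplex.extendMap r.hom (shiftEmbedding s) ≫
                HomologicalComplex.extendMap d.π (shiftEmbedding s) :=
            (HomologicalComplex.extendMap_comp _ _ _).symm.trans ((congrArg
              (HomologicalComplex.extendMap · (shiftEmbedding s)) hr).trans
                (HomologicalComplex.extendMap_comp _ _ _))
          refine (Category.assoc _ _ _).trans ((congrArg (_ ≫ ·)
            (extendSingleIso_hom_naturality (shiftEmbedding s) (zero_add s) f).symm).trans ?_)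
          exact (Category.assoc _ _ _).symm.trans ((congrArg (· ≫ _) h₃).trans
            (Category.assoc _ _ _)))
      exact (Category.assoc _ _ _).symm.trans ((congrArg (· ≫ _) h₁).trans
        ((Category.assoc _ _ _).trans ((congrArg (_ ≫ ·) h₂).trans
          (Category.assoc _ _ _).symm))))).symm ≪≫
    hQ.derivedIsoLeftSatellite t

end Shift

/-! ### Projection of a complex to its only homology object. -/

section Concentrated

variable {D : Type*} [Category* D] [Abelian D]

/-- If the differential of `L` starting in degree `s` vanishes, this is the projection of `L` to
its homology in degree `s`. -/
noncomputable def toSingleHomology (L : ChainComplex D ℕ) (s : ℕ)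
    (h : L.d s ((ComplexShape.down ℕ).next s) = 0) :
    L ⟶ (HomologicalComplex.single D (ComplexShape.down ℕ) s).obj (L.homology s) :=
  HomologicalComplex.mkHomToSingle (L.liftCycles (𝟙 _) _ rfl (by rw [h, comp_zero]) ≫ L.homologyπ s)
    (fun i hi => by
      have : L.d i s ≫ L.liftCycles (𝟙 _) _ rfl (by rw [h, comp_zero]) = L.toCycles i s := by
        rw [← cancel_mono (L.iCycles s), Category.assoc, L.liftCycles_i, Category.comp_id,
          L.toCycles_i]
      rw [reassoc_of% this, L.toCycles_comp_homologyπ])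

lemma toSingleHomology_f (L : ChainComplex D ℕ) (s : ℕ)
    (h : L.d s ((ComplexShape.down ℕ).next s) = 0) :
    (toSingleHomology L s h).f s =
      L.liftCycles (𝟙 _) _ rfl (by rw [h, comp_zero]) ≫ L.homologyπ s ≫
        (HomologicalComplex.singleObjXSelf (ComplexShape.down ℕ) s (L.homology s)).inv := by
  rw [toSingleHomology, HomologicalComplex.mkHomToSingle_f, Category.assoc]

lemma toSingleHomology_naturality {L L' : ChainComplex D ℕ} (f : L ⟶ L') (s : ℕ)
    (h : L.d s ((ComplexShape.down ℕ).next s) = 0)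
    (h' : L'.d s ((ComplexShape.down ℕ).next s) = 0) :
    f ≫ toSingleHomology L' s h' = toSingleHomology L s h ≫
      (HomologicalComplex.single D _ s).map (HomologicalComplex.homologyMap f s) := by
  refine HomologicalComplex.to_single_hom_ext ?_
  have h₁ : f.f s ≫ L'.liftCycles (𝟙 _) _ rfl (by rw [h', comp_zero]) =
      L.liftCycles (𝟙 _) _ rfl (by rw [h, comp_zero]) ≫ HomologicalComplex.cyclesMap f s := by
    rw [← cancel_mono (L'.iCycles s), Category.assoc, L'.liftCycles_i, Category.assoc,
      HomologicalComplex.cyclesMap_i, L.liftCycles_i_assoc, Category.comp_id, Category.id_comp]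
  rw [HomologicalComplex.comp_f, HomologicalComplex.comp_f, toSingleHomology_f,
    toSingleHomology_f, HomologicalComplex.single_map_f_self, reassoc_of% h₁]
  simp

lemma trivialFibrations_toSingleHomology (L : ChainComplex D ℕ) (s : ℕ)
    (h : L.d s ((ComplexShape.down ℕ).next s) = 0) (hL : ∀ i ≠ s, L.ExactAt i) :
    trivialFibrations D (toSingleHomology L s h) := by
  refine ⟨HomologicalComplex.epi_of_epi_f _ (fun i => ?_), ⟨fun i => ?_⟩⟩
  · by_cases hi : i = s
    · subst hi
      have : Epi (L.liftCycles (𝟙 _) _ rfl (by rw [h, comp_zero])) := by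
        -- As the outgoing differential vanishes, the lift of the identity is inverse to the
        -- inclusion of cycles.
        have : L.iCycles i ≫ L.liftCycles (𝟙 _) _ rfl (by rw [h, comp_zero]) = 𝟙 _ := by
          rw [← cancel_mono (L.iCycles i), Category.assoc, L.liftCycles_i, Category.comp_id,
            Category.id_comp]
        exact (SplitEpi.mk _ this).epi
      rw [toSingleHomology_f]
      infer_instance
    · exact ⟨fun _ _ _ => (HomologicalComplex.isZero_single_obj_X _ _ _ _ hi).eq_of_src _ _⟩
  · by_cases hi : i = s
    · subst hi
      rw [quasiIsoAt_iff_isIso_homologyMap]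
      have : HomologicalComplex.homologyMap (toSingleHomology L i h) i ≫
          (HomologicalComplex.singleObjHomologySelfIso _ i (L.homology i)).hom = 𝟙 _ := by
        rw [← cancel_epi (L.homologyπ i), HomologicalComplex.homologyπ_naturality_assoc,
          HomologicalComplex.homologyπ_singleObjHomologySelfIso_hom,
          HomologicalComplex.singleObjCyclesSelfIso_hom, HomologicalComplex.cyclesMap_i_assoc,
          toSingleHomology_f]
        have h₁ : L.iCycles i ≫ L.liftCycles (𝟙 _) _ rfl (by rw [h, comp_zero]) = 𝟙 _ := by
          rw [← cancel_mono (L.iCycles i), Category.assoc, L.liftCycles_i, Category.comp_id,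
            Category.id_comp]
        simp [reassoc_of% h₁]
      rw [← Iso.eq_comp_inv] at this
      rw [this]
      infer_instance
    · rw [quasiIsoAt_iff_exactAt _ _ (hL i hi)]
      exact HomologicalComplex.exactAt_single_obj _ _ _ _ hi

end Concentrated

/-! ### The second page. -/

section SecondPage

open Abelian (SpectralObject)
open ComposableArrows OrderDual

variable {D : Type*} [Category* D] [Abelian D] {E : Type*} [Category* E] [Abelian E]
  {F : D ⥤ E} [F.Additive] {Q : ObjectProperty D}

lemma shortExact_truncKernel (X : ComposableArrows ℕᵒᵈ 1) (K : ChainComplex D ℕ) :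
    (ShortComplex.mk (kernelFunctorι (truncTower.obj K) X) _
      (kernelFunctorι_comp (truncTower.obj K) X)).ShortExact := by
  let f : X.obj 0 ⟶ X.obj 1 := X.map' 0 1
  have : Epi ((truncTower.obj K).map f) := epiTower_truncTower K f
  exact shortExact_kernel ((truncTower.obj K).map f)

/-- Below level b both truncations agree with K. The vanishing of terms, stronger than exactness,
makes the differential out of degree b zero, as the projection to homology requires. -/
lemma isZero_truncKernel_X (X : ComposableArrows ℕᵒᵈ 1) (K : ChainComplex D ℕ) (i : ℕ)
    (hi : i < ofDual (X.obj 1)) : IsZero (((truncKernel D X).obj K).X i) := by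
  change IsZero (((kernelFunctor (truncTower.obj K)).obj X).X i)
  let f : X.obj 0 ⟶ X.obj 1 := X.map' 0 1
  have h₁ : Mono ((towerπ K (X.obj 1)).f i) := mono_truncπ_f (ofDual (X.obj 1)) K i hi
  have h₂ : (towerπ K (X.obj 0)).f i ≫ ((truncTower.obj K).map f).f i = (towerπ K (X.obj 1)).f i :=
    congrArg (fun φ => HomologicalComplex.Hom.f φ i) (towerπ_map K f)
  have h₃ : IsIso ((towerπ K (X.obj 0)).f i) := by
    have := mono_of_mono_fac h₂
    exact isIso_of_mono_of_epi _
  have h₄ : Mono (((truncTower.obj K).map f).f i) := by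
    rw [← IsIso.eq_inv_comp] at h₂
    rw [h₂]
    exact mono_comp _ _
  have h₅ : (kernelFunctorι (truncTower.obj K) X).f i ≫ ((truncTower.obj K).map f).f i = 0 :=
    congrArg (fun φ => HomologicalComplex.Hom.f φ i) (kernelFunctorι_comp (truncTower.obj K) X)
  exact IsZero.of_mono_eq_zero ((kernelFunctorι (truncTower.obj K) X).f i)
    (by rwa [← cancel_mono (((truncTower.obj K).map f).f i), zero_comp])

lemma exactAt_truncKernel_of_le (X : ComposableArrows ℕᵒᵈ 1) (K : ChainComplex D ℕ) (i : ℕ)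
    (hi : ofDual (X.obj 0) ≤ i) : ((truncKernel D X).obj K).ExactAt i := by
  have hX : ofDual (X.obj 1) ≤ ofDual (X.obj 0) := leOfHom (X.map' 0 1)
  have h₀ : IsZero (((truncTower.obj K).obj (X.obj 0)).homology i) :=
    (HomologicalComplex.exactAt_iff_isZero_homology _ _).1 (exactAt_truncTower K _ _ hi)
  refine (shortExact_truncKernel X K).exactAt_X₁ i ⟨fun _ _ _ => h₀.eq_of_tgt _ _⟩ ?_
  rintro _ rfl
  have h₁ : IsZero (((truncTower.obj K).obj (X.obj 1)).homology (i + 1)) :=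
    (HomologicalComplex.exactAt_iff_isZero_homology _ _).1 (exactAt_truncTower K _ _ (by lia))
  exact ⟨fun _ _ _ => h₁.eq_of_src _ _⟩

/-- The homology in degree `i` of the kernel of a transition morphism `T_a ⟶ T_b` for
`b ≤ i < a`. -/
noncomputable def truncKernelHomologyIso (X : ComposableArrows ℕᵒᵈ 1) (i : ℕ)
    (hi₁ : ofDual (X.obj 1) ≤ i) (hi₀ : i < ofDual (X.obj 0)) :
    truncKernel D X ⋙ HomologicalComplex.homologyFunctor D _ i ≅
      HomologicalComplex.homologyFunctor D _ i :=
  have h₁ (K : ChainComplex D ℕ) (j : ℕ) (hj : i ≤ j) :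
      IsZero (((truncTower.obj K).obj (X.obj 1)).homology j) :=
    (HomologicalComplex.exactAt_iff_isZero_homology _ _).1 (exactAt_truncTower K _ _ (by lia))
  -- T_b has no homology in degrees i and i + 1, so the kernel and T_a have the same H_i; the
  -- comparison with K goes through K → T_a.
  have h (K : ChainComplex D ℕ) :
      IsIso (HomologicalComplex.homologyMap (kernelFunctorι (truncTower.obj K) X) i) := by
    have : Mono (HomologicalComplex.homologyMap (kernelFunctorι (truncTower.obj K) X) i) :=
      ((shortExact_truncKernel X K).homology_exact₁ (i + 1) i rfl).mono_g
        ((h₁ K (i + 1) (by lia)).eq_of_src _ _)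
    have : Epi (HomologicalComplex.homologyMap (kernelFunctorι (truncTower.obj K) X) i) :=
      ((shortExact_truncKernel X K).homology_exact₂ i).epi_f ((h₁ K i le_rfl).eq_of_tgt _ _)
    exact isIso_of_mono_of_epi _
  have h' (K : ChainComplex D ℕ) := isIso_homologyMap_towerπ K (X.obj 0) i hi₀
  NatIso.ofComponents (fun K =>
    @asIso _ _ _ _ _ (h K) ≪≫ (@asIso _ _ _ _ _ (h' K)).symm) (fun {K L} f => by
    have e₁ : (truncKernel D X).map f ≫ kernelFunctorι (truncTower.obj L) X =
        kernelFunctorι (truncTower.obj K) X ≫ (truncTower.map f).app (X.obj 0) :=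
      kernelFunctorMap_app_ι _ _
    have e₂ := towerπ_naturality f (X.obj 0)
    have e₁' : HomologicalComplex.homologyMap ((truncKernel D X).map f) i ≫
        HomologicalComplex.homologyMap (kernelFunctorι (truncTower.obj L) X) i =
        HomologicalComplex.homologyMap (kernelFunctorι (truncTower.obj K) X) i ≫
          HomologicalComplex.homologyMap ((truncTower.map f).app (X.obj 0)) i :=
      (HomologicalComplex.homologyMap_comp _ _ _).symm.trans
        ((congrArg (HomologicalComplex.homologyMap · i) e₁).trans
          (HomologicalComplex.homologyMap_comp _ _ _))
    have e₂' := (HomologicalComplex.homologyMap_comp _ _ _).symm.trans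
        ((congrArg (HomologicalComplex.homologyMap · i) e₂).trans
          (HomologicalComplex.homologyMap_comp _ _ _))
    refine (Category.assoc _ _ _).symm.trans ((congrArg (· ≫ _) e₁').trans ?_)
    refine (Category.assoc _ _ _).trans (Eq.trans ?_ (Category.assoc _ _ _).symm)
    refine congrArg (_ ≫ ·) ?_
    exact (CommSq.horiz_inv (f := @asIso _ _ _ _ _ (h' K)) (i := @asIso _ _ _ _ _ (h' L))
      ⟨e₂'⟩).w.symm)

/-- The terms of the second page of the hyperhomology spectral sequence. -/
noncomputable def IsProjectiveFor.truncSpectralObjectSecondPageIso (hQ : IsProjectiveFor F Q)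
    (s t : ℕ) :
    hQ.truncSpectralObject ⋙
      spectralObjectEval E (mk₁ (dualArrow s.le_succ)) (-(s + t : ℤ)) ≅
      HomologicalComplex.homologyFunctor D _ s ⋙ leftSatellite F hQ t :=
  let X : ComposableArrows ℕᵒᵈ 1 := mk₁ (dualArrow s.le_succ)
  have hX (K : ChainComplex D ℕ) : ((truncKernel D X).obj K).d s ((ComplexShape.down ℕ).next s)
    = 0 := by
    cases s with
    | zero => exact HomologicalComplex.shape _ _ _ (by simp)
    | succ s =>
      rw [ChainComplex.next_nat_succ]
      exact (isZero_truncKernel_X X K s s.lt_succ_self).eq_of_tgt _ _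
  let α : truncKernel D X ⟶ (truncKernel D X ⋙ HomologicalComplex.homologyFunctor D _ s) ⋙
      HomologicalComplex.single D _ s :=
    { app K := toSingleHomology ((truncKernel D X).obj K) s (hX K)
      naturality K L f := toSingleHomology_naturality ((truncKernel D X).map f) s (hX K) (hX L) }
  -- Between levels s + 1 and s only degree s carries homology, so `α` consists of trivial
  -- fibrations.
  have hα (K : ChainComplex D ℕ) : IsIso ((hQ.hyper (s + t)).map (α.app K)) :=
    hQ.isIso_hyper_map _ _ (isConnected_of_trivialFibrations _
      (trivialFibrations_toSingleHomology _ s (hX K) (fun i hi => by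
        obtain hi | hi := hi.lt_or_gt
        · exact exactAt_truncKernel X K i hi
        · exact exactAt_truncKernel_of_le X K i hi)) _)
  have : IsIso (Functor.whiskerRight α (hQ.hyper (s + t))) :=
    (NatTrans.isIso_iff_isIso_app _).2 hα
  hQ.truncSpectralObjectEvalIso X (s + t) _ (by simp) ≪≫
    asIso (Functor.whiskerRight α (hQ.hyper (s + t))) ≪≫
    Functor.associator _ _ _ ≪≫
    Functor.isoWhiskerRight (truncKernelHomologyIso X s le_rfl s.lt_succ_self)
      (HomologicalComplex.single D _ s ⋙ hQ.hyper (s + t)) ≪≫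
    Functor.isoWhiskerLeft _ (hQ.singleCompHyperIso s t)

end SecondPage

/-! ### Acyclic objects for a right exact functor. -/

section AcyclicObjects

variable {D : Type*} [Category* D] [Abelian D] {E : Type*} [Category* E] [Abelian E]
  {F : D ⥤ E} [F.Additive] {Q : ObjectProperty D}

lemma shortExact_single₀ {S : ShortComplex D} (hS : S.ShortExact) :
    (S.map (ChainComplex.single₀ D)).ShortExact := by
  refine HomologicalComplex.shortExact_of_degreewise_shortExact _ (fun i => ?_)
  cases i with
  | zero =>
    exact ShortComplex.shortExact_of_iso (S.mapNatIso
      (HomologicalComplex.singleCompEvalIsoSelf D (ComplexShape.down ℕ) 0).symm) hS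
  | succ i =>
    have h0 (X : D) : IsZero (((ChainComplex.single₀ D).obj X).X (i + 1)) :=
      HomologicalComplex.isZero_single_obj_X _ _ _ _ (by simp)
    exact
      { exact := ShortComplex.exact_of_isZero_X₂ _ (h0 S.X₂)
        mono_f := ⟨fun _ _ _ => (h0 S.X₁).eq_of_tgt _ _⟩
        epi_g := ⟨fun _ _ _ => (h0 S.X₃).eq_of_src _ _⟩ }

/-- A short exact sequence has a short exact sequence of resolutions. -/
lemma IsProjectiveFor.exists_shortExact_resolution (hQ : IsProjectiveFor F Q)
    {S : ShortComplex D} (hS : S.ShortExact) :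
    ∃ (A : Resolution Q S.X₁) (B : Resolution Q S.X₂) (C : Resolution Q S.X₃)
      (f : A.complex ⟶ B.complex) (g : B.complex ⟶ C.complex) (w : f ≫ g = 0),
      (ShortComplex.mk f g w).ShortExact ∧ f ≫ B.π = A.π ≫ (ChainComplex.single₀ D).map S.f := by
  have hS' := shortExact_single₀ hS
  let S' := S.map (ChainComplex.single₀ D)
  have : Mono S'.f := hS'.mono_f
  have : Epi S'.g := hS'.epi_g
  obtain ⟨C, p, hC, _, _⟩ := exists_cover hQ.generating S'.X₃
  -- Covering X₂ ×_{X₃} C makes B → C an epimorphism. Its kernel is the base change of `q` along X₁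
  -- → X₂ ×_{X₃} C, hence a resolution of X₁, with terms in Q by quasi-projectivity.
  obtain ⟨B, q, hB, _, _⟩ := exists_cover hQ.generating (pullback S'.g p)
  have := quasiIso_pullback_fst S'.g p
  have hq : QuasiIso (q ≫ pullback.fst S'.g p) := quasiIso_comp _ _
  let j : S'.X₁ ⟶ pullback S'.g p := pullback.lift S'.f 0 (by rw [S'.zero, zero_comp])
  have hj : j ≫ pullback.fst _ _ = S'.f := pullback.lift_fst _ _ _
  have hj' : j ≫ pullback.snd _ _ = 0 := pullback.lift_snd _ _ _
  have : Mono j := mono_of_mono_fac hj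
  have w : pullback.snd j q ≫ q ≫ pullback.snd _ _ = 0 := by
    rw [← pullback.condition_assoc, hj', comp_zero]
  have hR : (ShortComplex.mk (pullback.snd j q) (q ≫ pullback.snd _ _) w).ShortExact :=
    { exact := by
        refine ShortComplex.exact_of_f_is_kernel _ (KernelFork.IsLimit.ofι' _ _ (fun {T} x hx =>
          ?_))
        have hx' : (x ≫ q) ≫ pullback.snd _ _ = 0 := (Category.assoc _ _ _).trans hx
        have h₀ : (x ≫ q ≫ pullback.fst _ _) ≫ S'.g = 0 := by
          simp only [Category.assoc, pullback.condition]
          rw [← Category.assoc q, ← Category.assoc x, ← Category.assoc x, hx', zero_comp]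
        let y : T ⟶ S'.X₁ := hS'.exact.lift (x ≫ q ≫ pullback.fst _ _) h₀
        have hy : y ≫ S'.f = x ≫ q ≫ pullback.fst _ _ := hS'.exact.lift_f _ h₀
        have h₁ : y ≫ j = x ≫ q := by
          apply pullback.hom_ext
          · rw [Category.assoc, hj, hy, Category.assoc]
          · rw [Category.assoc, hj', comp_zero, hx']
        exact ⟨pullback.lift y x h₁, pullback.lift_snd _ _ _⟩
      mono_f := inferInstanceAs (Mono (pullback.snd j q))
      epi_g := epi_comp _ _ }
  have hR' := (HomologicalComplex.shortExact_iff_degreewise_shortExact _).1 hR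
  have := quasiIso_pullback_fst j q
  refine ⟨⟨_, fun i => hQ.quasiProjective _ (hR' i) (hB i) (hC i), pullback.fst j q, this⟩,
    ⟨B, hB, q ≫ pullback.fst _ _, hq⟩, ⟨C, hC, p, ‹_›⟩, _, _, w, hR, ?_⟩
  change pullback.snd j q ≫ q ≫ pullback.fst _ _ = pullback.fst j q ≫ S'.f
  rw [← pullback.condition_assoc, hj]

lemma IsProjectiveFor.shortExact_mapHomologicalComplex (hQ : IsProjectiveFor F Q)
    {R : ShortComplex (ChainComplex D ℕ)} (hR : R.ShortExact) (h₂ : degreewise Q R.X₂)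
    (h₃ : degreewise Q R.X₃) :
    (R.map (F.mapHomologicalComplex (ComplexShape.down ℕ))).ShortExact :=
  HomologicalComplex.shortExact_of_degreewise_shortExact _ (fun i => hQ.shortExact_map _
    ((HomologicalComplex.shortExact_iff_degreewise_shortExact _).1 hR i) (h₂ i) (h₃ i))

lemma IsAcyclicFor.isZero_homology {hQ : IsProjectiveFor F Q} {X : D} (hX : IsAcyclicFor F hQ X)
    (A : Resolution Q X) (n : ℕ) (hn : 0 < n) :
    IsZero (((F.mapHomologicalComplex (ComplexShape.down ℕ)).obj A.complex).homology n) :=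
  IsZero.of_iso (hX n hn) (leftSatelliteIso hQ n A).symm

lemma isAcyclicFor_of_isZero_homology (hQ : IsProjectiveFor F Q) {X : D} (A : Resolution Q X)
    (h : ∀ n, 0 < n →
      IsZero (((F.mapHomologicalComplex (ComplexShape.down ℕ)).obj A.complex).homology n)) :
    IsAcyclicFor F hQ X :=
  fun n hn => IsZero.of_iso (h n hn) (leftSatelliteIso hQ n A)

lemma IsProjectiveFor.isAcyclicFor (hQ : IsProjectiveFor F Q) {X : D} (hX : Q X) :
    IsAcyclicFor F hQ X := by
  refine isAcyclicFor_of_isZero_homology hQ ⟨(ChainComplex.single₀ D).obj X, ?_, 𝟙 _,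
    inferInstance⟩ (fun n hn => ?_)
  · rintro (_ | i)
    · exact hX
    · exact hQ.prop_of_isZero (HomologicalComplex.isZero_single_obj_X _ _ _ _ (by simp))
  · exact ShortComplex.isZero_homology_of_isZero_X₂ _ (F.map_isZero
      (HomologicalComplex.isZero_single_obj_X _ _ _ _ hn.ne'))

/-- The augmentation `K₀ ⟶ X` of a resolution `K` of `X`. -/
noncomputable def Resolution.ε {X : D} (A : Resolution Q X) : A.complex.X 0 ⟶ X := A.π.f 0

lemma Resolution.d_ε {X : D} (A : Resolution Q X) : A.complex.d 1 0 ≫ A.ε = 0 :=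
  (A.π.comm 1 0).symm.trans comp_zero

lemma Resolution.epi_ε {X : D} (A : Resolution Q X) : Epi A.ε := by
  have := A.epi_π
  exact inferInstanceAs (Epi (A.π.f 0))

lemma Resolution.exact_ε {X : D} (A : Resolution Q X) :
    (ShortComplex.mk _ _ A.d_ε).Exact := by
  have := A.quasiIso
  have hm : Mono (HomologicalComplex.homologyMap A.π 0) := inferInstance
  rw [HomologicalComplex.mono_homologyMap_iff_up_to_refinements _ 1 0 _
      (ChainComplex.prev _ _) rfl] at hm
  rw [ShortComplex.exact_iff_exact_up_to_refinements]
  intro T x hx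
  exact hm x (by rw [HomologicalComplex.shape _ _ _ (by simp), comp_zero]) 0
    (hx.trans zero_comp.symm)

lemma Resolution.ε_naturality {X Y : D} (A : Resolution Q X) (B : Resolution Q Y)
    (f : X ⟶ Y) (φ : A.complex ⟶ B.complex)
    (h : φ ≫ B.π = A.π ≫ (ChainComplex.single₀ D).map f) : φ.f 0 ≫ B.ε = A.ε ≫ f :=
  (congrArg (fun ψ => HomologicalComplex.Hom.f ψ 0) h).trans
    (congrArg (A.π.f 0 ≫ ·) (ChainComplex.single₀_map_f_zero f))

/-- The morphism `F(K₀)/F(K₁) ⟶ F(X)` for a resolution `K` of `X`. -/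
noncomputable def Resolution.opcyclesMapπ {X : D} (A : Resolution Q X) (F : D ⥤ E) [F.Additive] :
    ((F.mapHomologicalComplex (ComplexShape.down ℕ)).obj A.complex).opcycles 0 ⟶ F.obj X :=
  HomologicalComplex.descOpcycles _ (F.map A.ε) 1 (by simp)
    ((F.map_comp _ _).symm.trans ((congrArg F.map A.d_ε).trans (F.map_zero _ _)))

lemma Resolution.p_opcyclesMapπ {X : D} (A : Resolution Q X) :
    HomologicalComplex.pOpcycles _ 0 ≫ A.opcyclesMapπ F = F.map A.ε :=
  HomologicalComplex.p_descOpcycles _ _ _ _ _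

/-- Right exactness keeps K₁ → K₀ → X → 0 exact under F; in effect L₀F = F. -/
lemma Resolution.isIso_opcyclesMapπ [PreservesFiniteColimits F] {X : D} (A : Resolution Q X) :
    IsIso (A.opcyclesMapπ F) :=
  have h : ∀ S : ShortComplex D, S.Exact ∧ Epi S.g → (S.map F).Exact ∧ Epi (F.map S.g) :=
    (F.preservesFiniteColimits_tfae.out 3 1).1 ‹_›
  (ChainComplex.isIso_descOpcycles_iff _ _ _).2 (h _ ⟨A.exact_ε, A.epi_ε⟩)

lemma Resolution.opcyclesMapπ_naturality {X Y : D} (A : Resolution Q X) (B : Resolution Q Y)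
    (f : X ⟶ Y) (φ : A.complex ⟶ B.complex)
    (h : φ ≫ B.π = A.π ≫ (ChainComplex.single₀ D).map f) :
    HomologicalComplex.opcyclesMap
      ((F.mapHomologicalComplex (ComplexShape.down ℕ)).map φ) 0 ≫ B.opcyclesMapπ F =
        A.opcyclesMapπ F ≫ F.map f := by
  rw [← cancel_epi (HomologicalComplex.pOpcycles _ 0), HomologicalComplex.p_opcyclesMap_assoc,
    Resolution.p_opcyclesMapπ, ← Category.assoc, Resolution.p_opcyclesMapπ]
  exact (F.map_comp _ _).symm.trans ((congrArg F.map (A.ε_naturality B f φ h)).trans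
    (F.map_comp _ _))

/-- Only injectivity is missing. In the long exact sequence of resolutions, L₁F(X₃) = 0 makes
H₀(F(A)) → H₀(F(B)) a monomorphism, and this map is F(X₁) → F(X₂) by way of opcycles. -/
lemma IsProjectiveFor.shortExact_map_of_isAcyclicFor [PreservesFiniteColimits F]
    (hQ : IsProjectiveFor F Q) {S : ShortComplex D} (hS : S.ShortExact)
    (h₃ : IsAcyclicFor F hQ S.X₃) : (S.map F).ShortExact := by
  have hF : ∀ S : ShortComplex D, S.ShortExact → (S.map F).Exact ∧ Epi (F.map S.g) :=
    (F.preservesFiniteColimits_tfae.out 3 0).1 ‹_›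
  obtain ⟨h, h'⟩ := hF S hS
  obtain ⟨A, B, C, f, g, w, hR, hf⟩ := hQ.exists_shortExact_resolution hS
  have hT := hQ.shortExact_mapHomologicalComplex hR B.mem C.mem
  have h₀ : Mono ((homologyMapFunctor F 0).map f) := (hT.homology_exact₁ 1 0 rfl).mono_g
    ((h₃.isZero_homology C 1 one_pos).eq_of_src _ _)
  have h₁ : Mono (HomologicalComplex.opcyclesMap
      ((F.mapHomologicalComplex (ComplexShape.down ℕ)).map f) 0) := by
    have := ChainComplex.isoHomologyι₀_inv_naturality
      ((F.mapHomologicalComplex (ComplexShape.down ℕ)).map f)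
    have h₂ : Mono ((ChainComplex.isoHomologyι₀ _).inv ≫ HomologicalComplex.homologyMap
      ((F.mapHomologicalComplex (ComplexShape.down ℕ)).map f) 0) := @mono_comp _ _ _ _ _ _ _ _ h₀
    rw [this] at h₂
    exact @mono_of_mono _ _ _ _ _ _ _ h₂
  have := A.isIso_opcyclesMapπ (F := F)
  have := B.isIso_opcyclesMapπ (F := F)
  have h₂ := Resolution.opcyclesMapπ_naturality (F := F) A B S.f f hf
  rw [← IsIso.inv_comp_eq] at h₂
  exact
    { exact := h
      epi_g := h'
      mono_f := by
        change Mono (F.map S.f)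
        rw [← h₂]
        infer_instance }

/-- If `F` is right exact, the subcategory of `F`-acyclic objects is `F`-projective. -/
lemma IsProjectiveFor.isProjectiveFor_isAcyclicFor [PreservesFiniteColimits F]
    (hQ : IsProjectiveFor F Q) : IsProjectiveFor F (IsAcyclicFor F hQ) where
  additive :=
    { zero := by
        obtain ⟨Z, hZ, hZ'⟩ := hQ.additive.zero
        exact ⟨Z, hQ.isAcyclicFor hZ, hZ'⟩
      biprod X Y hX hY := by
        refine ⟨X ⊞ Y, ?_, ⟨Iso.refl _⟩⟩
        let S := ShortComplex.mk (biprod.inl : X ⟶ X ⊞ Y) (biprod.snd : X ⊞ Y ⟶ Y) (by simp)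
        have hS : S.ShortExact := (ShortComplex.Splitting.ofHasBinaryBiproduct X Y).shortExact
        obtain ⟨A, B, C, f, g, w, hR, -⟩ := hQ.exists_shortExact_resolution hS
        have hT := hQ.shortExact_mapHomologicalComplex hR B.mem C.mem
        exact isAcyclicFor_of_isZero_homology hQ B (fun n hn =>
          (hT.homology_exact₂ n).isZero_X₂ ((hX.isZero_homology A n hn).eq_of_src _ _)
            ((hY.isZero_homology C n hn).eq_of_tgt _ _)) }
  generating X := by
    obtain ⟨Y, p, hY, hp⟩ := hQ.generating X
    exact ⟨Y, p, hQ.isAcyclicFor hY, hp⟩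
  quasiProjective S hS h₂ h₃ := by
    obtain ⟨A, B, C, f, g, w, hR, -⟩ := hQ.exists_shortExact_resolution hS
    have hT := hQ.shortExact_mapHomologicalComplex hR B.mem C.mem
    exact isAcyclicFor_of_isZero_homology hQ A (fun n hn =>
      (hT.homology_exact₁ (n + 1) n rfl).isZero_X₂
        ((h₃.isZero_homology C (n + 1) n.succ_pos).eq_of_src _ _)
        ((h₂.isZero_homology B n hn).eq_of_tgt _ _))
  shortExact_map S hS _ h₃ := hQ.shortExact_map_of_isAcyclicFor hS h₃

end AcyclicObjects

/-! ### Identification of the abutment. -/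

section AbutmentIdentification

open Abelian (SpectralObject)
open ComposableArrows OrderDual

variable {D : Type*} [Category* D] [Abelian D] {E : Type*} [Category* E] [Abelian E]
  {F : D ⥤ E} [F.Additive] {Q : ObjectProperty D}

lemma isConnected_towerπ (K : ChainComplex D ℕ) (n : ℕ) :
    IsConnected n (towerπ K (toDual (n + 1))) where
  epi := inferInstance
  isIso i hi := isIso_homologyMap_towerπ K _ i (Nat.lt_succ_of_le hi)
  epi_homologyMap := by
    have : IsZero (((truncTower.obj K).obj (toDual (n + 1))).homology (n + 1)) :=
      (HomologicalComplex.exactAt_iff_isZero_homology _ _).1 (exactAt_truncTower K _ _ le_rfl)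
    exact ⟨fun _ _ _ => this.eq_of_src _ _⟩

/-- The abutment of the hyperhomology spectral sequence. -/
noncomputable def IsProjectiveFor.truncSpectralObjectAbutmentIso (hQ : IsProjectiveFor F Q)
    (n : ℕ) :
    hQ.truncSpectralObject ⋙
      spectralObjectEval E (mk₁ (dualArrow (n + 1).zero_le)) (-n : ℤ) ≅ hQ.hyper n :=
  let X : ComposableArrows ℕᵒᵈ 1 := mk₁ (dualArrow (n + 1).zero_le)
  let T : ChainComplex D ℕ ⥤ ChainComplex D ℕ :=
    truncTower ⋙ (evaluation _ _).obj (toDual (n + 1))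
  let α : truncKernel D X ⟶ T :=
    { app K := kernelFunctorι (truncTower.obj K) X
      naturality K L f := kernelFunctorMap_app_ι _ _ }
  let β : 𝟭 _ ⟶ T :=
    { app K := towerπ K (toDual (n + 1))
      naturality K L f := (towerπ_naturality f _).symm }
  -- T_0 = 0, so the kernel of T_{n+1} → T_0 is all of T_{n+1}.
  have hα (K : ChainComplex D ℕ) : IsIso (α.app K) := by
    have hK := shortExact_truncKernel X K
    have h0 : IsZero ((truncTower.obj K).obj (X.obj 1)) := isZero_truncQuot_zero K
    have : Mono (kernelFunctorι (truncTower.obj K) X) := hK.mono_f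
    have : Epi (kernelFunctorι (truncTower.obj K) X) := hK.exact.epi_f (h0.eq_of_tgt _ _)
    exact isIso_of_mono_of_epi (kernelFunctorι (truncTower.obj K) X)
  have hβ (K : ChainComplex D ℕ) : IsIso ((hQ.hyper n).map (β.app K)) :=
    hQ.isIso_hyper_map n _ (isConnected_towerπ K n)
  have : IsIso α := (NatTrans.isIso_iff_isIso_app _).2 hα
  have : IsIso (Functor.whiskerRight β (hQ.hyper n)) := (NatTrans.isIso_iff_isIso_app _).2 hβ
  hQ.truncSpectralObjectEvalIso X n _ rfl ≪≫ Functor.isoWhiskerRight (asIso α) (hQ.hyper n) ≪≫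
    (asIso (Functor.whiskerRight β (hQ.hyper n))).symm ≪≫ Functor.leftUnitor _

/-- The hyperhomology of complexes of `F`-acyclic objects. -/
noncomputable def IsProjectiveFor.compHyperIso [PreservesFiniteColimits F]
    (hQ : IsProjectiveFor F Q) (n : ℕ) {I : Type*} [Category* I] (T : I ⥤ ChainComplex D ℕ)
    (hT : ∀ i, degreewise (IsAcyclicFor F hQ) (T.obj i)) :
    T ⋙ hQ.hyper n ≅ T ⋙ homologyMapFunctor F n :=
  (hQ.derivedIsoCompHyper n T).symm ≪≫
  (isResolving_chain hQ.generating).derivedIso (hQ.inverts n) T (fun _ => trivial)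
    (N := T ⋙ homologyMapFunctor F n)
    (fun i c =>
      have := c.prop.1
      have := c.prop.2
      -- Objects of Q are acyclic, so `c.π` is a trivial fibration between complexes of acyclic
      -- objects, and these form an F-projective subcategory.
      have := hQ.isProjectiveFor_isAcyclicFor.isIso_map c.π
        (fun j => hQ.isAcyclicFor (c.obj.property j)) (hT i) n
      asIso ((homologyMapFunctor F n).map c.π))
    (fun _ _ _ _ _ _ hr => ((homologyMapFunctor F n).map_comp _ _).symm.trans
      ((congrArg (homologyMapFunctor F n).map hr.symm).trans
        ((homologyMapFunctor F n).map_comp _ _)))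

end AbutmentIdentification

/-! ### The spectral sequence of a composite functor. -/

section Composition

open Abelian (SpectralObject)
open ComposableArrows OrderDual

variable {C : Type*} [Category* C] [Abelian C] {D : Type*} [Category* D] [Abelian D]
  {E : Type*} [Category* E] [Abelian E] {G : C ⥤ D} {F : D ⥤ E} [G.Additive] [F.Additive]
  {P : ObjectProperty C} {Q : ObjectProperty D}

lemma IsProjectiveFor.comp [PreservesFiniteColimits F] (hP : IsProjectiveFor G P)
    (hQ : IsProjectiveFor F Q) (h : ∀ X, P X → IsAcyclicFor F hQ (G.obj X)) :
    IsProjectiveFor (G ⋙ F) P where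
  additive := hP.additive
  generating := hP.generating
  quasiProjective := hP.quasiProjective
  shortExact_map S hS h₂ h₃ :=
    hQ.shortExact_map_of_isAcyclicFor (hP.shortExact_map S hS h₂ h₃) (h _ h₃)

/-- The functor which sends a complex `R` of objects satisfying `P` to the hyperhomology spectral
object of `G(R)`. -/
noncomputable abbrev IsProjectiveFor.compSpectralObject (G : C ⥤ D) [G.Additive]
    (P : ObjectProperty C) (hQ : IsProjectiveFor F Q) :
    (degreewise P).FullSubcategory ⥤ SpectralObject E ℕᵒᵈ :=
  ((degreewise P).ι ⋙ G.mapHomologicalComplex (ComplexShape.down ℕ)) ⋙ hQ.truncSpectralObject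

/-- On complexes of objects of P, G preserves trivial fibrations: epimorphisms by right exactness,
quasi-isomorphisms by G-projectivity. -/
lemma IsProjectiveFor.inverts_compSpectralObject [PreservesFiniteColimits G]
    (hP : IsProjectiveFor G P) (hQ : IsProjectiveFor F Q) :
    Inverts (trivialFibrations C) (hQ.compSpectralObject G P) := by
  rintro R S p ⟨_, _⟩
  refine hQ.isIso_truncSpectralObject_map _ ⟨HomologicalComplex.epi_of_epi_f _ (fun i => ?_),
    ⟨fun i => ?_⟩⟩
  · exact inferInstanceAs (Epi (G.map (p.hom.f i)))
  · rw [quasiIsoAt_iff_isIso_homologyMap]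
    exact hP.isIso_map p.hom R.property S.property i

/-- The functor to spectral objects which gives the Grothendieck spectral sequence. -/
noncomputable def IsProjectiveFor.grothendieckSpectralObject [PreservesFiniteColimits G]
    (hP : IsProjectiveFor G P) (hQ : IsProjectiveFor F Q) : C ⥤ SpectralObject E ℕᵒᵈ :=
  (isResolving_chain hP.generating).derived (hP.inverts_compSpectralObject hQ)
    (ChainComplex.single₀ C) (fun _ => trivial)

instance [PreservesFiniteColimits G] (hP : IsProjectiveFor G P) (hQ : IsProjectiveFor F Q)
    (X : C) : IsHomologicalFirstQuadrant ((hP.grothendieckSpectralObject hQ).obj X) where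
  isZero m Y h := hQ.isZero_truncSpectralObject Y _ m h

/-- The second page of the Grothendieck spectral sequence. -/
noncomputable def IsProjectiveFor.grothendieckSecondPageIso [PreservesFiniteColimits G]
    (hP : IsProjectiveFor G P) (hQ : IsProjectiveFor F Q) (s t : ℕ) :
    hP.grothendieckSpectralObject hQ ⋙
      spectralObjectEval E (mk₁ (dualArrow s.le_succ)) (-(s + t : ℤ)) ≅
      leftSatellite G hP s ⋙ leftSatellite F hQ t :=
  -- For a complex R of objects of P the second page is L_tF(H_s(G(R))); deriving in R turns
  -- H_s(G(-)) into L_sG.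
  (isResolving_chain hP.generating).derivedCompCongr (hP.inverts_compSpectralObject hQ)
    (ChainComplex.single₀ C) (fun _ => trivial) (hP.inverts s) _ (leftSatellite F hQ t)
    (Functor.isoWhiskerLeft ((degreewise P).ι ⋙ G.mapHomologicalComplex (ComplexShape.down ℕ))
      (hQ.truncSpectralObjectSecondPageIso s t)) ≪≫
    Functor.isoWhiskerRight (hP.derivedIsoLeftSatellite s) (leftSatellite F hQ t)

/-- The abutment of the Grothendieck spectral sequence. -/
noncomputable def IsProjectiveFor.grothendieckAbutmentIso [PreservesFiniteColimits G]
    [PreservesFiniteColimits F] (hP : IsProjectiveFor G P) (hQ : IsProjectiveFor F Q)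
    (h : ∀ X, P X → IsAcyclicFor F hQ (G.obj X)) (n : ℕ) :
    hP.grothendieckSpectralObject hQ ⋙
      spectralObjectEval E (mk₁ (dualArrow (n + 1).zero_le)) (-n : ℤ) ≅
      leftSatellite (G ⋙ F) (hP.comp hQ h) n :=
  (isResolving_chain hP.generating).derivedCompCongr (hP.inverts_compSpectralObject hQ)
    (ChainComplex.single₀ C) (fun _ => trivial) ((hP.comp hQ h).inverts n) _ (𝟭 E)
    (Functor.isoWhiskerLeft ((degreewise P).ι ⋙ G.mapHomologicalComplex (ComplexShape.down ℕ))
      (hQ.truncSpectralObjectAbutmentIso n) ≪≫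
      hQ.compHyperIso n _ (fun R i => h _ (R.property i)) ≪≫ Iso.refl _) ≪≫
    Functor.rightUnitor _ ≪≫ (hP.comp hQ h).derivedIsoLeftSatellite n

end Composition

end GrothendieckSS

theorem mainTheorem11 {C D E : Type*} [Category* C] [Abelian C] [Category* D] [Abelian D]
    [Category* E] [Abelian E] (G : C ⥤ D) (F : D ⥤ E) [G.Additive] [F.Additive]
    [PreservesFiniteColimits G] [PreservesFiniteColimits F]
    (P : ObjectProperty C) (Q : ObjectProperty D)
    (hP : GrothendieckSS.IsProjectiveFor G P) (hQ : GrothendieckSS.IsProjectiveFor F Q)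
    (hacyclic : ∀ X : C, P X → GrothendieckSS.IsAcyclicFor F hQ (G.obj X)) :
    ∃ (hGF : GrothendieckSS.IsProjectiveFor (G ⋙ F) P)
      (𝓔 : C ⥤ GrothendieckSS.E2SpectralSequence E),
      (∀ s t : ℕ, Nonempty (𝓔 ⋙ GrothendieckSS.pageTerm 2 le_rfl s t ≅
        GrothendieckSS.leftSatellite G hP s ⋙ GrothendieckSS.leftSatellite F hQ t)) ∧
      Nonempty (GrothendieckSS.ConvergesTo 𝓔
        (fun n => GrothendieckSS.leftSatellite (G ⋙ F) hGF n)) := by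
  exact ⟨hP.comp hQ hacyclic,
    GrothendieckSS.functorialSpectralSequence (hP.grothendieckSpectralObject hQ),
    fun s t => ⟨GrothendieckSS.functorialSecondPageIso _ s t ≪≫
      hP.grothendieckSecondPageIso hQ s t⟩,
    ⟨GrothendieckSS.functorialConvergesTo _ _
      (fun n => hP.grothendieckAbutmentIso hQ hacyclic n)⟩⟩
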